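/- Let $F$ be a compact connected oriented smooth surface, possibly with boundary, and let $T$ be an oriented tangle in $F$ with components numbered $1,\dots,n$; let $\Lambda\subset\{1,\dots,n\}$ be the set of its long components (arcs with end points on $\partial F$), the other components being closed. Let $\mathscr D_T(F)$ be the set of all diagrams of $T$ in $F$, i.e. of all diagrams obtained from a given one by isotopies fixed on $\partial F$ and Reidemeister moves. A crossing has component index $(i,j)$ if component $i$ passes over component $j$ at it. Its order index $o\in\{0,1\}$ is, for a self-crossing of a long component, $0$ for an early overcrossing (the component first passes the crossing on the upper branch) and $1$ for an early undercrossing; for every other crossing $o=0$. A map $\tau$ assigning a value in $\mathbb Z_2=\{0,1\}$ to every crossing of every diagram in $\mathscr D_T(F)$ is called an index if it is preserved by isotopies and by Reidemeister moves (for every crossing that survives the move) and takes equal values on any two crossings to which a decreasing second Reidemeister move can be applied. An index is called an order if, whenever $c_1$ (upper/middle strand), $c_2$ (upper/lower strand) and $c_3$ (middle/lower strand) are the crossings of a triangle of a move $\Omega_{3b}$ (the third Reidemeister move with co-oriented strands and three positive crossings), the combination $\tau(c_1)=\tau(c_3)\neq\tau(c_2)$ does not occur. An order is called rough if its value on a crossing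 depends only on the component index of the crossing and, for self-crossings of long components, on its order index. (In particular, every order whose value depends on the component index alone is rough.) Given an ordered splitting $\mathscr C=(C_1,\dots,C_m)$ of $\{1,\dots,n\}$ into nonempty disjoint subsets, a vector $\epsilon\in\mathbb Z_2^m$ and a vector $\omega=(\omega_i)_{i\in\Lambda}\in\mathbb Z_2^{\Lambda}$ such that $C_k=\{i\}$ whenever $i\in C_k$, $i\in\Lambda$ and $\omega_i=1$, define, for a crossing $c$ with component index $(i,j)$ and order index $o(c)$, \[ \tau^{\mathscr C,\epsilon,\omega}(c)=\begin{cases}\epsilon_k+\omega_i\, o(c), & i,j\in C_k,\\ 0,& i\in C_k,\ j\in C_l,\ k>l,\\ 1,& i\in C_k,\ j\in C_l,\ k<l,\end{cases} \] where the term $\omega_i\,o(c)$ is understood to be $0$ if $i\notin\Lambda$. Proposition. For every rough order $\tau$ on $\mathscr D_T(F)$ there are $\mathscr C$, $\epsilon$ and $\omega$ as above with $\tau=\tau^{\mathscr C,\epsilon,\omega}$. -/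

import Mathlib

open Set Filter Topology
open scoped Manifold ContDiff

/-! ### Oriented surfaces -/

/-- The Euclidean plane. -/
abbrev Plane : Type := EuclideanSpace ℝ (Fin 2)

/-- The given atlas of the surface `F` (possibly with boundary) is an oriented atlas: all coordinate
changes have positive Jacobian determinant. -/
class OrientedSurface (F : Type*) [TopologicalSpace F] [ChartedSpace (EuclideanHalfSpace 2) F] :
    Prop where
  det_pos : ∀ φ ∈ atlas (EuclideanHalfSpace 2) F, ∀ ψ ∈ atlas (EuclideanHalfSpace 2) F,
    ∀ x ∈ φ.source ∩ ψ.source,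
      0 < (fderivWithin ℝ (ψ.extend (𝓡∂ 2) ∘ (φ.extend (𝓡∂ 2)).symm) (range (𝓡∂ 2))
        (φ.extend (𝓡∂ 2) x)).det

namespace Tangle

section Surface

variable {F : Type*} [TopologicalSpace F] [ChartedSpace (EuclideanHalfSpace 2) F]

/-- `e` is a smooth open embedding of the plane into the surface. -/
def IsPlaneEmbedding (e : Plane → F) : Prop :=
  IsOpenEmbedding e ∧ IsLocalDiffeomorph 𝓘(ℝ, Plane) (𝓡∂ 2) ∞ e

/-- `e` is a smooth open embedding of the plane into the surface which preserves orientation. -/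
def IsPositivePlaneEmbedding (e : Plane → F) : Prop :=
  IsPlaneEmbedding e ∧ ∀ x, 0 < (fderiv ℝ (extChartAt (𝓡∂ 2) (e x) ∘ e) x).det

/-- `e` is a smooth open embedding of the closed half-plane into the surface
(so that it takes the boundary line to the boundary of the surface). -/
def IsHalfPlaneEmbedding (e : EuclideanHalfSpace 2 → F) : Prop :=
  IsOpenEmbedding e ∧ IsLocalDiffeomorph (𝓡∂ 2) (𝓡∂ 2) ∞ e

end Surface

/-- The point `(u, 0)`, `u ≥ 0`, of the closed half-plane. -/
noncomputable def halfPlanePoint (u : ℝ) : EuclideanHalfSpace 2 :=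
  ⟨!₂[max u 0, 0], by simp⟩

/-- The closed square `[-1,1] × [-1,1]`, the standard disk. -/
def square : Set Plane := {p | |p 0| ≤ 1 ∧ |p 1| ≤ 1}

/-- The open square `(-1,1) × (-1,1)`. -/
def openSquare : Set Plane := {p | |p 0| < 1 ∧ |p 1| < 1}

/-! ### Parameters

The components of a tangle diagram are numbered by `Fin n`, and `Λ` is the set of long components.
A long component is parametrized by `[0,1]`, a closed one by `ℝ` with period `1`. -/

/-- The admissible parameters of the component `i`. -/
def paramDomain {n : ℕ} (Λ : Finset (Fin n)) (i : Fin n) : Set ℝ :=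
  {t | i ∈ Λ → t ∈ Icc (0 : ℝ) 1}

/-- A fundamental domain of parameters: `[0,1]` for a long component, `[0,1)` for a closed one. -/
def fundDomain {n : ℕ} (Λ : Finset (Fin n)) (i : Fin n) : Set ℝ :=
  {t | 0 ≤ t ∧ t ≤ 1 ∧ (i ∉ Λ → t < 1)}

/-- `s` and `t` are the same parameter on the component `i`. -/
def SameParam {n : ℕ} (Λ : Finset (Fin n)) (i : Fin n) (s t : ℝ) : Prop :=
  s = t ∨ (i ∉ Λ ∧ ∃ m : ℤ, s = t + m)

/-- The distinct points `(i,s)` and `(j,t)` of the parametrized curves `γ` have the same image. -/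
def IsDoublePair {F : Type*} {n : ℕ} (Λ : Finset (Fin n)) (γ : Fin n → ℝ → F)
    (i : Fin n) (s : ℝ) (j : Fin n) (t : ℝ) : Prop :=
  s ∈ fundDomain Λ i ∧ t ∈ fundDomain Λ j ∧ (i, s) ≠ (j, t) ∧ γ i s = γ j t

end Tangle

open Tangle

/-! ### Tangle diagrams -/

/-- A (classical, oriented) tangle diagram in the surface `F` with `n` numbered components, where the
components in `Λ` are long and the other ones are closed.  It is given by immersed curves, oriented
by their parametrizations, whose only multiple points are finitely many transverse double points in
the interior of `F`, and which meet `∂F` exactly at the end points of the long components,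
transversally; `upper` is the set of those parameters at which a curve passes a double point as the
overcrossing branch.  Immersion and transversality are expressed by local normal forms. -/
structure TangleDiagram (F : Type*) [TopologicalSpace F] [ChartedSpace (EuclideanHalfSpace 2) F]
    (n : ℕ) (Λ : Finset (Fin n)) where
  γ : Fin n → ℝ → F
  periodic : ∀ i ∉ Λ, ∀ t, γ i (t + 1) = γ i t
  immersed : ∀ i t, (i ∈ Λ → t ∈ Ioo (0 : ℝ) 1) →
    ∃ e : Plane → F, IsPlaneEmbedding e ∧ ∀ᶠ u in 𝓝 (0 : ℝ), γ i (t + u) = e !₂[u, 0]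
  boundary_iff : ∀ i, ∀ t ∈ fundDomain Λ i,
    (γ i t ∈ (𝓡∂ 2).boundary F ↔ i ∈ Λ ∧ (t = 0 ∨ t = 1))
  neat_start : ∀ i ∈ Λ, ∃ e : EuclideanHalfSpace 2 → F, IsHalfPlaneEmbedding e ∧
    ∀ᶠ u in 𝓝[≥] (0 : ℝ), γ i u = e (halfPlanePoint u)
  neat_end : ∀ i ∈ Λ, ∃ e : EuclideanHalfSpace 2 → F, IsHalfPlaneEmbedding e ∧
    ∀ᶠ u in 𝓝[≥] (0 : ℝ), γ i (1 - u) = e (halfPlanePoint u)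
  finite_double : {p : (Fin n × ℝ) × (Fin n × ℝ) |
    IsDoublePair Λ γ p.1.1 p.1.2 p.2.1 p.2.2}.Finite
  double_interior : ∀ i s j t, IsDoublePair Λ γ i s j t → γ i s ∉ (𝓡∂ 2).boundary F
  no_triple : ∀ i s j t k u, IsDoublePair Λ γ i s j t → IsDoublePair Λ γ i s k u →
    (j, t) = (k, u)
  transverse : ∀ i s j t, IsDoublePair Λ γ i s j t →
    ∃ e : Plane → F, IsPlaneEmbedding e ∧
      ∀ᶠ u in 𝓝 (0 : ℝ), γ i (s + u) = e !₂[u, 0] ∧ γ j (t + u) = e !₂[0, u]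
  upper : Set (Fin n × ℝ)
  upper_domain : ∀ i t, (i, t) ∈ upper → t ∈ paramDomain Λ i
  upper_periodic : ∀ i ∉ Λ, ∀ t, (i, t + 1) ∈ upper ↔ (i, t) ∈ upper
  upper_double : ∀ i, ∀ s ∈ fundDomain Λ i, (i, s) ∈ upper → ∃ j t, IsDoublePair Λ γ i s j t
  upper_iff : ∀ i s j t, IsDoublePair Λ γ i s j t → ((i, s) ∈ upper ↔ (j, t) ∉ upper)

namespace Tangle

section Diagrams

variable {F : Type*} [TopologicalSpace F] [ChartedSpace (EuclideanHalfSpace 2) F]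
  {n : ℕ} {Λ : Finset (Fin n)}

/-- A crossing of a diagram: a double point with its overcrossing and undercrossing branches. -/
structure Crossing (D : TangleDiagram F n Λ) where
  overComp : Fin n
  overTime : ℝ
  underComp : Fin n
  underTime : ℝ
  over_dom : overTime ∈ fundDomain Λ overComp
  under_dom : underTime ∈ fundDomain Λ underComp
  meet : D.γ overComp overTime = D.γ underComp underTime
  upper_mem : (overComp, overTime) ∈ D.upper
  upper_notMem : (underComp, underTime) ∉ D.upper

namespace Crossing

variable {D : TangleDiagram F n Λ}

/-- The position of the crossing in the surface. -/
def point (c : Crossing D) : F := D.γ c.overComp c.overTime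

/-- The component index `(i, j)`: the component `i` is the overcrossing one. -/
def componentIndex (c : Crossing D) : Fin n × Fin n := (c.overComp, c.underComp)

/-- The order index: for a self-crossing of a long component it is `0` for an early overcrossing and
`1` for an early undercrossing; for all other crossings it is `0`. -/
noncomputable def orderIndex (c : Crossing D) : ZMod 2 :=
  open Classical in
  if c.overComp = c.underComp ∧ c.overComp ∈ Λ ∧ c.underTime < c.overTime then 1 else 0

end Crossing

/-! ### Isotopies and local moves -/

/-- An isotopy of diagrams: an ambient isotopy `Φ` of `F`, fixed on the boundary, which takes `D` to
`D'` up to an orientation preserving change `ρ` of the parametrizations. -/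
structure Isotopy (D D' : TangleDiagram F n Λ) where
  Φ : ℝ → Diffeomorph (𝓡∂ 2) (𝓡∂ 2) F F ∞
  smooth : ContMDiff (𝓘(ℝ, ℝ).prod (𝓡∂ 2)) (𝓡∂ 2) ∞ (fun p : ℝ × F => Φ p.1 p.2)
  Φ_zero : ∀ x, Φ 0 x = x
  Φ_boundary : ∀ s, ∀ x ∈ (𝓡∂ 2).boundary F, Φ s x = x
  ρ : Fin n → ℝ ≃o ℝ
  ρ_long : ∀ i ∈ Λ, ρ i 0 = 0 ∧ ρ i 1 = 1
  ρ_closed : ∀ i ∉ Λ, ∀ t, ρ i (t + 1) = ρ i t + 1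
  γ_eq : ∀ i, ∀ t ∈ paramDomain Λ i, D'.γ i t = Φ 1 (D.γ i (ρ i t))
  upper_iff : ∀ i, ∀ t ∈ paramDomain Λ i, ((i, t) ∈ D'.upper ↔ (i, ρ i t) ∈ D.upper)

/-- A `k`-strand local tangle: `k` arcs in the standard square, each going from its left side to
its right side. -/
structure LocalTangle (k : ℕ) where
  strand : Fin k → ℝ → Plane
  inside : ∀ a, ∀ x ∈ Ioo (-1 : ℝ) 1, strand a x ∈ openSquare
  left : ∀ a, (strand a (-1)) 0 = -1 ∧ |(strand a (-1)) 1| < 1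
  right : ∀ a, (strand a 1) 0 = 1 ∧ |(strand a 1) 1| < 1

/-- All strands of the local tangle are graphs of functions: `y = f a x`. -/
def LocalTangle.IsGraph {k : ℕ} (S : LocalTangle k) (f : Fin k → ℝ → ℝ) : Prop :=
  ∀ a, ∀ x ∈ Icc (-1 : ℝ) 1, S.strand a x = !₂[x, f a x]

/-- A local move from `D` to `D'`: in the disk `B = e(square)` the diagram `D` is the local tangle
`src`, and `D'` is obtained by replacing it by the local tangle `tgt` with the same ends.  The strand
`a` of the local tangle is the part `θ a ([-1,1])` of the component `comp a`, run through in either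
direction.  (The over/under information inside `B` is not restricted here.) -/
structure LocalMove (D D' : TangleDiagram F n Λ) (k : ℕ) where
  e : Plane → F
  e_pos : IsPositivePlaneEmbedding e
  src : LocalTangle k
  tgt : LocalTangle k
  same_ends : ∀ a, src.strand a (-1) = tgt.strand a (-1) ∧ src.strand a 1 = tgt.strand a 1
  comp : Fin k → Fin n
  θ : Fin k → ℝ → ℝ
  θ_cont : ∀ a, ContinuousOn (θ a) (Icc (-1) 1)
  θ_mono : ∀ a, StrictMonoOn (θ a) (Icc (-1) 1) ∨ StrictAntiOn (θ a) (Icc (-1) 1)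
  θ_domain : ∀ a, ∀ x ∈ Icc (-1 : ℝ) 1, θ a x ∈ paramDomain Λ (comp a)
  src_eq : ∀ a, ∀ x ∈ Icc (-1 : ℝ) 1, D.γ (comp a) (θ a x) = e (src.strand a x)
  tgt_eq : ∀ a, ∀ x ∈ Icc (-1 : ℝ) 1, D'.γ (comp a) (θ a x) = e (tgt.strand a x)
  outside : ∀ i, ∀ t ∈ paramDomain Λ i,
    (∃ a, ∃ x ∈ Icc (-1 : ℝ) 1, comp a = i ∧ SameParam Λ i t (θ a x)) ∨
    (D.γ i t ∉ e '' square ∧ D'.γ i t = D.γ i t ∧ ((i, t) ∈ D'.upper ↔ (i, t) ∈ D.upper))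

namespace LocalMove

variable {D D' : TangleDiagram F n Λ} {k : ℕ}

/-- At every crossing of two different strands, in `src` and in `tgt`, the strand with the greater
height is the overcrossing one. -/
def IsLayered (M : LocalMove D D' k) (height : Fin k → ℕ) : Prop :=
  ∀ a b, a ≠ b → ∀ x ∈ Icc (-1 : ℝ) 1, ∀ y ∈ Icc (-1 : ℝ) 1,
    (M.src.strand a x = M.src.strand b y →
      ((M.comp a, M.θ a x) ∈ D.upper ↔ height b < height a)) ∧
    (M.tgt.strand a x = M.tgt.strand b y →
      ((M.comp a, M.θ a x) ∈ D'.upper ↔ height b < height a))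

/-- An increasing first Reidemeister move: an arc without crossings is replaced by an arc with
exactly one (self-)crossing. -/
def IsOmega1 (M : LocalMove D D' 1) : Prop :=
  (∃ f, M.src.IsGraph f) ∧
  ∃ u ∈ Icc (-1 : ℝ) 1, ∃ v ∈ Icc (-1 : ℝ) 1, u < v ∧
    ∀ x ∈ Icc (-1 : ℝ) 1, ∀ y ∈ Icc (-1 : ℝ) 1, x < y →
      (M.tgt.strand 0 x = M.tgt.strand 0 y ↔ x = u ∧ y = v)

/-- An increasing second Reidemeister move: two disjoint strands are replaced by two strands that
cross exactly twice, one of them passing over the other at both crossings. -/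
def IsOmega2 (M : LocalMove D D' 2) : Prop :=
  (∃ f g, M.src.IsGraph f ∧ M.tgt.IsGraph g ∧
    (∀ x ∈ Icc (-1 : ℝ) 1, f 0 x < f 1 x) ∧
    ∃ u ∈ Icc (-1 : ℝ) 1, ∃ v ∈ Icc (-1 : ℝ) 1, u < v ∧
      ∀ x ∈ Icc (-1 : ℝ) 1, (g 0 x = g 1 x ↔ x = u ∨ x = v)) ∧
  ∃ height, Function.Injective height ∧ M.IsLayered height

/-- The plane configurations of a third Reidemeister move.  At the left side the strands `0,1,2`
follow each other upwards, and any two of them cross exactly once.  Before the move the crossings,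
from left to right, are those of the pairs `01, 02, 12`, and after the move those of the pairs
`12, 02, 01`. -/
def IsTriangleMove (M : LocalMove D D' 3) : Prop :=
  ∃ f g, M.src.IsGraph f ∧ M.tgt.IsGraph g ∧ f 0 (-1) < f 1 (-1) ∧ f 1 (-1) < f 2 (-1) ∧
    (∃ x₀₁ ∈ Icc (-1 : ℝ) 1, ∃ x₀₂ ∈ Icc (-1 : ℝ) 1, ∃ x₁₂ ∈ Icc (-1 : ℝ) 1,
      x₀₁ < x₀₂ ∧ x₀₂ < x₁₂ ∧ ∀ x ∈ Icc (-1 : ℝ) 1,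
        (f 0 x = f 1 x ↔ x = x₀₁) ∧ (f 0 x = f 2 x ↔ x = x₀₂) ∧ (f 1 x = f 2 x ↔ x = x₁₂)) ∧
    (∃ y₀₁ ∈ Icc (-1 : ℝ) 1, ∃ y₀₂ ∈ Icc (-1 : ℝ) 1, ∃ y₁₂ ∈ Icc (-1 : ℝ) 1,
      y₁₂ < y₀₂ ∧ y₀₂ < y₀₁ ∧ ∀ x ∈ Icc (-1 : ℝ) 1,
        (g 0 x = g 1 x ↔ x = y₀₁) ∧ (g 0 x = g 2 x ↔ x = y₀₂) ∧ (g 1 x = g 2 x ↔ x = y₁₂))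

/-- A third Reidemeister move, with arbitrary orientations of the three strands and an arbitrary
choice of the upper, the middle and the lower strand. -/
def IsOmega3 (M : LocalMove D D' 3) : Prop :=
  M.IsTriangleMove ∧ ∃ height, Function.Injective height ∧ M.IsLayered height

/-- The third Reidemeister move `Ω₃b`: the three strands are oriented in the same direction and the
three crossings are positive, i.e. the strand `2` is the upper, `1` the middle and `0` the lower
one. -/
def IsOmega3b (M : LocalMove D D' 3) : Prop :=
  M.IsTriangleMove ∧ M.IsLayered (fun a => (a : ℕ)) ∧
    ∀ a, StrictMonoOn (M.θ a) (Icc (-1) 1)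

/-- The partial bijection of crossings induced by the move: crossings outside the disk stay where
they are, and a crossing of two strands in the disk corresponds to the crossing of the same strands
(the latter occurs for third Reidemeister moves only). -/
def Corresponds (M : LocalMove D D' k) (c : Crossing D) (c' : Crossing D') : Prop :=
  (c.point ∉ M.e '' square ∧ c'.point = c.point) ∨
  ∃ a b, a ≠ b ∧ ∃ x ∈ Icc (-1 : ℝ) 1, ∃ y ∈ Icc (-1 : ℝ) 1,
    ∃ x' ∈ Icc (-1 : ℝ) 1, ∃ y' ∈ Icc (-1 : ℝ) 1,
      c.point = M.e (M.src.strand a x) ∧ c.point = M.e (M.src.strand b y) ∧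
      c'.point = M.e (M.tgt.strand a x') ∧ c'.point = M.e (M.tgt.strand b y')

/-- `c` is the crossing of the strands `a` and `b` in the disk, before the move. -/
def IsSourceCrossing (M : LocalMove D D' k) (a b : Fin k) (c : Crossing D) : Prop :=
  ∃ x ∈ Icc (-1 : ℝ) 1, ∃ y ∈ Icc (-1 : ℝ) 1,
    c.point = M.e (M.src.strand a x) ∧ c.point = M.e (M.src.strand b y)

/-- `c` is the crossing of the strands `a` and `b` in the disk, after the move. -/
def IsTargetCrossing (M : LocalMove D D' k) (a b : Fin k) (c : Crossing D') : Prop :=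
  ∃ x ∈ Icc (-1 : ℝ) 1, ∃ y ∈ Icc (-1 : ℝ) 1,
    c.point = M.e (M.tgt.strand a x) ∧ c.point = M.e (M.tgt.strand b y)

end LocalMove

/-- `D'` is obtained from `D` by an isotopy or a Reidemeister move; the inverse moves are added in
`DiagramsOf`. -/
inductive Step (D D' : TangleDiagram F n Λ) : Prop
  | isotopy (I : Isotopy D D') : Step D D'
  | omega1 (M : LocalMove D D' 1) (h : M.IsOmega1) : Step D D'
  | omega2 (M : LocalMove D D' 2) (h : M.IsOmega2) : Step D D'
  | omega3 (M : LocalMove D D' 3) (h : M.IsOmega3) : Step D D'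

/-- The set of all diagrams of the tangle presented by the diagram `T`. -/
def DiagramsOf (T : TangleDiagram F n Λ) : Set (TangleDiagram F n Λ) :=
  {D | Relation.EqvGen Step T D}

/-! ### Traits, indices and orders -/

/-- An assignment of elements of `Θ` to all crossings of all diagrams of the tangle `T`. -/
abbrev Labelling (T : TangleDiagram F n Λ) (Θ : Type*) : Type _ :=
  ∀ D : DiagramsOf T, Crossing D.1 → Θ

variable {T : TangleDiagram F n Λ} {Θ : Type*}

/-- A trait: the labels of crossings are preserved by isotopies and Reidemeister moves. -/
structure IsTrait (τ : Labelling T Θ) : Prop where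
  isotopy : ∀ (D D' : DiagramsOf T) (I : Isotopy D.1 D'.1) (c : Crossing D.1) (c' : Crossing D'.1),
    c'.point = I.Φ 1 c.point → τ D c = τ D' c'
  omega1 : ∀ (D D' : DiagramsOf T) (M : LocalMove D.1 D'.1 1), M.IsOmega1 →
    ∀ c c', M.Corresponds c c' → τ D c = τ D' c'
  omega2 : ∀ (D D' : DiagramsOf T) (M : LocalMove D.1 D'.1 2), M.IsOmega2 →
    ∀ c c', M.Corresponds c c' → τ D c = τ D' c'
  omega3 : ∀ (D D' : DiagramsOf T) (M : LocalMove D.1 D'.1 3), M.IsOmega3 →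
    ∀ c c', M.Corresponds c c' → τ D c = τ D' c'

/-- An index: a trait with equal values on any two crossings to which a decreasing second
Reidemeister move can be applied. -/
structure IsIndex (τ : Labelling T Θ) : Prop extends IsTrait τ where
  eq_of_omega2 : ∀ (D D' : DiagramsOf T) (M : LocalMove D.1 D'.1 2), M.IsOmega2 →
    ∀ c₁ c₂ : Crossing D'.1, c₁.point ∈ M.e '' square → c₂.point ∈ M.e '' square →
      τ D' c₁ = τ D' c₂

/-- An order: a binary index such that, for the crossings `c₁` (upper and middle strand), `c₂` (upper
and lower strand), `c₃` (middle and lower strand) of a triangle of a move `Ω₃b`, one never has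
`τ(c₁) = τ(c₃) ≠ τ(c₂)`. -/
structure IsOrder (τ : Labelling T (ZMod 2)) : Prop extends IsIndex τ where
  source_triangle : ∀ (D D' : DiagramsOf T) (M : LocalMove D.1 D'.1 3), M.IsOmega3b →
    ∀ c₁ c₂ c₃ : Crossing D.1, M.IsSourceCrossing 2 1 c₁ → M.IsSourceCrossing 2 0 c₂ →
      M.IsSourceCrossing 1 0 c₃ → ¬ (τ D c₁ = τ D c₃ ∧ τ D c₃ ≠ τ D c₂)
  target_triangle : ∀ (D D' : DiagramsOf T) (M : LocalMove D.1 D'.1 3), M.IsOmega3b →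
    ∀ c₁ c₂ c₃ : Crossing D'.1, M.IsTargetCrossing 2 1 c₁ → M.IsTargetCrossing 2 0 c₂ →
      M.IsTargetCrossing 1 0 c₃ → ¬ (τ D' c₁ = τ D' c₃ ∧ τ D' c₃ ≠ τ D' c₂)

/-- The crossings, in all diagrams of the tangle, with component index `(i, j)`, order index `o` and
label `t`.  It is empty if and only if the set `H^t_ij` of the homotopy indices of these crossings
is empty. -/
def crossingSet (τ : Labelling T (ZMod 2)) (i j : Fin n) (o t : ZMod 2) :
    Set (Σ D : DiagramsOf T, Crossing D.1) :=
  {p | p.2.componentIndex = (i, j) ∧ p.2.orderIndex = o ∧ τ p.1 p.2 = t}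

/-- A rough order: an order whose value on a crossing is determined by its component index and, for
self-crossings of long components, its order index.  (An order whose value depends on the component
index alone is a special case.) -/
structure IsRoughOrder (τ : Labelling T (ZMod 2)) : Prop extends IsOrder τ where
  rough : ∀ i j o, crossingSet τ i j o 0 = ∅ ∨ crossingSet τ i j o 1 = ∅

end Diagrams

/-! ### The orders `τ^{C,ε,ω}` -/

/-- The data `(C, ε, ω)`: an ordered splitting of the components into `m` nonempty sets
`C k = {i | part i = k}`, a vector `ε ∈ {0,1}^m` and a vector `ω = w ∈ {0,1}^Λ` such that a
long component `i` with `w i = 1` forms a part of its own. -/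
structure RoughData (n : ℕ) (Λ : Finset (Fin n)) where
  m : ℕ
  part : Fin n → Fin m
  part_surjective : Function.Surjective part
  ε : Fin m → ZMod 2
  w : Λ → ZMod 2
  singleton_of_w : ∀ i : Λ, w i = 1 → ∀ j, part j = part i → j = i

/-- The labelling `τ^{C,ε,ω}`.  On a crossing with component index `(i, j)`, `i ∈ C k`, `j ∈ C l`, it
is `ε k + w i · o` if `k = l` (where `o` is the order index, and the second term is present for
long `i` only), `0` if `k > l` and `1` if `k < l`. -/
noncomputable def RoughData.label {n : ℕ} {Λ : Finset (Fin n)} (S : RoughData n Λ) {F : Type*}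
    [TopologicalSpace F] [ChartedSpace (EuclideanHalfSpace 2) F] (T : TangleDiagram F n Λ) :
    Labelling T (ZMod 2) := fun _ c =>
  if S.part c.overComp = S.part c.underComp then
    S.ε (S.part c.overComp) +
      (if h : c.overComp ∈ Λ then S.w ⟨c.overComp, h⟩ * c.orderIndex else 0)
  else if S.part c.underComp < S.part c.overComp then 0
  else 1

end Tangle

/-!
A rough order is a function `V i j o` of the component index `(i, j)` and the order index `o` of a
crossing. Everything known about it comes from the triangles of moves `Ω₃b`: such a triangle with
upper strand in `i`, middle strand in `j` and lower strand in `k` excludes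
`V i j 0 = V j k 0 ≠ V i k o`, where `o` is the order index of the crossing of the outer strands.
So the point is that all triangles with `i ≠ j` and `j ≠ k` occur in diagrams of the tangle; if
`i = k` is a long component, both values of `o` are needed (`IsOrder.exists_triangle`).

Such a triangle is found as follows. Choose three disjoint arcs on the components `k`, `j`, `i`, and
on each of them a point which is not a crossing. A finite set of interior points of a connected
surface lies in one embedded plane (`exists_planeEmbedding_of_finite`). By a shear and a Hermite
interpolation the coordinates of this plane are changed so that the three points lie on the vertical
axis and are passed from left to right (`exists_vertical`). By Sard's theorem in dimension one
almost every vertical line is transverse to the diagram and avoids its crossings, so one near the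
axis meets the three arcs in this way (`exists_regularLine`). Near a segment of this line the
diagram consists of graphs, which a further change of coordinates makes horizontal
(`exists_straight`). The result is a `Box`: a square in which the diagram consists of horizontal
strands, the three chosen ones among them and co-oriented (`exists_box`). In a box, families of
graphs over the horizontal axis can replace the strands (`Box.deform`), so that Reidemeister moves
in it reduce to statements about real functions. Second moves exchange neighbouring strands; hence
the chosen strands can be made the three lowest ones in the right order (`Box.exists_permute`,
`Box.exists_lowest`), and three more second moves produce the triangle (`Box.exists_triangle`).

The rest is combinatorics (`exists_roughData`). The relation `i = j ∨ V i j 0 = 1 ∨ V j i 0 = 0` is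
a total preorder by the triangle condition; its classes, in their order, are the sets `C_k`. Two
elements `i ≠ j` of one class satisfy `V i j 0 = V j i 0`, and the triangles with `i = k` show that
`V i i o` has the same value for every admissible `o`. Hence all values in a class with several
elements agree, and only a class with one element leaves room for a dependence on the order index.
-/

namespace Tangle

/-! ### Local diffeomorphisms -/

section LocalDiffeo

variable {E H M : Type*} [NormedAddCommGroup E] [NormedSpace ℝ E] [TopologicalSpace H]
  {I : ModelWithCorners ℝ E H} [TopologicalSpace M] [ChartedSpace H M]
  {E' H' N : Type*} [NormedAddCommGroup E'] [NormedSpace ℝ E'] [TopologicalSpace H']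
  {J : ModelWithCorners ℝ E' H'} [TopologicalSpace N] [ChartedSpace H' N]

lemma localDiffeo_eventually {f : M → N} {x : M} (hf : IsLocalDiffeomorphAt I J ∞ f x) :
    ∀ᶠ y in 𝓝 x, IsLocalDiffeomorphAt I J ∞ f y := by
  obtain ⟨Φ, hx, h⟩ := hf
  filter_upwards [Φ.open_source.mem_nhds hx] with y hy using ⟨Φ, hy, h⟩

/-- The identity of an open set. -/
def idOn (I : ModelWithCorners ℝ E H) (U : Set M) (hU : IsOpen U) :
    PartialDiffeomorph I I M M ∞ where
  toPartialEquiv := PartialEquiv.ofSet U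
  open_source := hU
  open_target := hU
  contMDiffOn_toFun := contMDiff_id.contMDiffOn
  contMDiffOn_invFun := contMDiff_id.contMDiffOn

lemma localDiffeo_id (x : M) : IsLocalDiffeomorphAt I I ∞ (id : M → M) x :=
  ⟨idOn I univ isOpen_univ, mem_univ x, fun _ _ => rfl⟩

lemma localDiffeo_congr {f g : M → N} {x : M} (hf : IsLocalDiffeomorphAt I J ∞ f x)
    (h : g =ᶠ[𝓝 x] f) : IsLocalDiffeomorphAt I J ∞ g x := by
  obtain ⟨Φ, hx, hΦ⟩ := hf
  obtain ⟨U, hU, hUo, hxU⟩ := eventually_nhds_iff.1 h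
  refine ⟨(idOn I U hUo).trans Φ, ?_, ?_⟩
  · simp [idOn, hx, hxU]
  · intro y hy
    have h1 : y ∈ U := hy.1
    have h2 : y ∈ Φ.source := hy.2
    rw [hU y h1, hΦ h2]
    rfl

lemma localDiffeo_comp {E'' H'' P : Type*} [NormedAddCommGroup E''] [NormedSpace ℝ E'']
    [TopologicalSpace H''] {K : ModelWithCorners ℝ E'' H''} [TopologicalSpace P]
    [ChartedSpace H'' P] {f : M → N} {g : N → P} {x : M} (hf : IsLocalDiffeomorphAt I J ∞ f x)
    (hg : IsLocalDiffeomorphAt J K ∞ g (f x)) : IsLocalDiffeomorphAt I K ∞ (g ∘ f) x :=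
  IsLocalDiffeomorphAt.comp (hf := hf) (hg := hg)

lemma localDiffeo_invFun [Nonempty M] {e : M → N} (he : Function.Injective e) {x : M}
    (hx : IsLocalDiffeomorphAt I J ∞ e x) :
    IsLocalDiffeomorphAt J I ∞ (Function.invFun e) (e x) := by
  refine localDiffeo_congr hx.localInverse_isLocalDiffeomorphAt ?_
  filter_upwards [hx.localInverse_eventuallyEq_right] with y hy
  have hy' : e (hx.localInverse y) = y := hy
  conv_lhs => rw [← hy']
  exact Function.leftInverse_invFun he _

end LocalDiffeo

/-- Inverse function theorem: a smooth map with injective differential is a local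
diffeomorphism. -/
lemma localDiffeo_of_fderiv {E : Type*} [NormedAddCommGroup E] [NormedSpace ℝ E]
    [FiniteDimensional ℝ E] {f : E → E} {x : E} (hf : ∀ᶠ y in 𝓝 x, ContDiffAt ℝ ∞ f y)
    (hx : ∀ v, fderiv ℝ f x v = 0 → v = 0) :
    IsLocalDiffeomorphAt 𝓘(ℝ, E) 𝓘(ℝ, E) ∞ f x := by
  have hinj : Function.Injective (fderiv ℝ f x : E →ₗ[ℝ] E) :=
    (injective_iff_map_eq_zero _).2 hx
  let L : E ≃L[ℝ] E := (LinearEquiv.ofInjectiveEndo _ hinj).toContinuousLinearEquiv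
  have hL : (L : E →L[ℝ] E) = fderiv ℝ f x := by ext v; rfl
  have hfx : ContDiffAt ℝ ∞ f x := hf.self_of_nhds
  have hd : HasFDerivAt f (L : E →L[ℝ] E) x := by
    rw [hL]; exact (hfx.differentiableAt (by simp)).hasFDerivAt
  let Φ := hfx.toOpenPartialHomeomorph f hd (by simp)
  have hcont : ContinuousAt (fderiv ℝ f) x :=
    (hfx.fderiv_right (m := ∞) (by simp)).continuousAt
  have hev : ∀ᶠ y in 𝓝 x, ContDiffAt ℝ ∞ f y ∧ ∃ A : E ≃L[ℝ] E, (A : E →L[ℝ] E) = fderiv ℝ f y := by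
    refine hf.and ?_
    have h1 := ContinuousLinearEquiv.nhds L
    rw [hL] at h1
    exact hcont h1
  obtain ⟨U, hU, hUo, hxU⟩ := eventually_nhds_iff.1 hev
  let Ψ := Φ.restrOpen U hUo
  have hΨs : ∀ y ∈ Ψ.source, y ∈ U := fun y hy => by
    have := (Φ.restrOpen_source U hUo) ▸ hy
    exact this.2
  have hΨc : (Ψ : E → E) = f := rfl
  refine ⟨⟨Ψ.toPartialEquiv, Ψ.open_source, Ψ.open_target, ?_, ?_⟩, ?_, fun y _ => rfl⟩
  · intro y hy
    exact (hU y (hΨs y hy)).1.contMDiffAt.contMDiffWithinAt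
  · intro y hy
    obtain ⟨h1, A, hA⟩ := hU _ (hΨs _ (Ψ.map_target hy))
    have : ContDiffAt ℝ ∞ Ψ.symm y := by
      refine Ψ.contDiffAt_symm (f₀' := A) hy ?_ ?_
      · rw [hA, hΨc]; exact (h1.differentiableAt (by simp)).hasFDerivAt
      · rw [hΨc]; exact h1
    exact this.contMDiffAt.contMDiffWithinAt
  · change x ∈ (Φ.restrOpen U hUo).source
    rw [Φ.restrOpen_source U hUo]
    exact ⟨hfx.mem_toOpenPartialHomeomorph_source hd (by simp), hxU⟩

lemma localDiffeo_contDiffAt {E E' : Type*} [NormedAddCommGroup E] [NormedSpace ℝ E]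
    [NormedAddCommGroup E'] [NormedSpace ℝ E'] {f : E → E'} {x : E}
    (hf : IsLocalDiffeomorphAt 𝓘(ℝ, E) 𝓘(ℝ, E') ∞ f x) : ContDiffAt ℝ ∞ f x :=
  hf.contMDiffAt.contDiffAt

lemma localDiffeo_fderiv_ne_zero {E E' : Type*} [NormedAddCommGroup E] [NormedSpace ℝ E]
    [NormedAddCommGroup E'] [NormedSpace ℝ E'] {f : E → E'} {x : E}
    (hf : IsLocalDiffeomorphAt 𝓘(ℝ, E) 𝓘(ℝ, E') ∞ f x) {v : E} (hv : fderiv ℝ f x v = 0) :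
    v = 0 := by
  have h := (hf.mfderivToContinuousLinearEquiv (by simp)).injective
  have h2 : ∀ w, hf.mfderivToContinuousLinearEquiv (by simp) w = fderiv ℝ f x w := by
    intro w
    rw [← mfderiv_eq_fderiv]; rfl
  apply h
  erw [h2 v, map_zero]
  exact hv

/-! ### Squeezing the plane into a small square -/

/-- A smooth increasing embedding of the line into the interval `(-r, r)` which is the identity
near `0`. -/
lemma exists_squeeze {r : ℝ} (hr : 0 < r) : ∃ σ : ℝ → ℝ, ContDiff ℝ ∞ σ ∧ (∀ u, 0 < deriv σ u) ∧
    (∀ u, |σ u| < r) ∧ ∀ᶠ u in 𝓝 (0 : ℝ), σ u = u := by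
  let b : ContDiffBump (0 : ℝ) := ⟨1, 2, one_pos, one_lt_two⟩
  let h : ℝ → ℝ := fun t => b t + (1 - b t) * (1 / (1 + t ^ 2))
  have hpos : ∀ t : ℝ, 0 < 1 + t ^ 2 := fun t => by positivity
  have hsm : ContDiff ℝ ∞ h := by
    have hb : ContDiff ℝ ∞ b := b.contDiff
    refine hb.add ((contDiff_const.sub hb).mul (contDiff_const.div (by fun_prop) ?_))
    exact fun t => (hpos t).ne'
  have hc : Continuous h := hsm.continuous
  have h0 : ∀ t, 0 < h t := by
    intro t
    have h1 : 0 ≤ b t := b.nonneg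
    have h2 : b t ≤ 1 := b.le_one
    have h3 : 0 < 1 / (1 + t ^ 2) := by have := hpos t; positivity
    have h4 : 1 / (1 + t ^ 2) ≤ 1 := by rw [div_le_one (hpos t)]; nlinarith
    change 0 < b t + (1 - b t) * (1 / (1 + t ^ 2))
    nlinarith
  have hle : ∀ t, h t ≤ 5 * (1 / (1 + t ^ 2)) := by
    intro t
    have h1 : 0 ≤ b t := b.nonneg
    have h2 : b t ≤ 1 := b.le_one
    have h3 : 0 < 1 / (1 + t ^ 2) := by have := hpos t; positivity
    change b t + (1 - b t) * (1 / (1 + t ^ 2)) ≤ _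
    rcases le_or_gt 2 |t| with ht | ht
    · have : b t = 0 := b.zero_of_le_dist (by simpa [b] using ht)
      rw [this]; linarith
    · have h5 : 1 ≤ 5 * (1 / (1 + t ^ 2)) := by
        rw [mul_one_div, le_div_iff₀ (hpos t)]
        have := abs_lt.1 ht
        nlinarith
      have h4 : 1 / (1 + t ^ 2) ≤ 1 := by rw [div_le_one (hpos t)]; nlinarith
      nlinarith
  let σ : ℝ → ℝ := fun u => ∫ t in (0 : ℝ)..u, h t
  have hd : ∀ u, HasDerivAt σ (h u) u := fun u =>
    intervalIntegral.integral_hasDerivAt_right (hc.intervalIntegrable _ _)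
      hc.stronglyMeasurable.stronglyMeasurableAtFilter hc.continuousAt
  have hσ : ContDiff ℝ ∞ σ := by
    rw [contDiff_infty_iff_deriv]
    refine ⟨fun u => (hd u).differentiableAt, ?_⟩
    rwa [funext fun u => (hd u).deriv]
  have hcc : Continuous fun t : ℝ => 5 * (1 / (1 + t ^ 2)) := by
    refine continuous_const.mul (continuous_const.div (by fun_prop) ?_)
    exact fun t => (hpos t).ne'
  have hI : ∀ a c : ℝ,
      ∫ t in a..c, 5 * (1 / (1 + t ^ 2)) = 5 * (Real.arctan c - Real.arctan a) := by
    intro a c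
    rw [intervalIntegral.integral_const_mul, integral_one_div_one_add_sq]
  have hb8 : ∀ u, |σ u| < 8 := by
    intro u
    have hpi := Real.pi_lt_d2
    have ha1 := Real.arctan_lt_pi_div_two u
    have ha2 := Real.neg_pi_div_two_lt_arctan u
    rcases le_total 0 u with hu | hu
    · have h1 : σ u ≤ ∫ t in (0 : ℝ)..u, 5 * (1 / (1 + t ^ 2)) :=
        intervalIntegral.integral_mono_on hu (hc.intervalIntegrable _ _)
        (hcc.intervalIntegrable _ _) (fun t _ => hle t)
      have h2 : 0 ≤ σ u := intervalIntegral.integral_nonneg hu (fun t _ => (h0 t).le)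
      rw [hI, Real.arctan_zero] at h1
      rw [abs_of_nonneg h2]; linarith
    · have h1 : ∫ t in u..0, h t ≤ ∫ t in u..0, 5 * (1 / (1 + t ^ 2)) :=
        intervalIntegral.integral_mono_on hu (hc.intervalIntegrable _ _)
        (hcc.intervalIntegrable _ _) (fun t _ => hle t)
      have h2 : 0 ≤ ∫ t in u..0, h t := intervalIntegral.integral_nonneg hu (fun t _ => (h0 t).le)
      have h3 : σ u = -∫ t in u..0, h t := intervalIntegral.integral_symm _ _
      rw [hI, Real.arctan_zero] at h1
      rw [h3, abs_neg, abs_of_nonneg h2]; linarith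
  have hid : ∀ u ∈ Ioo (-1 : ℝ) 1, σ u = u := by
    intro u hu
    have : σ u = ∫ t in (0 : ℝ)..u, (1 : ℝ) := by
      refine intervalIntegral.integral_congr fun t ht => ?_
      have hb1 : b t = 1 := by
        refine b.one_of_mem_closedBall ?_
        rw [Metric.mem_closedBall, dist_zero_right, Real.norm_eq_abs]
        have : |t - 0| ≤ |u - 0| := abs_sub_left_of_mem_uIcc ht
        rw [sub_zero, sub_zero] at this
        exact this.trans (abs_lt.2 hu).le
      change b t + (1 - b t) * (1 / (1 + t ^ 2)) = 1
      rw [hb1]; ring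
    rw [this]; simp
  refine ⟨fun u => r / 8 * σ (8 / r * u), ?_, ?_, ?_, ?_⟩
  · fun_prop
  · intro u
    have : HasDerivAt (fun u => r / 8 * σ (8 / r * u)) (r / 8 * (h (8 / r * u) * (8 / r * 1))) u :=
      ((hd _).comp u ((hasDerivAt_id u).const_mul (8 / r))).const_mul (r / 8)
    rw [this.deriv]
    have := h0 (8 / r * u)
    positivity
  · intro u
    rw [abs_mul, abs_of_pos (by positivity)]
    have := hb8 (8 / r * u)
    calc r / 8 * |σ (8 / r * u)| < r / 8 * 8 := by gcongr
      _ = r := by ring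
  · have : ∀ᶠ u in 𝓝 (0 : ℝ), 8 / r * u ∈ Ioo (-1 : ℝ) 1 := by
      have : ContinuousAt (fun u : ℝ => 8 / r * u) 0 := by fun_prop
      refine this.eventually (Ioo_mem_nhds ?_ ?_) <;> simp
    filter_upwards [this] with u hu
    rw [hid _ hu]; field_simp

/-! ### Maps of the plane -/

lemma pt_eta (p : Plane) : !₂[p 0, p 1] = p := by
  ext i; fin_cases i <;> simp

lemma plane_ext {p q : Plane} (h0 : p 0 = q 0) (h1 : p 1 = q 1) : p = q := by
  ext i; fin_cases i <;> simpa

lemma contDiffAt_pt {E : Type*} [NormedAddCommGroup E] [NormedSpace ℝ E] {f g : E → ℝ} {x : E}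
    (hf : ContDiffAt ℝ ∞ f x) (hg : ContDiffAt ℝ ∞ g x) :
    ContDiffAt ℝ ∞ (fun y => (!₂[f y, g y] : Plane)) x := by
  rw [contDiffAt_euclidean]
  intro i; fin_cases i <;> simpa

lemma contDiff_pt {E : Type*} [NormedAddCommGroup E] [NormedSpace ℝ E] {f g : E → ℝ}
    (hf : ContDiff ℝ ∞ f) (hg : ContDiff ℝ ∞ g) :
    ContDiff ℝ ∞ (fun y => (!₂[f y, g y] : Plane)) := by
  rw [contDiff_euclidean]
  intro i; fin_cases i <;> simpa

lemma hasDerivAt_pt {f g : ℝ → ℝ} {f' g' x : ℝ} (hf : HasDerivAt f f' x) (hg : HasDerivAt g g' x) :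
    HasDerivAt (fun y => (!₂[f y, g y] : Plane)) !₂[f', g'] x := by
  have : HasDerivAt (fun y => f y • (!₂[1, 0] : Plane) + g y • (!₂[0, 1] : Plane))
      (f' • (!₂[1, 0] : Plane) + g' • (!₂[0, 1] : Plane)) x :=
    (hf.smul_const _).add (hg.smul_const _)
  convert this using 1
  · ext y i; fin_cases i <;> simp
  · ext i; fin_cases i <;> simp

lemma continuous_pt {X : Type*} [TopologicalSpace X] {f g : X → ℝ} (hf : Continuous f)
    (hg : Continuous g) : Continuous (fun y => (!₂[f y, g y] : Plane)) := by
  refine (PiLp.continuous_toLp 2 _).comp (continuous_pi fun i => ?_)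
  fin_cases i <;> simpa

lemma contDiff_coord (i : Fin 2) : ContDiff ℝ ∞ (fun p : Plane => p i) :=
  contDiff_euclidean.1 contDiff_id i

lemma continuous_coord (i : Fin 2) : Continuous (fun p : Plane => p i) :=
  (contDiff_coord i).continuous

lemma fderiv_coord {E : Type*} [NormedAddCommGroup E] [NormedSpace ℝ E] {φ : E → Plane} {x : E}
    (h : DifferentiableAt ℝ φ x) (i : Fin 2) (v : E) :
    (fderiv ℝ φ x v) i = fderiv ℝ (fun y => φ y i) x v := by
  have : HasFDerivAt (fun y => φ y i) ((EuclideanSpace.proj i).comp (fderiv ℝ φ x)) x :=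
    (EuclideanSpace.proj i : Plane →L[ℝ] ℝ).hasFDerivAt.comp x h.hasFDerivAt
  rw [this.fderiv]; rfl

lemma hasFDerivAt_comp_coord {σ : ℝ → ℝ} {p : Plane} {i : Fin 2} (h : DifferentiableAt ℝ σ (p i)) :
    HasFDerivAt (fun q : Plane => σ (q i))
      (deriv σ (p i) • (EuclideanSpace.proj i : Plane →L[ℝ] ℝ)) p :=
  h.hasDerivAt.comp_hasFDerivAt p
    (EuclideanSpace.proj i : Plane →L[ℝ] ℝ).hasFDerivAt

/-- The product `(x, y) ↦ (σ x, τ y)` of two maps of the line. -/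
noncomputable def prodPlane (σ τ : ℝ → ℝ) (p : Plane) : Plane := !₂[σ (p 0), τ (p 1)]

@[simp] lemma prodPlane_zero (σ τ : ℝ → ℝ) (p : Plane) : prodPlane σ τ p 0 = σ (p 0) := rfl
@[simp] lemma prodPlane_one (σ τ : ℝ → ℝ) (p : Plane) : prodPlane σ τ p 1 = τ (p 1) := rfl

lemma contDiff_prodPlane {σ τ : ℝ → ℝ} (hσ : ContDiff ℝ ∞ σ) (hτ : ContDiff ℝ ∞ τ) :
    ContDiff ℝ ∞ (prodPlane σ τ) :=
  contDiff_pt (hσ.comp (contDiff_coord 0)) (hτ.comp (contDiff_coord 1))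

lemma fderiv_prodPlane {σ τ : ℝ → ℝ} (hσ : ContDiff ℝ ∞ σ) (hτ : ContDiff ℝ ∞ τ) (p v : Plane) :
    fderiv ℝ (prodPlane σ τ) p v = !₂[deriv σ (p 0) * v 0, deriv τ (p 1) * v 1] := by
  have hd := (contDiff_prodPlane hσ hτ).differentiable (by simp) p
  apply plane_ext
  · rw [fderiv_coord hd]
    simp only [prodPlane_zero]
    rw [(hasFDerivAt_comp_coord (hσ.differentiable (by simp) _)).fderiv]
    simp
  · rw [fderiv_coord hd]
    simp only [prodPlane_one]
    rw [(hasFDerivAt_comp_coord (hτ.differentiable (by simp) _)).fderiv]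
    simp

lemma det_fderiv_prodPlane {σ τ : ℝ → ℝ} (hσ : ContDiff ℝ ∞ σ) (hτ : ContDiff ℝ ∞ τ) (p : Plane) :
    (fderiv ℝ (prodPlane σ τ) p).det = deriv σ (p 0) * deriv τ (p 1) := by
  let b := (EuclideanSpace.basisFun (Fin 2) ℝ).toBasis
  rw [ContinuousLinearMap.det, ← LinearMap.det_toMatrix b, Matrix.det_fin_two]
  simp [LinearMap.toMatrix_apply, b, fderiv_prodPlane hσ hτ]

lemma localDiffeo_prodPlane {σ τ : ℝ → ℝ} (hσ : ContDiff ℝ ∞ σ) (hτ : ContDiff ℝ ∞ τ)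
    (hσ' : ∀ u, deriv σ u ≠ 0) (hτ' : ∀ u, deriv τ u ≠ 0) :
    IsLocalDiffeomorph 𝓘(ℝ, Plane) 𝓘(ℝ, Plane) ∞ (prodPlane σ τ) := by
  intro p
  refine localDiffeo_of_fderiv (.of_forall fun y => (contDiff_prodPlane hσ hτ).contDiffAt) ?_
  intro v hv
  rw [fderiv_prodPlane hσ hτ] at hv
  have h0 := congrArg (fun q : Plane => q 0) hv
  have h1 := congrArg (fun q : Plane => q 1) hv
  simp only [PiLp.zero_apply, Matrix.cons_val_zero, Matrix.cons_val_one,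
    mul_eq_zero] at h0 h1
  exact plane_ext (by simpa [hσ'] using h0) (by simpa [hτ'] using h1)

lemma injective_prodPlane {σ τ : ℝ → ℝ} (hσ : Function.Injective σ) (hτ : Function.Injective τ) :
    Function.Injective (prodPlane σ τ) := fun _ _ h =>
  plane_ext (hσ (congrArg (fun q : Plane => q 0) h)) (hτ (congrArg (fun q : Plane => q 1) h))

/-- A map `(x, y) ↦ (x, h (x, y))` is a local diffeomorphism where the derivative of `h` in the
direction of `y` does not vanish. -/
lemma localDiffeo_triangular {h : Plane → ℝ} {p : Plane} (hh : ∀ᶠ q in 𝓝 p, ContDiffAt ℝ ∞ h q)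
    (hp : fderiv ℝ h p !₂[0, 1] ≠ 0) :
    IsLocalDiffeomorphAt 𝓘(ℝ, Plane) 𝓘(ℝ, Plane) ∞ (fun q => (!₂[q 0, h q] : Plane)) p := by
  have hs : ∀ᶠ q in 𝓝 p, ContDiffAt ℝ ∞ (fun q => (!₂[q 0, h q] : Plane)) q := by
    filter_upwards [hh] with q hq using contDiffAt_pt (contDiff_coord 0).contDiffAt hq
  refine localDiffeo_of_fderiv hs fun v hv => ?_
  have hd := hs.self_of_nhds.differentiableAt (by simp)
  have h0 := congrArg (fun q : Plane => q 0) hv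
  have h1 := congrArg (fun q : Plane => q 1) hv
  simp only [fderiv_coord hd, PiLp.zero_apply, Matrix.cons_val_zero, Matrix.cons_val_one] at h0 h1
  have hv0 : v 0 = 0 := by
    have := (EuclideanSpace.proj 0 : Plane →L[ℝ] ℝ).hasFDerivAt (x := p)
    change fderiv ℝ (EuclideanSpace.proj 0 : Plane →L[ℝ] ℝ) p v = 0 at h0
    rw [this.fderiv] at h0
    exact h0
  have hv1 : v = v 1 • (!₂[0, 1] : Plane) := plane_ext (by simp [hv0]) (by simp)
  rw [hv1, map_smul, smul_eq_mul, mul_eq_zero, or_iff_left hp] at h1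
  exact plane_ext hv0 h1

lemma apply_invFun {F : Type*} {e : Plane → F} {q : F} (hq : q ∈ range e) :
    e (Function.invFun e q) = q := Function.invFun_eq hq

section Surface

variable {F : Type*} [TopologicalSpace F] [ChartedSpace (EuclideanHalfSpace 2) F]

lemma isPlaneEmbedding_of_injective {e : Plane → F}
    (h : IsLocalDiffeomorph 𝓘(ℝ, Plane) (𝓡∂ 2) ∞ e) (hi : Function.Injective e) :
    IsPlaneEmbedding e :=
  ⟨h.isLocalHomeomorph.isOpenEmbedding_of_injective hi, h⟩

lemma IsPlaneEmbedding.injective {e : Plane → F} (he : IsPlaneEmbedding e) :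
    Function.Injective e := he.1.injective

lemma IsPlaneEmbedding.comp {e : Plane → F} (he : IsPlaneEmbedding e) {φ : Plane → Plane}
    (hφ : IsLocalDiffeomorph 𝓘(ℝ, Plane) 𝓘(ℝ, Plane) ∞ φ) (hi : Function.Injective φ) :
    IsPlaneEmbedding (e ∘ φ) :=
  isPlaneEmbedding_of_injective (fun x => localDiffeo_comp (hφ x) (he.2 (φ x)))
    (he.injective.comp hi)

lemma IsPlaneEmbedding.localDiffeo_invFun {e : Plane → F} (he : IsPlaneEmbedding e) (p : Plane) :
    IsLocalDiffeomorphAt (𝓡∂ 2) 𝓘(ℝ, Plane) ∞ (Function.invFun e) (e p) :=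
  Tangle.localDiffeo_invFun he.injective (he.2 p)

lemma IsPlaneEmbedding.invFun_apply {e : Plane → F} (he : IsPlaneEmbedding e) (p : Plane) :
    Function.invFun e (e p) = p := Function.leftInverse_invFun he.injective p

lemma coord_abs_lt_mem_nhds (p : Plane) {s : Set Plane} (hs : s ∈ 𝓝 p) : ∃ r > 0, ∀ q : Plane,
    |q 0 - p 0| < r → |q 1 - p 1| < r → q ∈ s := by
  have : Continuous fun x : ℝ × ℝ => (!₂[p 0 + x.1, p 1 + x.2] : Plane) :=
    continuous_pt (by fun_prop) (by fun_prop)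
  have h1 : Tendsto (fun x : ℝ × ℝ => (!₂[p 0 + x.1, p 1 + x.2] : Plane)) (𝓝 (0, 0)) (𝓝 p) := by
    simpa [pt_eta] using this.tendsto (0, 0)
  obtain ⟨r, hr, h⟩ := Metric.mem_nhds_iff.1 (h1 hs)
  refine ⟨r, hr, fun q hq0 hq1 => ?_⟩
  have : (q 0 - p 0, q 1 - p 1) ∈ Metric.ball ((0, 0) : ℝ × ℝ) r := by
    rw [Metric.mem_ball, Prod.dist_eq, max_lt_iff]
    simpa [Real.dist_eq] using ⟨hq0, hq1⟩
  have h2 := h this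
  simpa [pt_eta] using h2

/-- Every germ of a local diffeomorphism from the plane to the surface is the germ of an embedding
of the whole plane. -/
lemma exists_planeEmbedding_germ {Φ : Plane → F}
    (h : IsLocalDiffeomorphAt 𝓘(ℝ, Plane) (𝓡∂ 2) ∞ Φ 0) :
    ∃ e : Plane → F, IsPlaneEmbedding e ∧ e =ᶠ[𝓝 0] Φ := by
  obtain ⟨Ψ, h0, hΨ⟩ := h
  obtain ⟨r, hr, hs⟩ := coord_abs_lt_mem_nhds 0 (Ψ.open_source.mem_nhds h0)
  obtain ⟨σ, hσ, hσ', hσr, hσid⟩ := exists_squeeze hr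
  have hmem : ∀ p, prodPlane σ σ p ∈ Ψ.source := fun p =>
    hs _ (by simpa using hσr _) (by simpa using hσr _)
  refine ⟨Φ ∘ prodPlane σ σ, isPlaneEmbedding_of_injective (fun p => ?_) ?_, ?_⟩
  · exact localDiffeo_comp
      (localDiffeo_prodPlane hσ hσ (fun u => (hσ' u).ne') (fun u => (hσ' u).ne') p)
      ⟨Ψ, hmem p, hΨ⟩
  · intro p q hpq
    have hinj := (strictMono_of_deriv_pos hσ').injective
    refine injective_prodPlane hinj hinj (Ψ.injOn (hmem p) (hmem q) ?_)
    simpa only [Function.comp, hΨ (hmem p), hΨ (hmem q)] using hpq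
  · have h0 : ∀ᶠ p : Plane in 𝓝 0, σ (p 0) = p 0 := by
      have := (continuous_coord 0).continuousAt (x := (0 : Plane)); exact this.eventually hσid
    have h1 : ∀ᶠ p : Plane in 𝓝 0, σ (p 1) = p 1 := by
      have := (continuous_coord 1).continuousAt (x := (0 : Plane)); exact this.eventually hσid
    filter_upwards [h0, h1] with p hp0 hp1
    simp only [Function.comp]
    congr 1
    exact plane_ext hp0 hp1

end Surface

section Surface

variable {F : Type*} [TopologicalSpace F] [ChartedSpace (EuclideanHalfSpace 2) F]

/-- A smooth curve in the image of a plane embedding is a smooth immersed curve in the coordinates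
of the embedding. -/
lemma planar_curve {e e₁ : Plane → F} (he : IsPlaneEmbedding e) (he₁ : IsPlaneEmbedding e₁)
    {c : ℝ → F} {t : ℝ} (h : ∀ᶠ u in 𝓝 (0 : ℝ), c (t + u) = e₁ !₂[u, 0]) (ht : c t ∈ range e) :
    (∀ᶠ s in 𝓝 t, c s ∈ range e) ∧
    (∀ᶠ s in 𝓝 t, ContDiffAt ℝ ∞ (fun s => Function.invFun e (c s)) s) ∧
    deriv (fun s => Function.invFun e (c s)) t ≠ 0 := by
  have hshift : Tendsto (fun s : ℝ => s - t) (𝓝 t) (𝓝 0) := by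
    have : Continuous fun s : ℝ => s - t := by fun_prop
    simpa using this.tendsto t
  have h' : ∀ᶠ s in 𝓝 t, c s = e₁ !₂[s - t, 0] := by
    filter_upwards [hshift.eventually h] with s hs
    simpa using hs
  have hz : (!₂[(0 : ℝ), 0] : Plane) = 0 := by ext i; fin_cases i <;> simp
  have hct : c t = e₁ 0 := by simpa [hz] using h'.self_of_nhds
  have hline : ContDiff ℝ ∞ (fun s : ℝ => (!₂[s - t, 0] : Plane)) :=
    contDiff_pt (by fun_prop) contDiff_const
  have hlt : Tendsto (fun s : ℝ => (!₂[s - t, 0] : Plane)) (𝓝 t) (𝓝 0) := by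
    simpa [hz] using hline.continuous.tendsto t
  obtain ⟨p, hp⟩ := ht
  have hΨ : IsLocalDiffeomorphAt 𝓘(ℝ, Plane) 𝓘(ℝ, Plane) ∞ (Function.invFun e ∘ e₁) 0 := by
    refine localDiffeo_comp (he₁.2 0) ?_
    rw [← hct, ← hp]
    exact he.localDiffeo_invFun p
  have hα : ∀ᶠ s in 𝓝 t, (fun s => Function.invFun e (c s)) =ᶠ[𝓝 s]
      fun s => (Function.invFun e ∘ e₁) !₂[s - t, 0] := by
    filter_upwards [h'.eventually_nhds] with s hs
    filter_upwards [hs] with s' hs'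
    simp only [hs', Function.comp]
  refine ⟨?_, ?_, ?_⟩
  · have hopen : range e ∈ 𝓝 (e₁ 0) := by
      rw [← hct, ← hp]
      exact he.1.isOpen_range.mem_nhds ⟨p, rfl⟩
    filter_upwards [h', hlt.eventually (he₁.1.continuous.continuousAt hopen)] with s h1 h2
    rw [h1]; exact h2
  · filter_upwards [hα, hlt.eventually (localDiffeo_eventually hΨ)] with s h1 h2
    refine ContDiffAt.congr_of_eventuallyEq ?_ h1
    exact ContDiffAt.comp (g := Function.invFun e ∘ e₁) (f := fun s : ℝ => (!₂[s - t, 0] : Plane)) s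
      (localDiffeo_contDiffAt h2) hline.contDiffAt
  · rw [hα.self_of_nhds.deriv_eq]
    have hdl : HasDerivAt (fun s : ℝ => (!₂[s - t, 0] : Plane)) !₂[1, 0] t := by
      refine hasDerivAt_pt ?_ (hasDerivAt_const t 0)
      exact (hasDerivAt_id t).sub_const t
    have hd : HasFDerivAt (Function.invFun e ∘ e₁) (fderiv ℝ (Function.invFun e ∘ e₁) 0)
        (!₂[t - t, 0] : Plane) := by
      rw [sub_self, hz]
      exact ((localDiffeo_contDiffAt hΨ).differentiableAt (by simp)).hasFDerivAt
    have := hd.comp_hasDerivAt t hdl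
    rw [show deriv (fun s => (Function.invFun e ∘ e₁) !₂[s - t, 0]) t = _ from this.deriv]
    intro h0
    have := localDiffeo_fderiv_ne_zero hΨ h0
    simpa using congrArg (fun q : Plane => q 0) this

lemma IsPlaneEmbedding.notMem_boundary [IsManifold (𝓡∂ 2) ∞ F] {e : Plane → F}
    (he : IsPlaneEmbedding e) (p : Plane) : e p ∉ (𝓡∂ 2).boundary F := by
  intro h
  have : IsManifold (𝓡∂ 2) 1 F := IsManifold.of_le (n := ∞) (by simp)
  have h2 := he.2.preimage_boundary (n := ∞) (by simp)
  have : p ∈ e ⁻¹' (𝓡∂ 2).boundary F := h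
  rw [h2] at this
  rw [ModelWithCorners.Boundaryless.boundary_eq_empty] at this
  exact this

/-! ### Orientation -/

/-- The Jacobian of a plane embedding in the preferred chart at the image point. -/
noncomputable def chartJacobian (e : Plane → F) (x : Plane) : ℝ :=
  (fderiv ℝ (extChartAt (𝓡∂ 2) (e x) ∘ e) x).det

lemma chart_comp_fderiv [IsManifold (𝓡∂ 2) ∞ F] {e : Plane → F} {x : Plane}
    (he : IsLocalDiffeomorphAt 𝓘(ℝ, Plane) (𝓡∂ 2) ∞ e x) :
    ContDiffAt ℝ ∞ (extChartAt (𝓡∂ 2) (e x) ∘ e) x ∧ chartJacobian e x ≠ 0 := by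
  have h1 : ContDiffAt ℝ ∞ (extChartAt (𝓡∂ 2) (e x) ∘ e) x := by
    exact (contMDiffAt_iff_target.1 he.contMDiffAt).2.contDiffAt
  refine ⟨h1, ?_⟩
  have hm : mfderiv 𝓘(ℝ, Plane) (𝓡∂ 2) e x = fderiv ℝ (extChartAt (𝓡∂ 2) (e x) ∘ e) x := by
    let L : Plane →L[ℝ] Plane := mfderiv 𝓘(ℝ, Plane) (𝓡∂ 2) e x
    have h3 : HasFDerivWithinAt (extChartAt (𝓡∂ 2) (e x) ∘ e) L (range 𝓘(ℝ, Plane)) x :=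
      (he.mdifferentiableAt (by simp)).hasMFDerivAt.2
    rw [ModelWithCorners.range_eq_univ, hasFDerivWithinAt_univ] at h3
    exact h3.fderiv.symm
  have hi := (he.mfderivToContinuousLinearEquiv (by simp)).injective
  intro h0
  rw [chartJacobian, ContinuousLinearMap.det] at h0
  have : ¬ LinearMap.ker (fderiv ℝ (extChartAt (𝓡∂ 2) (e x) ∘ e) x : Plane →ₗ[ℝ] Plane) = ⊥ := by
    intro hk
    exact (LinearMap.bot_lt_ker_of_det_eq_zero h0).ne' hk
  apply this
  rw [LinearMap.ker_eq_bot]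
  intro v w hvw
  apply hi
  change mfderiv 𝓘(ℝ, Plane) (𝓡∂ 2) e x v = mfderiv 𝓘(ℝ, Plane) (𝓡∂ 2) e x w
  rw [hm]; exact hvw

lemma chartJacobian_comp [IsManifold (𝓡∂ 2) ∞ F] {e : Plane → F} {A : Plane → Plane} {x : Plane}
    (he : IsPlaneEmbedding e) (hA : DifferentiableAt ℝ A x) :
    chartJacobian (e ∘ A) x = chartJacobian e (A x) * (fderiv ℝ A x).det := by
  have h := ((chart_comp_fderiv (he.2 (A x))).1.differentiableAt (by simp)).hasFDerivAt
  have h2 : HasFDerivAt (extChartAt (𝓡∂ 2) ((e ∘ A) x) ∘ (e ∘ A)) _ x := h.comp x hA.hasFDerivAt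
  rw [chartJacobian, h2.fderiv, chartJacobian]
  simp only [ContinuousLinearMap.det, ContinuousLinearMap.toLinearMap_comp, LinearMap.det_comp]

/-- The sign of the Jacobian is locally constant: it is so with respect to a fixed chart, and the
changes of charts of an oriented surface have positive determinants. -/
lemma chartJacobian_eventually [IsManifold (𝓡∂ 2) ∞ F] [OrientedSurface F] {e : Plane → F}
    (he : IsPlaneEmbedding e) (x₀ : Plane) :
    ∀ᶠ x in 𝓝 x₀, 0 < chartJacobian e x * chartJacobian e x₀ := by
  obtain ⟨h1, h2⟩ := chart_comp_fderiv (he.2 x₀)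
  have hc : ContinuousAt (fun x => (fderiv ℝ (extChartAt (𝓡∂ 2) (e x₀) ∘ e) x).det) x₀ := by
    have := (h1.fderiv_right (m := ∞) (by simp)).continuousAt
    exact ContinuousLinearMap.continuous_det.continuousAt.comp this
  have hp : ∀ᶠ x in 𝓝 x₀, 0 < (fderiv ℝ (extChartAt (𝓡∂ 2) (e x₀) ∘ e) x).det *
      chartJacobian e x₀ := by
    have := hc.mul (continuousAt_const (y := chartJacobian e x₀))
    refine this.eventually (lt_mem_nhds ?_)
    exact mul_self_pos.2 h2
  have hs : ∀ᶠ x in 𝓝 x₀, e x ∈ (chartAt (EuclideanHalfSpace 2) (e x₀)).source :=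
    he.1.continuous.continuousAt.eventually
      ((chartAt _ (e x₀)).open_source.mem_nhds (mem_chart_source _ _))
  have hd : ∀ᶠ x in 𝓝 x₀, DifferentiableAt ℝ (extChartAt (𝓡∂ 2) (e x₀) ∘ e) x := by
    have := h1.of_le (m := 1) (by simp)
    filter_upwards [this.eventually (by simp)] with x hx using hx.differentiableAt (by simp)
  filter_upwards [hp, hs, hd] with x hx hxs hxd
  have hpos := OrientedSurface.det_pos (chartAt (EuclideanHalfSpace 2) (e x₀))
    (chart_mem_atlas _ _) (chartAt (EuclideanHalfSpace 2) (e x)) (chart_mem_atlas _ _) (e x)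
    ⟨hxs, mem_chart_source _ _⟩
  set T := fderivWithin ℝ (((chartAt (EuclideanHalfSpace 2) (e x)).extend (𝓡∂ 2)) ∘
    ((chartAt (EuclideanHalfSpace 2) (e x₀)).extend (𝓡∂ 2)).symm) (range (𝓡∂ 2))
    ((chartAt (EuclideanHalfSpace 2) (e x₀)).extend (𝓡∂ 2) (e x)) with hT
  have hTd : HasFDerivWithinAt (((chartAt (EuclideanHalfSpace 2) (e x)).extend (𝓡∂ 2)) ∘
    ((chartAt (EuclideanHalfSpace 2) (e x₀)).extend (𝓡∂ 2)).symm) T (range (𝓡∂ 2))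
    ((chartAt (EuclideanHalfSpace 2) (e x₀)).extend (𝓡∂ 2) (e x)) := by
    by_contra hn
    have : T = 0 := by
      rw [hT]
      refine fderivWithin_zero_of_not_differentiableWithinAt fun hh => hn hh.hasFDerivWithinAt
    rw [this] at hpos
    simp [ContinuousLinearMap.det] at hpos
  have hcomp : HasFDerivAt (((chartAt (EuclideanHalfSpace 2) (e x)).extend (𝓡∂ 2) ∘
    ((chartAt (EuclideanHalfSpace 2) (e x₀)).extend (𝓡∂ 2)).symm) ∘
      (extChartAt (𝓡∂ 2) (e x₀) ∘ e)) (T.comp (fderiv ℝ (extChartAt (𝓡∂ 2) (e x₀) ∘ e) x)) x :=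
    HasFDerivWithinAt.comp_hasFDerivAt x hTd hxd.hasFDerivAt
      (.of_forall fun y => by simp [extChartAt, OpenPartialHomeomorph.extend])
  have heq : (extChartAt (𝓡∂ 2) (e x) ∘ e) =ᶠ[𝓝 x]
      (((chartAt (EuclideanHalfSpace 2) (e x)).extend (𝓡∂ 2) ∘
    ((chartAt (EuclideanHalfSpace 2) (e x₀)).extend (𝓡∂ 2)).symm) ∘
      (extChartAt (𝓡∂ 2) (e x₀) ∘ e)) := by
    have : ∀ᶠ y in 𝓝 x, e y ∈ (chartAt (EuclideanHalfSpace 2) (e x₀)).source :=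
      he.1.continuous.continuousAt.eventually ((chartAt _ (e x₀)).open_source.mem_nhds hxs)
    filter_upwards [this] with y hy
    simp only [Function.comp]
    have : ((chartAt (EuclideanHalfSpace 2) (e x₀)).extend (𝓡∂ 2)).symm
        (extChartAt (𝓡∂ 2) (e x₀) (e y)) = e y :=
      (extChartAt (𝓡∂ 2) (e x₀)).left_inv (by simpa using hy)
    rw [this]; rfl
  have : chartJacobian e x = T.det * (fderiv ℝ (extChartAt (𝓡∂ 2) (e x₀) ∘ e) x).det := by
    rw [chartJacobian, heq.fderiv_eq, hcomp.fderiv]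
    simp only [ContinuousLinearMap.det, ContinuousLinearMap.toLinearMap_comp, LinearMap.det_comp]
  rw [this, mul_assoc]
  exact mul_pos hpos hx

/-- The sign of the Jacobian is constant, because the plane is connected. -/
lemma chartJacobian_sign [IsManifold (𝓡∂ 2) ∞ F] [OrientedSurface F] {e : Plane → F}
    (he : IsPlaneEmbedding e) : (∀ x, 0 < chartJacobian e x) ∨ (∀ x, chartJacobian e x < 0) := by
  have hne : ∀ x, chartJacobian e x ≠ 0 := fun x => (chart_comp_fderiv (he.2 x)).2
  have h1 : IsOpen {x | 0 < chartJacobian e x} := by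
    rw [isOpen_iff_mem_nhds]
    intro x hx
    filter_upwards [chartJacobian_eventually he x] with y hy
    exact pos_of_mul_pos_left hy (le_of_lt hx)
  have h2 : IsOpen {x | chartJacobian e x < 0} := by
    rw [isOpen_iff_mem_nhds]
    intro x hx
    filter_upwards [chartJacobian_eventually he x] with y hy
    exact neg_of_mul_pos_left hy (le_of_lt hx)
  have h3 : Disjoint {x | 0 < chartJacobian e x} {x | chartJacobian e x < 0} :=
    Set.disjoint_left.2 fun x hx hx' => lt_asymm (show 0 < chartJacobian e x from hx) hx'
  have h4 : univ ⊆ {x | 0 < chartJacobian e x} ∪ {x | chartJacobian e x < 0} := fun x _ =>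
    (hne x).symm.lt_or_gt
  rcases (isPreconnected_univ (α := Plane)).subset_or_subset h1 h2 h3 h4 with h | h
  · exact Or.inl fun x => h (mem_univ x)
  · exact Or.inr fun x => h (mem_univ x)

lemma IsPositivePlaneEmbedding.comp_prodPlane [IsManifold (𝓡∂ 2) ∞ F] {e : Plane → F}
    (he : IsPositivePlaneEmbedding e) {σ τ : ℝ → ℝ} (hσ : ContDiff ℝ ∞ σ) (hτ : ContDiff ℝ ∞ τ)
    (hσ' : ∀ u, 0 < deriv σ u) (hτ' : ∀ u, 0 < deriv τ u) :
    IsPositivePlaneEmbedding (e ∘ prodPlane σ τ) := by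
  refine ⟨he.1.comp (localDiffeo_prodPlane hσ hτ (fun u => (hσ' u).ne') fun u => (hτ' u).ne')
    (injective_prodPlane (strictMono_of_deriv_pos hσ').injective
      (strictMono_of_deriv_pos hτ').injective), fun x => ?_⟩
  change 0 < chartJacobian _ x
  rw [chartJacobian_comp he.1 ((contDiff_prodPlane hσ hτ).differentiable (by simp) x),
    det_fderiv_prodPlane hσ hτ]
  exact mul_pos (he.2 _) (mul_pos (hσ' _) (hτ' _))

/-- After a reflection, if necessary, a plane embedding preserves the orientation. -/
lemma IsPlaneEmbedding.positive_or [IsManifold (𝓡∂ 2) ∞ F] [OrientedSurface F] {e : Plane → F}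
    (he : IsPlaneEmbedding e) : IsPositivePlaneEmbedding e ∨
      IsPositivePlaneEmbedding (e ∘ prodPlane id (fun y => -y)) := by
  have hn : ContDiff ℝ ∞ (fun y : ℝ => -y) := by fun_prop
  have hd : ∀ u : ℝ, deriv (fun y : ℝ => -y) u = -1 := fun u => by simp
  rcases chartJacobian_sign he with h | h
  · exact Or.inl ⟨he, h⟩
  · refine Or.inr ⟨he.comp (localDiffeo_prodPlane contDiff_id hn (fun u => by simp)
      fun u => by simp [hd]) (injective_prodPlane Function.injective_id neg_injective), fun x => ?_⟩
    change 0 < chartJacobian _ x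
    rw [chartJacobian_comp he ((contDiff_prodPlane contDiff_id hn).differentiable (by simp) x),
      det_fderiv_prodPlane contDiff_id hn, hd, deriv_id]
    have := h (prodPlane id (fun y => -y) x)
    linarith

end Surface

/-! ### Parameters -/

section Parameters

variable {n : ℕ} {Λ : Finset (Fin n)} {i : Fin n} {s t : ℝ}

/-- The representative of a parameter in the fundamental domain. -/
noncomputable def rep (Λ : Finset (Fin n)) (i : Fin n) (t : ℝ) : ℝ :=
  if i ∈ Λ then t else Int.fract t

lemma rep_mem (ht : t ∈ paramDomain Λ i) : rep Λ i t ∈ fundDomain Λ i := by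
  unfold rep
  split_ifs with h
  · exact ⟨(ht h).1, (ht h).2, fun h' => absurd h h'⟩
  · exact ⟨Int.fract_nonneg t, (Int.fract_lt_one t).le, fun _ => Int.fract_lt_one t⟩

lemma sameParam_rep : SameParam Λ i t (rep Λ i t) := by
  unfold rep
  split_ifs with h
  · exact Or.inl rfl
  · exact Or.inr ⟨h, ⌊t⌋, (Int.fract_add_floor t).symm⟩

lemma SameParam.trans {u : ℝ} (h : SameParam Λ i s t) (h' : SameParam Λ i t u) :
    SameParam Λ i s u := by
  rcases h with rfl | ⟨h, m, hm⟩
  · exact h'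
  · rcases h' with rfl | ⟨_, k, hk⟩
    · exact Or.inr ⟨h, m, hm⟩
    · exact Or.inr ⟨h, k + m, by push_cast; linarith⟩

lemma eq_rep (hs : s ∈ fundDomain Λ i) (h : SameParam Λ i s t) : s = rep Λ i t := by
  unfold rep
  rcases h with rfl | ⟨h, m, hm⟩
  · split_ifs with h
    · rfl
    · exact (Int.fract_eq_self.2 ⟨hs.1, hs.2.2 h⟩).symm
  · rw [if_neg h]
    have h1 : Int.fract s = s := Int.fract_eq_self.2 ⟨hs.1, hs.2.2 h⟩
    rw [← h1, hm, Int.fract_add_intCast]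

lemma fundDomain_subset_paramDomain (hs : s ∈ fundDomain Λ i) : s ∈ paramDomain Λ i :=
  fun _ => ⟨hs.1, hs.2.1⟩

lemma eventually_mem_paramDomain (h : i ∈ Λ → t ∈ Ioo (0 : ℝ) 1) :
    ∀ᶠ s in 𝓝 t, s ∈ paramDomain Λ i := by
  by_cases hi : i ∈ Λ
  · filter_upwards [Ioo_mem_nhds (h hi).1 (h hi).2] with s hs _ using ⟨hs.1.le, hs.2.le⟩
  · exact .of_forall fun s h' => absurd h' hi

end Parameters

section Diagrams

variable {F : Type*} [TopologicalSpace F] [ChartedSpace (EuclideanHalfSpace 2) F]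
  {n : ℕ} {Λ : Finset (Fin n)}

lemma gamma_eq_of_sameParam (D : TangleDiagram F n Λ) {i : Fin n} {s t : ℝ}
    (h : SameParam Λ i s t) : D.γ i s = D.γ i t := by
  rcases h with rfl | ⟨h, m, rfl⟩
  · rfl
  · have : Function.Periodic (D.γ i) 1 := D.periodic i h
    simpa using this.int_mul m t

lemma upper_iff_of_sameParam (D : TangleDiagram F n Λ) {i : Fin n} {s t : ℝ}
    (h : SameParam Λ i s t) : (i, s) ∈ D.upper ↔ (i, t) ∈ D.upper := by
  rcases h with rfl | ⟨h, m, rfl⟩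
  · rfl
  · have : Function.Periodic (fun t => (i, t) ∈ D.upper) 1 := fun t =>
      propext (D.upper_periodic i h t)
    simpa using iff_of_eq (this.int_mul m t)

lemma continuousAt_gamma (D : TangleDiagram F n Λ) {i : Fin n} {t : ℝ}
    (h : i ∈ Λ → t ∈ Ioo (0 : ℝ) 1) : ContinuousAt (D.γ i) t := by
  obtain ⟨e, he, hu⟩ := D.immersed i t h
  have hshift : Tendsto (fun s : ℝ => s - t) (𝓝 t) (𝓝 0) := by
    have : Continuous fun s : ℝ => s - t := by fun_prop
    simpa using this.tendsto t
  have h' : D.γ i =ᶠ[𝓝 t] fun s => e !₂[s - t, 0] := by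
    filter_upwards [hshift.eventually hu] with s hs
    simpa using hs
  refine ContinuousAt.congr ?_ h'.symm
  exact (he.1.continuous.comp (continuous_pt (by fun_prop) continuous_const)).continuousAt

/-- A parameter at which the diagram does not meet the boundary is an inner one. -/
lemma mem_Ioo_of_notMem_boundary (D : TangleDiagram F n Λ) {i : Fin n} {t : ℝ}
    (ht : t ∈ paramDomain Λ i) (h : D.γ i t ∉ (𝓡∂ 2).boundary F) (hi : i ∈ Λ) :
    t ∈ Ioo (0 : ℝ) 1 := by
  have hf : t ∈ fundDomain Λ i := ⟨(ht hi).1, (ht hi).2, fun h' => absurd hi h'⟩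
  rw [D.boundary_iff i t hf] at h
  push Not at h
  obtain ⟨h0, h1⟩ := h hi
  exact ⟨lt_of_le_of_ne (ht hi).1 (Ne.symm h0), lt_of_le_of_ne (ht hi).2 h1⟩

/-! ### Boxes -/

/-- A box of the diagram `D`: an embedded square in which `D` consists of `K` disjoint strands,
the horizontal lines of heights `y a`.  The strand `a` is the part `θ a ([-1,1])` of the component
`comp a`, run through in either direction. -/
structure Box (D : TangleDiagram F n Λ) (K : ℕ) where
  e : Plane → F
  e_pos : IsPositivePlaneEmbedding e
  y : Fin K → ℝ
  y_mono : StrictMono y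
  y_mem : ∀ a, |y a| < 1
  comp : Fin K → Fin n
  θ : Fin K → ℝ → ℝ
  θ_cont : ∀ a, ContinuousOn (θ a) (Icc (-1) 1)
  θ_mono : ∀ a, StrictMonoOn (θ a) (Icc (-1) 1) ∨ StrictAntiOn (θ a) (Icc (-1) 1)
  θ_domain : ∀ a, ∀ x ∈ Icc (-1 : ℝ) 1, θ a x ∈ paramDomain Λ (comp a)
  θ_eq : ∀ a, ∀ x ∈ Icc (-1 : ℝ) 1, D.γ (comp a) (θ a x) = e !₂[x, y a]
  cover : ∀ i, ∀ t ∈ paramDomain Λ i, D.γ i t ∈ e '' square →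
    ∃ a, ∃ x ∈ Icc (-1 : ℝ) 1, comp a = i ∧ SameParam Λ i t (θ a x)

namespace Box

variable {D : TangleDiagram F n Λ} {K : ℕ} (B : Box D K)

lemma e_inj {x y x' y' : ℝ} (h : B.e !₂[x, y] = B.e !₂[x', y']) : x = x' ∧ y = y' := by
  have := B.e_pos.1.injective h
  exact ⟨by simpa using congrArg (fun q : Plane => q 0) this,
    by simpa using congrArg (fun q : Plane => q 1) this⟩

lemma mem_square {x : ℝ} {h : ℝ} (hx : x ∈ Icc (-1 : ℝ) 1) (hh : |h| < 1) :
    B.e !₂[x, h] ∈ B.e '' square :=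
  ⟨_, ⟨by simpa using abs_le.2 hx, by simpa using hh.le⟩, rfl⟩

lemma exists_of_mem_square {i : Fin n} {t : ℝ} (ht : t ∈ paramDomain Λ i)
    (h : D.γ i t ∈ B.e '' square) : ∃ a, ∃ x ∈ Icc (-1 : ℝ) 1, B.comp a = i ∧
      SameParam Λ i t (B.θ a x) ∧ D.γ i t = B.e !₂[x, B.y a] := by
  obtain ⟨a, x, hx, rfl, hs⟩ := B.cover i t ht h
  exact ⟨a, x, hx, rfl, hs, by rw [gamma_eq_of_sameParam D hs, B.θ_eq a x hx]⟩

lemma sameParam_of_eq {i : Fin n} {t : ℝ} (ht : t ∈ paramDomain Λ i) {a : Fin K} {x : ℝ}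
    (hx : x ∈ Icc (-1 : ℝ) 1) (h : D.γ i t = B.e !₂[x, B.y a]) :
    B.comp a = i ∧ SameParam Λ i t (B.θ a x) := by
  obtain ⟨b, x', hx', rfl, hs, h'⟩ := B.exists_of_mem_square ht (by
    rw [h]; exact B.mem_square hx (B.y_mem a))
  rw [h] at h'
  obtain ⟨rfl, h2⟩ := B.e_inj h'
  obtain rfl := B.y_mono.injective h2
  exact ⟨rfl, hs⟩

/-- There are no crossings inside a box. -/
lemma not_double {i j : Fin n} {s t : ℝ} (h : IsDoublePair Λ D.γ i s j t) :
    D.γ i s ∉ B.e '' square := by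
  intro hsq
  obtain ⟨hs, ht, hne, heq⟩ := h
  obtain ⟨a, x, hx, rfl, hs', he⟩ :=
    B.exists_of_mem_square (fundDomain_subset_paramDomain hs) hsq
  obtain ⟨rfl, ht'⟩ := B.sameParam_of_eq (fundDomain_subset_paramDomain ht) hx (heq ▸ he)
  apply hne
  rw [eq_rep hs hs', eq_rep ht ht']

open Classical in
/-- The map which moves the strand `a` of the box to the graph of the function `g a` and fixes all
other points. -/
noncomputable def move (g : Fin K → ℝ → ℝ) (q : F) : F :=
  if h : ∃ p : Fin K × ℝ, p.2 ∈ Icc (-1 : ℝ) 1 ∧ q = B.e !₂[p.2, B.y p.1] then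
    B.e !₂[h.choose.2, g h.choose.1 h.choose.2]
  else q

lemma move_strand (g : Fin K → ℝ → ℝ) {a : Fin K} {x : ℝ} (hx : x ∈ Icc (-1 : ℝ) 1) :
    B.move g (B.e !₂[x, B.y a]) = B.e !₂[x, g a x] := by
  have h : ∃ p : Fin K × ℝ, p.2 ∈ Icc (-1 : ℝ) 1 ∧
      B.e !₂[x, B.y a] = B.e !₂[p.2, B.y p.1] := ⟨(a, x), hx, rfl⟩
  rw [move, dif_pos h]
  obtain ⟨h1, h2⟩ := B.e_inj h.choose_spec.2
  rw [← h1, ← B.y_mono.injective h2]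

lemma move_of_notMem (g : Fin K → ℝ → ℝ) {q : F} (hq : q ∉ B.e '' square) : B.move g q = q := by
  rw [move, dif_neg]
  rintro ⟨⟨a, x⟩, hx, rfl⟩
  exact hq (B.mem_square hx (B.y_mem a))

/-- A family of functions whose graphs may replace the strands of a box: it is standard near the
left and right sides, the graphs stay in the square and meet in transverse double points. -/
structure Admissible (g : Fin K → ℝ → ℝ) : Prop where
  smooth : ∀ a, ContDiff ℝ ∞ (g a)
  flat : ∃ r < 1, ∀ a x, r ≤ |x| → g a x = B.y a
  mem : ∀ a x, |g a x| < 1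
  transverse : ∀ a b x, a ≠ b → g a x = g b x → deriv (g a) x ≠ deriv (g b) x
  no_triple : ∀ a b c x, a ≠ b → a ≠ c → g a x = g b x → g a x = g c x → b = c

end Box

end Diagrams

/-! ### Replacing the strands of a box -/

/-- A compact set without accumulation points in itself is finite. -/
lemma finite_of_isolated {X : Type*} [TopologicalSpace X] {s : Set X} (hs : IsCompact s)
    (h : ∀ x ∈ s, ∀ᶠ y in 𝓝 x, y ∈ s → y = x) : s.Finite := by
  by_contra hinf
  obtain ⟨x, hx, hacc⟩ := Set.Infinite.exists_accPt_of_subset_isCompact hinf hs subset_rfl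
  rw [accPt_iff_frequently] at hacc
  obtain ⟨y, ⟨h1, h2⟩, h3⟩ := (hacc.and_eventually (h x hx)).exists
  exact h1 (h3 h2)

/-- A zero with nonzero derivative is isolated. -/
lemma eventually_eq_of_deriv_ne_zero {f : ℝ → ℝ} {x : ℝ} (h : deriv f x ≠ 0) :
    ∀ᶠ y in 𝓝 x, f y = 0 → y = x := by
  have hd : DifferentiableAt ℝ f x := by
    by_contra hn; exact h (deriv_zero_of_not_differentiableAt hn)
  have := hd.hasDerivAt.eventually_ne (c := 0) h
  rw [eventually_nhdsWithin_iff] at this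
  filter_upwards [this] with y hy hy0
  by_contra hne
  exact hy hne hy0

lemma isCompact_rect (a b c d : ℝ) :
    IsCompact {p : Plane | (a ≤ p 0 ∧ p 0 ≤ b) ∧ (c ≤ p 1 ∧ p 1 ≤ d)} := by
  have : {p : Plane | (a ≤ p 0 ∧ p 0 ≤ b) ∧ (c ≤ p 1 ∧ p 1 ≤ d)} =
      (fun x : ℝ × ℝ => (!₂[x.1, x.2] : Plane)) '' (Icc a b ×ˢ Icc c d) := by
    ext p
    constructor
    · rintro ⟨h0, h1⟩
      exact ⟨(p 0, p 1), ⟨h0, h1⟩, pt_eta p⟩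
    · rintro ⟨x, ⟨h0, h1⟩, rfl⟩
      simpa using ⟨h0, h1⟩
  rw [this]
  exact (isCompact_Icc.prod isCompact_Icc).image (continuous_pt continuous_fst continuous_snd)

lemma isCompact_square : IsCompact square := by
  convert isCompact_rect (-1) 1 (-1) 1 using 1
  ext p; simp [square, abs_le]

section Diagrams

variable {F : Type*} [TopologicalSpace F] [ChartedSpace (EuclideanHalfSpace 2) F]
  {n : ℕ} {Λ : Finset (Fin n)}

namespace Box

variable {D : TangleDiagram F n Λ} {K : ℕ} (B : Box D K) {g : Fin K → ℝ → ℝ}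

lemma Admissible.finite {B : Box D K} (hg : B.Admissible g) {a b : Fin K} (hab : a ≠ b) :
    {x | x ∈ Icc (-1 : ℝ) 1 ∧ g a x = g b x}.Finite := by
  have hc : ∀ c, Continuous (g c) := fun c => (hg.smooth c).continuous
  refine finite_of_isolated (isCompact_Icc.inter_right (isClosed_eq (hc a) (hc b))) ?_
  rintro x ⟨-, hx⟩
  have hd : ∀ c, DifferentiableAt ℝ (g c) x := fun c => (hg.smooth c).differentiable (by simp) x
  have h1 : deriv (fun x => g a x - g b x) x ≠ 0 := by
    rw [deriv_fun_sub (hd a) (hd b)]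
    exact sub_ne_zero.2 (hg.transverse a b x hab hx)
  filter_upwards [eventually_eq_of_deriv_ne_zero h1] with y hy hy'
  exact hy (sub_eq_zero.2 hy'.2)

/-- The point `q` of the box is moved to a crossing, the branch through `q` being the upper one. -/
def Over (g : Fin K → ℝ → ℝ) (ht : Fin K → ℕ) (q : F) : Prop :=
  ∃ a b x, x ∈ Icc (-1 : ℝ) 1 ∧ q = B.e !₂[x, B.y a] ∧ g a x = g b x ∧ ht b < ht a

lemma over_strand {ht : Fin K → ℕ} {a : Fin K} {x : ℝ} (hx : x ∈ Icc (-1 : ℝ) 1) :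
    B.Over g ht (B.e !₂[x, B.y a]) ↔ ∃ b, g a x = g b x ∧ ht b < ht a := by
  constructor
  · rintro ⟨a', b, x', hx', h1, h2, h3⟩
    obtain ⟨rfl, h4⟩ := B.e_inj h1
    obtain rfl := B.y_mono.injective h4
    exact ⟨b, h2, h3⟩
  · rintro ⟨b, h2, h3⟩
    exact ⟨a, b, x, hx, rfl, h2, h3⟩

lemma not_over_of_notMem {ht : Fin K → ℕ} {q : F} (hq : q ∉ B.e '' square) :
    ¬ B.Over g ht q := by
  rintro ⟨a, b, x, hx, rfl, -⟩
  exact hq (B.mem_square hx (B.y_mem a))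

variable {B}

/-- Outside a closed part of the open box neither the curves nor the upper branches change. This is
what keeps the local conditions of a diagram at the edge of the box. -/
lemma Admissible.exists_core [T2Space F] (hg : B.Admissible g) :
    ∃ C : Set F, IsClosed C ∧ C ⊆ B.e '' {p | |p 0| < 1 ∧ |p 1| ≤ 1} ∧
      (∀ q ∉ C, B.move g q = q) ∧ ∀ ht, ∀ q ∉ C, ¬ B.Over g ht q := by
  obtain ⟨r, hr, hflat⟩ := hg.flat
  refine ⟨B.e '' {p | (-r ≤ p 0 ∧ p 0 ≤ r) ∧ (-1 ≤ p 1 ∧ p 1 ≤ 1)},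
    ((isCompact_rect _ _ _ _).image B.e_pos.1.1.continuous).isClosed, ?_, ?_, ?_⟩
  · refine image_mono fun p hp => ⟨?_, abs_le.2 hp.2⟩
    exact (abs_le.2 hp.1).trans_lt hr
  · intro q hq
    by_cases h : ∃ p : Fin K × ℝ, p.2 ∈ Icc (-1 : ℝ) 1 ∧ q = B.e !₂[p.2, B.y p.1]
    · obtain ⟨⟨a, x⟩, hx, rfl⟩ := h
      rw [B.move_strand g hx, hflat]
      by_contra hlt
      exact hq ⟨_, ⟨by simpa using abs_le.1 (not_le.1 hlt).le,
        by simpa using abs_le.1 (B.y_mem a).le⟩, rfl⟩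
    · rw [move, dif_neg h]
  · rintro ht q hq ⟨a, b, x, hx, rfl, hab, hlt⟩
    have : ¬ r ≤ |x| := by
      intro hle
      rw [hflat a x hle, hflat b x hle] at hab
      rw [B.y_mono.injective hab] at hlt
      exact lt_irrefl _ hlt
    exact hq ⟨_, ⟨by simpa using abs_le.1 (not_le.1 this).le,
        by simpa using abs_le.1 (B.y_mem a).le⟩, rfl⟩

/-- Near an inner point of a strand the curve stays on this strand. -/
lemma strand_near {i : Fin n} {t : ℝ} (hreg : i ∈ Λ → t ∈ Ioo (0 : ℝ) 1) {a : Fin K} {x : ℝ}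
    (hx : |x| < 1) (h : D.γ i t = B.e !₂[x, B.y a]) :
    ∀ᶠ s in 𝓝 t, ∃ x', |x'| < 1 ∧ D.γ i s = B.e !₂[x', B.y a] := by
  have hopen : IsOpen {p : Plane | (|p 0| < 1 ∧ |p 1| < 1) ∧ ∀ b, b ≠ a → p 1 ≠ B.y b} := by
    have h0 := continuous_coord 0
    have h1 := continuous_coord 1
    refine ((isOpen_lt h0.abs continuous_const).inter (isOpen_lt h1.abs continuous_const)).inter ?_
    have heq : {p : Plane | ∀ b, b ≠ a → p 1 ≠ B.y b} =
        (fun p : Plane => p 1) ⁻¹' (B.y '' {b | b ≠ a})ᶜ := by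
      ext p
      simp only [mem_preimage, mem_compl_iff, mem_image, not_exists, not_and]
      exact forall_congr' fun b => forall_congr' fun _ => ne_comm
    change IsOpen {p : Plane | ∀ b, b ≠ a → p 1 ≠ B.y b}
    rw [heq]
    exact (Set.toFinite (B.y '' {b | b ≠ a})).isClosed.isOpen_compl.preimage h1
  have hmem : B.e '' {p : Plane | (|p 0| < 1 ∧ |p 1| < 1) ∧ ∀ b, b ≠ a → p 1 ≠ B.y b} ∈
      𝓝 (D.γ i t) := by
    refine (B.e_pos.1.1.isOpenMap _ hopen).mem_nhds ?_
    rw [h]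
    exact ⟨_, ⟨⟨by simpa using hx, by simpa using B.y_mem a⟩, fun b hb => by
      simpa using fun hh => hb (B.y_mono.injective hh).symm⟩, rfl⟩
  filter_upwards [continuousAt_gamma D hreg hmem, eventually_mem_paramDomain hreg] with s hs hs'
  obtain ⟨p, ⟨⟨hp0, hp1⟩, hp⟩, hps⟩ := hs
  obtain ⟨b, x', hx', -, -, he⟩ := B.exists_of_mem_square hs' (by
    rw [← hps]; exact ⟨p, ⟨hp0.le, hp1.le⟩, rfl⟩)
  have := B.e_pos.1.injective (hps.trans he)
  have h1 : p 1 = B.y b := by rw [this]; simp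
  have h0 : p 0 = x' := by rw [this]; simp
  have hba : b = a := by
    by_contra hne
    exact hp b hne h1
  subst hba
  exact ⟨x', h0 ▸ hp0, he⟩

variable (B)

/-- The shear of the box which moves the strand `a` to its new position. -/
noncomputable def shear (g : Fin K → ℝ → ℝ) (a : Fin K) (p : Plane) : Plane :=
  !₂[p 0, p 1 + (g a (p 0) - B.y a)]

variable {B}

lemma Admissible.localDiffeo_shear (hg : B.Admissible g) (a : Fin K) (p : Plane) :
    IsLocalDiffeomorphAt 𝓘(ℝ, Plane) 𝓘(ℝ, Plane) ∞ (B.shear g a) p := by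
  have h0 : ContDiff ℝ ∞ fun q : Plane => g a (q 0) - B.y a :=
    ((hg.smooth a).comp (contDiff_coord 0)).sub contDiff_const
  refine localDiffeo_triangular (.of_forall fun q => ((contDiff_coord 1).add h0).contDiffAt) ?_
  have h1 : HasFDerivAt (fun q : Plane => q 1 + (g a (q 0) - B.y a))
      ((EuclideanSpace.proj 1 : Plane →L[ℝ] ℝ) +
        deriv (g a) (p 0) • (EuclideanSpace.proj 0 : Plane →L[ℝ] ℝ)) p :=
    (EuclideanSpace.proj 1 : Plane →L[ℝ] ℝ).hasFDerivAt.add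
      ((hasFDerivAt_comp_coord ((hg.smooth a).differentiable (by simp) _)).sub_const _)
  rw [h1.fderiv]
  simp

/-- Near each inner parameter the new curve is the image of the old one under a local
diffeomorphism of the surface. -/
lemma Admissible.exists_localDiffeo [T2Space F] (hg : B.Admissible g) {i : Fin n} {t : ℝ}
    (ht : t ∈ paramDomain Λ i) (hreg : i ∈ Λ → t ∈ Ioo (0 : ℝ) 1) :
    ∃ Φ : F → F, IsLocalDiffeomorphAt (𝓡∂ 2) (𝓡∂ 2) ∞ Φ (D.γ i t) ∧
      ∀ᶠ s in 𝓝 t, B.move g (D.γ i s) = Φ (D.γ i s) := by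
  obtain ⟨C, hC, hCsub, hCmove, -⟩ := hg.exists_core
  by_cases hmem : D.γ i t ∈ C
  · have hsq : D.γ i t ∈ B.e '' square :=
      image_mono (fun (p : Plane) (hp : |p 0| < 1 ∧ |p 1| ≤ 1) => show |p 0| ≤ 1 ∧ |p 1| ≤ 1 from
        ⟨hp.1.le, hp.2⟩) (hCsub hmem)
    obtain ⟨a, x, hx, -, -, he⟩ := B.exists_of_mem_square ht hsq
    have hx1 : |x| < 1 := by
      obtain ⟨p, hp, hpe⟩ := hCsub hmem
      have := B.e_pos.1.injective (hpe.trans he)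
      simpa [this] using hp.1
    refine ⟨B.e ∘ B.shear g a ∘ Function.invFun B.e, ?_, ?_⟩
    · rw [he]
      refine localDiffeo_comp ?_ (B.e_pos.1.2 _)
      refine localDiffeo_comp (B.e_pos.1.localDiffeo_invFun _) ?_
      exact hg.localDiffeo_shear a _
    · filter_upwards [strand_near hreg hx1 he] with s hs
      obtain ⟨x', hx', he'⟩ := hs
      rw [he', B.move_strand g (abs_le.1 hx'.le)]
      simp [B.e_pos.1.invFun_apply, shear]
  · refine ⟨id, localDiffeo_id _, ?_⟩
    have := (continuousAt_gamma D hreg).eventually (hC.isOpen_compl.mem_nhds hmem)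
    filter_upwards [this] with s hs
    exact hCmove _ hs

lemma Admissible.move_mem_square_iff (hg : B.Admissible g) {i : Fin n} {t : ℝ}
    (ht : t ∈ paramDomain Λ i) :
    B.move g (D.γ i t) ∈ B.e '' square ↔ D.γ i t ∈ B.e '' square := by
  by_cases h : D.γ i t ∈ B.e '' square
  · obtain ⟨a, x, hx, -, -, he⟩ := B.exists_of_mem_square ht h
    simp only [h, iff_true]
    rw [he, B.move_strand g hx]
    exact B.mem_square hx (hg.mem a x)
  · rw [B.move_of_notMem g h]

/-- The double points after the move are the old ones, outside the box, and the crossings of the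
graphs. -/
lemma Admissible.double_iff (hg : B.Admissible g) {i j : Fin n} {s t : ℝ} :
    IsDoublePair Λ (fun i t => B.move g (D.γ i t)) i s j t ↔ IsDoublePair Λ D.γ i s j t ∨
      (s ∈ fundDomain Λ i ∧ t ∈ fundDomain Λ j ∧ ∃ a b x, a ≠ b ∧ x ∈ Icc (-1 : ℝ) 1 ∧
        g a x = g b x ∧ D.γ i s = B.e !₂[x, B.y a] ∧ D.γ j t = B.e !₂[x, B.y b]) := by
  constructor
  · rintro ⟨hs, ht, hne, heq⟩
    have hs' := fundDomain_subset_paramDomain hs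
    have ht' := fundDomain_subset_paramDomain ht
    by_cases hsq : D.γ i s ∈ B.e '' square
    · right
      refine ⟨hs, ht, ?_⟩
      have hsq' : D.γ j t ∈ B.e '' square := by
        have := (hg.move_mem_square_iff hs').2 hsq
        dsimp only at heq
        rw [heq] at this
        exact (hg.move_mem_square_iff ht').1 this
      obtain ⟨a, x, hx, rfl, hsa, he⟩ := B.exists_of_mem_square hs' hsq
      obtain ⟨b, x', hx', rfl, htb, he'⟩ := B.exists_of_mem_square ht' hsq'
      dsimp only at heq
      rw [he, he', B.move_strand g hx, B.move_strand g hx'] at heq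
      obtain ⟨rfl, hgx⟩ := B.e_inj heq
      refine ⟨a, b, x, ?_, hx, hgx, he, he'⟩
      rintro rfl
      exact hne (by rw [eq_rep hs hsa, eq_rep ht htb])
    · left
      refine ⟨hs, ht, hne, ?_⟩
      have hsq' : D.γ j t ∉ B.e '' square := by
        dsimp only at heq
        rw [← hg.move_mem_square_iff ht', ← heq, hg.move_mem_square_iff hs']
        exact hsq
      dsimp only at heq
      rwa [B.move_of_notMem g hsq, B.move_of_notMem g hsq'] at heq
  · rintro (⟨hs, ht, hne, heq⟩ | ⟨hs, ht, a, b, x, hab, hx, hgx, he, he'⟩)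
    · exact ⟨hs, ht, hne, by dsimp only; rw [heq]⟩
    · refine ⟨hs, ht, ?_, ?_⟩
      · intro h
        obtain ⟨rfl, rfl⟩ := Prod.mk.inj h
        exact hab (B.y_mono.injective (B.e_inj (he.symm.trans he')).2)
      · dsimp only
        rw [he, he', B.move_strand g hx, B.move_strand g hx, hgx]

end Box

end Diagrams

/-! ### The diagram with replaced strands -/

section Diagrams

variable {F : Type*} [TopologicalSpace F] [ChartedSpace (EuclideanHalfSpace 2) F]
  {n : ℕ} {Λ : Finset (Fin n)}

/-- Two smooth planar curves which cross transversally are the coordinate lines of a plane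
embedding. -/
lemma exists_planeEmbedding_of_transverse {e : Plane → F} (he : IsPlaneEmbedding e)
    {α β : ℝ → Plane} {s t : ℝ} (hα : ∀ᶠ u in 𝓝 s, ContDiffAt ℝ ∞ α u)
    (hβ : ∀ᶠ u in 𝓝 t, ContDiffAt ℝ ∞ β u) (h : α s = β t) {v w : Plane} (hv : HasDerivAt α v s)
    (hw : HasDerivAt β w t) (hvw : v 0 * w 1 - v 1 * w 0 ≠ 0) :
    ∃ E : Plane → F, IsPlaneEmbedding E ∧
      ∀ᶠ u in 𝓝 (0 : ℝ), e (α (s + u)) = E !₂[u, 0] ∧ e (β (t + u)) = E !₂[0, u] := by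
  let Ψ : Plane → Plane := fun p => α (s + p 0) + β (t + p 1) - α s
  have h0 : Tendsto (fun p : Plane => s + p 0) (𝓝 0) (𝓝 s) := by
    have hc : Continuous fun p : Plane => s + p 0 := continuous_const.add (continuous_coord 0)
    simpa using hc.tendsto 0
  have h1 : Tendsto (fun p : Plane => t + p 1) (𝓝 0) (𝓝 t) := by
    have hc : Continuous fun p : Plane => t + p 1 := continuous_const.add (continuous_coord 1)
    simpa using hc.tendsto 0
  have hsm : ∀ᶠ p in 𝓝 (0 : Plane), ContDiffAt ℝ ∞ Ψ p := by
    filter_upwards [h0.eventually hα, h1.eventually hβ] with p hp0 hp1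
    refine ContDiffAt.sub (ContDiffAt.add ?_ ?_) contDiffAt_const
    · exact ContDiffAt.comp (g := α) (f := fun p : Plane => s + p 0) p hp0
        (contDiff_const.add (contDiff_coord 0)).contDiffAt
    · exact ContDiffAt.comp (g := β) (f := fun p : Plane => t + p 1) p hp1
        (contDiff_const.add (contDiff_coord 1)).contDiffAt
  have hd : HasFDerivAt Ψ ((EuclideanSpace.proj 0 : Plane →L[ℝ] ℝ).smulRight v +
      (EuclideanSpace.proj 1 : Plane →L[ℝ] ℝ).smulRight w) 0 := by
    refine HasFDerivAt.sub_const _ (HasFDerivAt.add ?_ ?_)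
    · have h2 : HasFDerivAt (fun p : Plane => s + p 0) (EuclideanSpace.proj 0 : Plane →L[ℝ] ℝ) 0 :=
        (EuclideanSpace.proj 0 : Plane →L[ℝ] ℝ).hasFDerivAt.const_add s
      have h3 : HasFDerivAt α (ContinuousLinearMap.toSpanSingleton ℝ v) (s + (0 : Plane) 0) := by
        simpa using hv.hasFDerivAt
      exact h3.comp (0 : Plane) h2
    · have h2 : HasFDerivAt (fun p : Plane => t + p 1) (EuclideanSpace.proj 1 : Plane →L[ℝ] ℝ) 0 :=
        (EuclideanSpace.proj 1 : Plane →L[ℝ] ℝ).hasFDerivAt.const_add t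
      have h3 : HasFDerivAt β (ContinuousLinearMap.toSpanSingleton ℝ w) (t + (0 : Plane) 1) := by
        simpa using hw.hasFDerivAt
      exact h3.comp (0 : Plane) h2
  have hloc : IsLocalDiffeomorphAt 𝓘(ℝ, Plane) 𝓘(ℝ, Plane) ∞ Ψ 0 := by
    refine localDiffeo_of_fderiv hsm fun z hz => ?_
    rw [hd.fderiv] at hz
    have hz0 := congrArg (fun q : Plane => q 0) hz
    have hz1 := congrArg (fun q : Plane => q 1) hz
    simp at hz0 hz1
    have e0 : z 0 * (v 0 * w 1 - v 1 * w 0) = 0 := by linear_combination w 1 * hz0 - w 0 * hz1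
    have e1 : z 1 * (v 0 * w 1 - v 1 * w 0) = 0 := by linear_combination v 0 * hz1 - v 1 * hz0
    exact plane_ext (by simpa [hvw] using e0) (by simpa [hvw] using e1)
  obtain ⟨E, hE, hEΨ⟩ := exists_planeEmbedding_germ (localDiffeo_comp hloc (he.2 (Ψ 0)))
  refine ⟨E, hE, ?_⟩
  have hz : (!₂[(0 : ℝ), 0] : Plane) = 0 := by ext i; fin_cases i <;> simp
  have l0 : Tendsto (fun u : ℝ => (!₂[u, 0] : Plane)) (𝓝 0) (𝓝 0) := by
    have := (continuous_pt continuous_id (continuous_const (y := (0 : ℝ)))).tendsto (0 : ℝ)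
    simpa [hz] using this
  have l1 : Tendsto (fun u : ℝ => (!₂[0, u] : Plane)) (𝓝 0) (𝓝 0) := by
    have := (continuous_pt (continuous_const (y := (0 : ℝ))) continuous_id).tendsto (0 : ℝ)
    simpa [hz] using this
  filter_upwards [l0.eventually hEΨ, l1.eventually hEΨ] with u hu0 hu1
  rw [hu0, hu1]
  constructor
  · simp [Ψ, ← h]
  · simp [Ψ]

namespace Box

variable {D : TangleDiagram F n Λ} {K : ℕ} {B : Box D K} {g : Fin K → ℝ → ℝ}

lemma Admissible.immersed [T2Space F] (hg : B.Admissible g) {i : Fin n} {t : ℝ}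
    (hreg : i ∈ Λ → t ∈ Ioo (0 : ℝ) 1) : ∃ e : Plane → F, IsPlaneEmbedding e ∧
      ∀ᶠ u in 𝓝 (0 : ℝ), B.move g (D.γ i (t + u)) = e !₂[u, 0] := by
  obtain ⟨e₁, he₁, hu⟩ := D.immersed i t hreg
  obtain ⟨Φ, hΦ, hm⟩ := hg.exists_localDiffeo (eventually_mem_paramDomain hreg).self_of_nhds hreg
  have hz : (!₂[(0 : ℝ), 0] : Plane) = 0 := by ext i; fin_cases i <;> simp
  have h0 : D.γ i t = e₁ 0 := by simpa [hz] using hu.self_of_nhds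
  rw [h0] at hΦ
  obtain ⟨E, hE, hEΦ⟩ := exists_planeEmbedding_germ (localDiffeo_comp (he₁.2 0) hΦ)
  refine ⟨E, hE, ?_⟩
  have hl : Tendsto (fun u : ℝ => (!₂[u, 0] : Plane)) (𝓝 0) (𝓝 0) := by
    have := (continuous_pt continuous_id (continuous_const (y := (0 : ℝ)))).tendsto (0 : ℝ)
    simpa [hz] using this
  have ht : Tendsto (fun u : ℝ => t + u) (𝓝 0) (𝓝 t) := by
    have : Continuous fun u : ℝ => t + u := by fun_prop
    simpa using this.tendsto 0
  filter_upwards [hu, ht.eventually hm, hl.eventually hEΦ] with u h1 h2 h3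
  rw [h2, h1, h3]; rfl

/-- The new curve along a strand, in the coordinates of the box. -/
lemma Admissible.strand_curve [T2Space F] (hg : B.Admissible g) {i : Fin n} {t : ℝ}
    (hreg : i ∈ Λ → t ∈ Ioo (0 : ℝ) 1) {a : Fin K} {x : ℝ} (hx : |x| < 1)
    (h : D.γ i t = B.e !₂[x, B.y a]) :
    ∃ α : ℝ → Plane, (∀ᶠ s in 𝓝 t, B.move g (D.γ i s) = B.e (α s)) ∧
      (∀ᶠ s in 𝓝 t, ContDiffAt ℝ ∞ α s) ∧ α t = !₂[x, g a x] ∧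
      ∃ k ≠ 0, HasDerivAt α !₂[k, deriv (g a) x * k] t := by
  obtain ⟨e₁, he₁, hu⟩ := hg.immersed hreg
  have hmt : B.move g (D.γ i t) = B.e !₂[x, g a x] := by
    rw [h, B.move_strand g (abs_le.1 hx.le)]
  obtain ⟨h1, h2, h3⟩ := planar_curve (c := fun s => B.move g (D.γ i s)) B.e_pos.1 he₁ hu
    ⟨_, hmt.symm⟩
  set α : ℝ → Plane := fun s => Function.invFun B.e (B.move g (D.γ i s)) with hα
  have hαt : α t = !₂[x, g a x] := by
    rw [hα]; dsimp only
    rw [hmt, B.e_pos.1.invFun_apply]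
  refine ⟨α, ?_, h2, hαt, ?_⟩
  · filter_upwards [h1] with s hs using (apply_invFun hs).symm
  · have hd : HasDerivAt α (deriv α t) t :=
      (h2.self_of_nhds.differentiableAt (by simp)).hasDerivAt
    have hd0 : HasDerivAt (fun s => α s 0) (deriv α t 0) t :=
      ((EuclideanSpace.proj 0 : Plane →L[ℝ] ℝ).hasFDerivAt.comp_hasDerivAt t hd)
    have hd1 : HasDerivAt (fun s => α s 1) (deriv α t 1) t :=
      ((EuclideanSpace.proj 1 : Plane →L[ℝ] ℝ).hasFDerivAt.comp_hasDerivAt t hd)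
    have hgr : (fun s => α s 1) =ᶠ[𝓝 t] fun s => g a (α s 0) := by
      filter_upwards [strand_near hreg hx h] with s hs
      obtain ⟨x', hx', he'⟩ := hs
      have : α s = !₂[x', g a x'] := by
        rw [hα]; dsimp only
        rw [he', B.move_strand g (abs_le.1 hx'.le), B.e_pos.1.invFun_apply]
      simp [this]
    have hg' : HasDerivAt (g a) (deriv (g a) x) (α t 0) := by
      rw [hαt]
      exact ((hg.smooth a).differentiable (by simp) x).hasDerivAt
    have he := hd1.unique ((hg'.comp t hd0).congr_of_eventuallyEq hgr)
    have hv : deriv α t = !₂[deriv α t 0, deriv (g a) x * deriv α t 0] := by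
      rw [← he, pt_eta]
    refine ⟨deriv α t 0, ?_, hv ▸ hd⟩
    intro hk
    apply h3
    rw [hv, hk]
    ext i; fin_cases i <;> simp

/-- The diagram obtained by replacing the strands of a box by the graphs of an admissible family,
where the strand with the greater height is the upper one at a crossing. -/
noncomputable def deform [T2Space F] [IsManifold (𝓡∂ 2) ∞ F] (B : Box D K) {g : Fin K → ℝ → ℝ}
    (hg : B.Admissible g) {ht : Fin K → ℕ} (hinj : Function.Injective ht) :
    TangleDiagram F n Λ where
  γ i t := B.move g (D.γ i t)
  periodic i hi t := by rw [D.periodic i hi]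
  immersed i t h := hg.immersed h
  boundary_iff i t ht := by
    rw [← D.boundary_iff i t ht]
    by_cases h : D.γ i t ∈ B.e '' square
    · have h' := (hg.move_mem_square_iff (fundDomain_subset_paramDomain ht)).2 h
      have hb : ∀ q ∈ B.e '' square, q ∉ (𝓡∂ 2).boundary F := by
        rintro _ ⟨p, -, rfl⟩
        exact B.e_pos.1.notMem_boundary p
      simp [hb _ h, hb _ h']
    · rw [B.move_of_notMem g h]
  neat_start i hi := by
    obtain ⟨e, he, hu⟩ := D.neat_start i hi
    refine ⟨e, he, ?_⟩
    obtain ⟨C, hC, hCsub, hCmove, -⟩ := hg.exists_core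
    have h0 : D.γ i 0 ∈ (𝓡∂ 2).boundary F :=
      (D.boundary_iff i 0 ⟨le_rfl, zero_le_one, fun h => absurd hi h⟩).2 ⟨hi, Or.inl rfl⟩
    have hC0 : D.γ i 0 ∉ C := fun h => by
      obtain ⟨p, -, hp⟩ := hCsub h
      exact B.e_pos.1.notMem_boundary p (hp ▸ h0)
    have hc : Continuous fun u : ℝ => e (halfPlanePoint u) := by
      refine he.1.continuous.comp (Continuous.subtype_mk ?_ _)
      exact continuous_pt (by fun_prop) continuous_const
    rw [hu.self_of_nhdsWithin (by simp)] at hC0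
    have hev := hc.continuousAt.eventually (hC.isOpen_compl.mem_nhds hC0)
    filter_upwards [hu, hev.filter_mono nhdsWithin_le_nhds] with u h1 h2
    rw [h1]
    exact hCmove _ h2
  neat_end i hi := by
    obtain ⟨e, he, hu⟩ := D.neat_end i hi
    refine ⟨e, he, ?_⟩
    obtain ⟨C, hC, hCsub, hCmove, -⟩ := hg.exists_core
    have h0 : D.γ i (1 - 0) ∈ (𝓡∂ 2).boundary F := by
      rw [sub_zero]
      exact (D.boundary_iff i 1 ⟨zero_le_one, le_rfl, fun h => absurd hi h⟩).2 ⟨hi, Or.inr rfl⟩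
    have hC0 : D.γ i (1 - 0) ∉ C := fun h => by
      obtain ⟨p, -, hp⟩ := hCsub h
      exact B.e_pos.1.notMem_boundary p (hp ▸ h0)
    have hc : Continuous fun u : ℝ => e (halfPlanePoint u) := by
      refine he.1.continuous.comp (Continuous.subtype_mk ?_ _)
      exact continuous_pt (by fun_prop) continuous_const
    rw [hu.self_of_nhdsWithin (by simp)] at hC0
    have hev := hc.continuousAt.eventually (hC.isOpen_compl.mem_nhds hC0)
    filter_upwards [hu, hev.filter_mono nhdsWithin_le_nhds] with u h1 h2
    rw [h1]
    exact hCmove _ h2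
  finite_double := by
    have h1 : {p : (Fin K × Fin K) × ℝ | p.1.1 ≠ p.1.2 ∧ p.2 ∈ Icc (-1 : ℝ) 1 ∧
        g p.1.1 p.2 = g p.1.2 p.2}.Finite := by
      have : {p : (Fin K × Fin K) × ℝ | p.1.1 ≠ p.1.2 ∧ p.2 ∈ Icc (-1 : ℝ) 1 ∧
          g p.1.1 p.2 = g p.1.2 p.2} = ⋃ ab : {ab : Fin K × Fin K // ab.1 ≠ ab.2},
            (fun x => (ab.1, x)) '' {x | x ∈ Icc (-1 : ℝ) 1 ∧ g ab.1.1 x = g ab.1.2 x} := by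
        ext ⟨ab, x⟩
        simp only [mem_ofPred_eq, mem_iUnion, mem_image, Prod.mk.injEq]
        constructor
        · rintro ⟨h, hx⟩; exact ⟨⟨ab, h⟩, x, hx, rfl, rfl⟩
        · rintro ⟨⟨ab', h⟩, x', hx, rfl, rfl⟩; exact ⟨h, hx⟩
      rw [this]
      exact finite_iUnion fun ab => (hg.finite ab.2).image _
    refine (D.finite_double.union (h1.image fun p =>
      ((B.comp p.1.1, rep Λ (B.comp p.1.1) (B.θ p.1.1 p.2)),
        (B.comp p.1.2, rep Λ (B.comp p.1.2) (B.θ p.1.2 p.2))))).subset ?_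
    rintro ⟨⟨i, s⟩, ⟨j, t⟩⟩ hp
    rcases hg.double_iff.1 hp with h | ⟨hs, ht, a, b, x, hab, hx, hgx, h1, h2⟩
    · exact Or.inl h
    · right
      obtain ⟨rfl, hs'⟩ := B.sameParam_of_eq (fundDomain_subset_paramDomain hs) hx h1
      obtain ⟨rfl, ht'⟩ := B.sameParam_of_eq (fundDomain_subset_paramDomain ht) hx h2
      exact ⟨((a, b), x), ⟨hab, hx, hgx⟩, Prod.ext (Prod.ext rfl (eq_rep hs hs').symm)
        (Prod.ext rfl (eq_rep ht ht').symm)⟩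
  double_interior i s j t h := by
    rcases hg.double_iff.1 h with h | ⟨hs, ht, a, b, x, hab, hx, hgx, h1, h2⟩
    · rw [B.move_of_notMem g (B.not_double h)]
      exact D.double_interior i s j t h
    · rw [h1, B.move_strand g hx]
      exact B.e_pos.1.notMem_boundary _
  no_triple i s j t k u h h' := by
    rcases hg.double_iff.1 h with h | ⟨hs, ht, a, b, x, hab, hx, hgx, h1, h2⟩ <;>
    rcases hg.double_iff.1 h' with h' | ⟨hs', hu, a', c, x', hac, hx', hgx', h1', h2'⟩
    · exact D.no_triple i s j t k u h h'
    · exact absurd (h1' ▸ B.mem_square hx' (B.y_mem a')) (B.not_double h)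
    · exact absurd (h1 ▸ B.mem_square hx (B.y_mem a)) (B.not_double h')
    · obtain ⟨rfl, h3⟩ := B.e_inj (h1.symm.trans h1')
      obtain rfl := B.y_mono.injective h3
      obtain rfl := hg.no_triple a b c x hab hac hgx hgx'
      obtain ⟨rfl, ht'⟩ := B.sameParam_of_eq (fundDomain_subset_paramDomain ht) hx h2
      obtain ⟨rfl, hu'⟩ := B.sameParam_of_eq (fundDomain_subset_paramDomain hu) hx h2'
      rw [eq_rep ht ht', eq_rep hu hu']
  transverse i s j t h := by
    have hbd : ∀ {i s}, s ∈ fundDomain Λ i → B.move g (D.γ i s) ∉ (𝓡∂ 2).boundary F →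
        i ∈ Λ → s ∈ Ioo (0 : ℝ) 1 := by
      intro i s hs hb
      refine mem_Ioo_of_notMem_boundary D (fundDomain_subset_paramDomain hs) fun hb' => hb ?_
      have hsq : D.γ i s ∉ B.e '' square := by
        rintro ⟨p, -, hp⟩
        exact B.e_pos.1.notMem_boundary p (hp ▸ hb')
      rwa [B.move_of_notMem g hsq]
    rcases hg.double_iff.1 h with hD | ⟨hs, ht, a, b, x, hab, hx, hgx, h1, h2⟩
    · obtain ⟨e, he, hu⟩ := D.transverse i s j t hD
      refine ⟨e, he, ?_⟩
      have hsq := B.not_double hD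
      have hint := D.double_interior i s j t hD
      have hregs := mem_Ioo_of_notMem_boundary D (fundDomain_subset_paramDomain hD.1) hint
      have hregt := mem_Ioo_of_notMem_boundary D (fundDomain_subset_paramDomain hD.2.1)
        (hD.2.2.2 ▸ hint)
      have hcl : IsClosed (B.e '' square) :=
        (isCompact_square.image B.e_pos.1.1.continuous).isClosed
      have hshift : ∀ t : ℝ, Tendsto (fun u : ℝ => t + u) (𝓝 0) (𝓝 t) := fun t => by
        have : Continuous fun u : ℝ => t + u := by fun_prop
        simpa using this.tendsto 0
      have h1 := (hshift s).eventually ((continuousAt_gamma D hregs).eventually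
        (hcl.isOpen_compl.mem_nhds hsq))
      have h2 := (hshift t).eventually ((continuousAt_gamma D hregt).eventually
        (hcl.isOpen_compl.mem_nhds (show D.γ j t ∉ _ from hD.2.2.2 ▸ hsq)))
      filter_upwards [hu, h1, h2] with u hu h1 h2
      rw [B.move_of_notMem g h1, B.move_of_notMem g h2]
      exact hu
    · have hbm : ∀ c, B.e !₂[x, g c x] ∉ (𝓡∂ 2).boundary F := fun c =>
        B.e_pos.1.notMem_boundary _
      have hregs := hbd hs (by rw [h1, B.move_strand g hx]; exact hbm a)
      have hregt := hbd ht (by rw [h2, B.move_strand g hx]; exact hbm b)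
      have hx1 : |x| < 1 := by
        obtain ⟨r, hr, hflat⟩ := hg.flat
        by_contra hle
        have hrx : r ≤ |x| := hr.le.trans (not_lt.1 hle)
        rw [hflat a x hrx, hflat b x hrx] at hgx
        exact hab (B.y_mono.injective hgx)
      obtain ⟨α, hα, hαs, hα0, k, hk, hαd⟩ := hg.strand_curve hregs hx1 h1
      obtain ⟨β, hβ, hβs, hβ0, l, hl, hβd⟩ := hg.strand_curve hregt hx1 h2
      obtain ⟨E, hE, hEu⟩ := exists_planeEmbedding_of_transverse B.e_pos.1 hαs hβs
        (by rw [hα0, hβ0, hgx]) hαd hβd (by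
          have := hg.transverse a b x hab hgx
          have h3 : k * l * (deriv (g b) x - deriv (g a) x) ≠ 0 :=
            mul_ne_zero (mul_ne_zero hk hl) (sub_ne_zero.2 this.symm)
          convert h3 using 1
          simp; ring)
      refine ⟨E, hE, ?_⟩
      have hshift : ∀ t : ℝ, Tendsto (fun u : ℝ => t + u) (𝓝 0) (𝓝 t) := fun t => by
        have : Continuous fun u : ℝ => t + u := by fun_prop
        simpa using this.tendsto 0
      filter_upwards [hEu, (hshift s).eventually hα, (hshift t).eventually hβ] with u h3 h4 h5
      rw [h4, h5]
      exact h3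
  -- outside the box the upper branches are the old ones; inside, the heights `ht` decide
  upper := {p | p.2 ∈ paramDomain Λ p.1 ∧
    ((D.γ p.1 p.2 ∉ B.e '' square ∧ p ∈ D.upper) ∨ B.Over g ht (D.γ p.1 p.2))}
  upper_domain i t h := h.1
  upper_periodic i hi t := by
    have h1 : ∀ t, t ∈ paramDomain Λ i := fun t h => absurd h hi
    simp only [mem_ofPred_eq, D.periodic i hi, D.upper_periodic i hi, h1, true_and]
  upper_double i s hs h := by
    rcases h.2 with ⟨hsq, hup⟩ | ⟨a, b, x, hx, h1, hgx, hlt⟩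
    · obtain ⟨j, t, hD⟩ := D.upper_double i s hs hup
      exact ⟨j, t, hg.double_iff.2 (Or.inl hD)⟩
    · have hab : a ≠ b := by rintro rfl; exact lt_irrefl _ hlt
      refine ⟨B.comp b, rep Λ (B.comp b) (B.θ b x), hg.double_iff.2 (Or.inr
        ⟨hs, rep_mem (B.θ_domain b x hx), a, b, x, hab, hx, hgx, h1, ?_⟩)⟩
      rw [← gamma_eq_of_sameParam D sameParam_rep, B.θ_eq b x hx]
  upper_iff i s j t h := by
    simp only [mem_ofPred_eq]
    rcases hg.double_iff.1 h with hD | ⟨hs, ht', a, b, x, hab, hx, hgx, h1, h2⟩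
    · have hsq := B.not_double hD
      have hsq' : D.γ j t ∉ B.e '' square := hD.2.2.2 ▸ hsq
      simp only [hsq, hsq', not_false_eq_true, true_and, B.not_over_of_notMem hsq,
        B.not_over_of_notMem hsq', or_false, fundDomain_subset_paramDomain hD.1,
        fundDomain_subset_paramDomain hD.2.1]
      exact D.upper_iff i s j t hD
    · have hsq : D.γ i s ∈ B.e '' square := h1 ▸ B.mem_square hx (B.y_mem a)
      have hsq' : D.γ j t ∈ B.e '' square := h2 ▸ B.mem_square hx (B.y_mem b)
      simp only [hsq, hsq', not_true_eq_false, false_and, false_or, true_and,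
        fundDomain_subset_paramDomain hs, fundDomain_subset_paramDomain ht']
      rw [h1, h2, B.over_strand hx, B.over_strand hx]
      constructor
      · rintro ⟨c, hc, hlt⟩ ⟨d, hd, hlt'⟩
        have hac : a ≠ c := by rintro rfl; exact lt_irrefl _ hlt
        have hbd : b ≠ d := by rintro rfl; exact lt_irrefl _ hlt'
        obtain rfl := hg.no_triple a b c x hab hac hgx hc
        obtain rfl := hg.no_triple b a d x hab.symm hbd hgx.symm hd
        exact lt_asymm hlt hlt'
      · intro hn
        refine ⟨b, hgx, ?_⟩
        rcases lt_trichotomy (ht b) (ht a) with h3 | h3 | h3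
        · exact h3
        · exact absurd (hinj h3) hab.symm
        · exact absurd ⟨a, hgx.symm, h3⟩ hn

end Box

end Diagrams

/-! ### Moves in a rectangle -/

section Rect

/-- A rectangle inside the square of a box, with centre `(x₀, h₀)` and half sides `u` and `v`. -/
structure IsRect (x₀ u h₀ v : ℝ) : Prop where
  u_pos : 0 < u
  v_pos : 0 < v
  x_left : -1 ≤ x₀ - u
  x_right : x₀ + u ≤ 1
  h_bot : -1 ≤ h₀ - v
  h_top : h₀ + v ≤ 1

/-- The affine embedding of the plane which takes the square to a rectangle. -/
noncomputable def rectMap (x₀ u h₀ v : ℝ) : Plane → Plane :=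
  prodPlane (fun x => x₀ + u * x) (fun y => h₀ + v * y)

variable {x₀ u h₀ v : ℝ}

lemma IsRect.positive {F : Type*} [TopologicalSpace F]
    [ChartedSpace (EuclideanHalfSpace 2) F] (hR : IsRect x₀ u h₀ v) [IsManifold (𝓡∂ 2) ∞ F]
    {e : Plane → F} (he : IsPositivePlaneEmbedding e) :
    IsPositivePlaneEmbedding (e ∘ rectMap x₀ u h₀ v) := by
  refine he.comp_prodPlane (by fun_prop) (by fun_prop) (fun x => ?_) fun x => ?_
  · simpa using hR.u_pos
  · simpa using hR.v_pos

lemma IsRect.x_mem (hR : IsRect x₀ u h₀ v) {x : ℝ} (hx : x ∈ Icc (-1 : ℝ) 1) :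
    x₀ + u * x ∈ Icc (x₀ - u) (x₀ + u) := by
  have := hR.u_pos
  constructor <;> nlinarith [hx.1, hx.2]

lemma IsRect.mem_unit (hR : IsRect x₀ u h₀ v) {x : ℝ} (hx : x ∈ Icc (x₀ - u) (x₀ + u)) :
    x ∈ Icc (-1 : ℝ) 1 := ⟨hR.x_left.trans hx.1, hx.2.trans hR.x_right⟩

lemma IsRect.exists_x (hR : IsRect x₀ u h₀ v) {x : ℝ} (hx : x ∈ Icc (x₀ - u) (x₀ + u)) :
    ∃ x' ∈ Icc (-1 : ℝ) 1, x = x₀ + u * x' := by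
  have := hR.u_pos
  refine ⟨(x - x₀) / u, ⟨?_, ?_⟩, by field_simp; ring⟩
  · rw [le_div_iff₀ this]; linarith [hx.1]
  · rw [div_le_iff₀ this]; linarith [hx.2]

lemma IsRect.mem_image_iff {F : Type*} (hR : IsRect x₀ u h₀ v) {e : Plane → F}
    (he : Function.Injective e)
    {x h : ℝ} : e !₂[x, h] ∈ (e ∘ rectMap x₀ u h₀ v) '' square ↔
      x ∈ Icc (x₀ - u) (x₀ + u) ∧ |h - h₀| ≤ v := by
  have hu := hR.u_pos
  have hv := hR.v_pos
  constructor
  · rintro ⟨p, ⟨hp0, hp1⟩, hp⟩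
    have := he hp
    have h0 : x₀ + u * p 0 = x := by simpa [rectMap] using congrArg (fun q : Plane => q 0) this
    have h1 : h₀ + v * p 1 = h := by simpa [rectMap] using congrArg (fun q : Plane => q 1) this
    refine ⟨h0 ▸ hR.x_mem (abs_le.1 hp0), ?_⟩
    rw [← h1, add_sub_cancel_left, abs_mul, abs_of_pos hv]
    nlinarith
  · rintro ⟨hx, hh⟩
    obtain ⟨x', hx', rfl⟩ := hR.exists_x hx
    refine ⟨!₂[x', (h - h₀) / v], ⟨by simpa using abs_le.2 hx', ?_⟩, ?_⟩
    · simp only [Matrix.cons_val_one, Matrix.cons_val_fin_one]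
      rw [abs_div, abs_of_pos hv, div_le_one hv]
      exact hh
    · simp only [Function.comp, rectMap]
      congr 1
      refine plane_ext (by simp) ?_
      simp only [prodPlane_one, Matrix.cons_val_one, Matrix.cons_val_fin_one]
      field_simp; ring

lemma IsRect.image_subset {F : Type*} (hR : IsRect x₀ u h₀ v) {e : Plane → F} :
    (e ∘ rectMap x₀ u h₀ v) '' square ⊆ e '' square := by
  rintro _ ⟨p, ⟨hp0, hp1⟩, rfl⟩
  refine ⟨_, ⟨?_, ?_⟩, rfl⟩
  · exact abs_le.2 (hR.mem_unit (hR.x_mem (abs_le.1 hp0)))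
  · have h1 := abs_le.1 hp1
    have := hR.v_pos
    simp only [rectMap, prodPlane_one]
    rw [abs_le]
    constructor <;> nlinarith [hR.h_bot, hR.h_top, h1.1, h1.2]

lemma rectMap_strand (hv : v ≠ 0) (x h : ℝ) :
    rectMap x₀ u h₀ v !₂[x, (h - h₀) / v] = !₂[x₀ + u * x, h] := by
  refine plane_ext (by simp [rectMap]) ?_
  simp only [rectMap, prodPlane_one, Matrix.cons_val_one, Matrix.cons_val_fin_one]
  field_simp; ring

/-- The local tangle formed by the graphs in a rectangle. -/
noncomputable def rectTangle {k : ℕ} (f : Fin k → ℝ → ℝ) (hR : IsRect x₀ u h₀ v)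
    (hf : ∀ c, ∀ x ∈ Icc (x₀ - u) (x₀ + u), |f c x - h₀| < v) : LocalTangle k :=
  have hlt : ∀ c, ∀ x ∈ Icc (-1 : ℝ) 1, |(f c (x₀ + u * x) - h₀) / v| < 1 := fun c x hx => by
    rw [abs_div, abs_of_pos hR.v_pos, div_lt_one hR.v_pos]
    exact hf c _ (hR.x_mem hx)
  { strand := fun c x => !₂[x, (f c (x₀ + u * x) - h₀) / v]
    inside := fun c x hx => ⟨by simpa using abs_lt.2 hx, by
      simpa using hlt c x ⟨hx.1.le, hx.2.le⟩⟩
    left := fun c => ⟨by simp, by simpa using hlt c (-1) (by simp)⟩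
    right := fun c => ⟨by simp, by simpa using hlt c 1 (by simp)⟩ }

end Rect

section Diagrams

variable {F : Type*} [TopologicalSpace F] [ChartedSpace (EuclideanHalfSpace 2) F]
  {n : ℕ} {Λ : Finset (Fin n)}

namespace Box

lemma admissible_const {D : TangleDiagram F n Λ} {K : ℕ} (B : Box D K) :
    B.Admissible fun a _ => B.y a where
  smooth _ := contDiff_const
  flat := ⟨0, one_pos, fun _ _ _ => rfl⟩
  mem a _ := B.y_mem a
  transverse _ _ _ hab h := absurd (B.y_mono.injective h) hab
  no_triple _ _ _ _ hab _ h _ := absurd (B.y_mono.injective h) hab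

variable [T2Space F] [IsManifold (𝓡∂ 2) ∞ F]

variable {D : TangleDiagram F n Λ} {K : ℕ} {B : Box D K} {g g' : Fin K → ℝ → ℝ} {ht : Fin K → ℕ}

lemma deform_gamma (hg : B.Admissible g) (hinj : Function.Injective ht) (i : Fin n) (t : ℝ) :
    (B.deform hg hinj).γ i t = B.move g (D.γ i t) := rfl

lemma deform_gamma_strand (hg : B.Admissible g) (hinj : Function.Injective ht) (a : Fin K) {x : ℝ}
    (hx : x ∈ Icc (-1 : ℝ) 1) :
    (B.deform hg hinj).γ (B.comp a) (B.θ a x) = B.e !₂[x, g a x] := by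
  rw [deform_gamma, B.θ_eq a x hx, B.move_strand g hx]

lemma mem_deform_upper (hg : B.Admissible g) (hinj : Function.Injective ht) {i : Fin n} {t : ℝ}
    (h : t ∈ paramDomain Λ i) : (i, t) ∈ (B.deform hg hinj).upper ↔
      (D.γ i t ∉ B.e '' square ∧ (i, t) ∈ D.upper) ∨ B.Over g ht (D.γ i t) :=
  ⟨fun h' => h'.2, fun h' => ⟨h, h'⟩⟩

lemma mem_deform_upper_strand (hg : B.Admissible g) (hinj : Function.Injective ht) (a : Fin K)
    {x : ℝ} (hx : x ∈ Icc (-1 : ℝ) 1) : (B.comp a, B.θ a x) ∈ (B.deform hg hinj).upper ↔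
      ∃ b, g a x = g b x ∧ ht b < ht a := by
  rw [mem_deform_upper hg hinj (B.θ_domain a x hx), B.θ_eq a x hx, B.over_strand hx]
  simp [B.mem_square hx (B.y_mem a)]

lemma mem_deform_upper_crossing (hg : B.Admissible g) (hinj : Function.Injective ht) {a b : Fin K}
    (hab : a ≠ b) {x : ℝ} (hx : x ∈ Icc (-1 : ℝ) 1) (h : g a x = g b x) :
    (B.comp a, B.θ a x) ∈ (B.deform hg hinj).upper ↔ ht b < ht a := by
  rw [mem_deform_upper_strand hg hinj a hx]
  constructor
  · rintro ⟨c, hc, hlt⟩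
    have hac : a ≠ c := by rintro rfl; exact lt_irrefl _ hlt
    rwa [hg.no_triple a b c x hab hac h hc]
  · exact fun hlt => ⟨b, h, hlt⟩

/-- Without moving the strands the diagram does not change. -/
lemma deform_const (hinj : Function.Injective ht) : B.deform B.admissible_const hinj = D := by
  have hm : ∀ q, B.move (fun a _ => B.y a) q = q := by
    intro q
    by_cases h : ∃ p : Fin K × ℝ, p.2 ∈ Icc (-1 : ℝ) 1 ∧ q = B.e !₂[p.2, B.y p.1]
    · obtain ⟨⟨a, x⟩, hx, rfl⟩ := h
      exact B.move_strand _ hx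
    · rw [move, dif_neg h]
  have hγ : (B.deform B.admissible_const hinj).γ = D.γ := by
    funext i t; exact hm _
  have hup : (B.deform B.admissible_const hinj).upper = D.upper := by
    ext ⟨i, t⟩
    constructor
    · rintro ⟨-, ⟨-, h⟩ | ⟨a, b, x, hx, -, h, hlt⟩⟩
      · exact h
      · exact absurd (B.y_mono.injective h ▸ hlt) (lt_irrefl _)
    · intro h
      have hd := D.upper_domain i t h
      refine ⟨hd, Or.inl ⟨?_, h⟩⟩
      have h' := (upper_iff_of_sameParam D sameParam_rep).1 h
      obtain ⟨j, s, hdouble⟩ := D.upper_double i _ (rep_mem hd) h'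
      change D.γ i t ∉ _
      rw [gamma_eq_of_sameParam D sameParam_rep]
      exact B.not_double hdouble
  generalize B.deform B.admissible_const hinj = D' at hγ hup
  cases D; cases D'
  simp only at hγ hup
  subst hγ hup
  rfl

variable {x₀ u h₀ v : ℝ}

/-- Two families which differ in a rectangle only. The strands `ι c` are those which meet the
rectangle. -/
structure DifferInRect (g g' : Fin K → ℝ → ℝ) {k : ℕ} (ι : Fin k → Fin K) (x₀ u h₀ v : ℝ) :
    Prop where
  rect : IsRect x₀ u h₀ v
  inside : ∀ c, ∀ x ∈ Icc (x₀ - u) (x₀ + u), |g (ι c) x - h₀| < v ∧ |g' (ι c) x - h₀| < v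
  outside : ∀ a, (∀ c, ι c ≠ a) → ∀ x ∈ Icc (x₀ - u) (x₀ + u), v < |g a x - h₀| ∧ g' a x = g a x
  same : ∀ a x, x ∉ Ioo (x₀ - u) (x₀ + u) → g' a x = g a x

lemma deform_strand_cases (hg : B.Admissible g) (hinj : Function.Injective ht) {i : Fin n} {t : ℝ}
    (hd : t ∈ paramDomain Λ i) (h : D.γ i t ∈ B.e '' square) :
    ∃ a, ∃ x ∈ Icc (-1 : ℝ) 1, B.comp a = i ∧ SameParam Λ i t (B.θ a x) ∧
      D.γ i t = B.e !₂[x, B.y a] ∧ (B.deform hg hinj).γ i t = B.e !₂[x, g a x] := by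
  obtain ⟨a, x, hx, hc, hs, he⟩ := B.exists_of_mem_square hd h
  exact ⟨a, x, hx, hc, hs, he, by rw [deform_gamma, he, B.move_strand g hx]⟩

lemma DifferInRect.over_iff {k : ℕ} {ι : Fin k → Fin K} (hd : DifferInRect g g' ι x₀ u h₀ v)
    {a : Fin K} {x : ℝ}
    (h : x ∉ Ioo (x₀ - u) (x₀ + u) ∨ x ∈ Icc (x₀ - u) (x₀ + u) ∧ ∀ c, ι c ≠ a) (b : Fin K) :
    g' a x = g' b x ↔ g a x = g b x := by
  by_cases hx : x ∈ Ioo (x₀ - u) (x₀ + u)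
  · obtain ⟨hx', ha⟩ := h.resolve_left (not_not.2 hx)
    obtain ⟨h1, h2⟩ := hd.outside a ha x hx'
    by_cases hb : ∃ c, ι c = b
    · obtain ⟨c, rfl⟩ := hb
      obtain ⟨h3, h4⟩ := hd.inside c x hx'
      rw [h2]
      constructor
      · intro h; rw [h] at h1; exact absurd h1 h4.not_gt
      · intro h; rw [h] at h1; exact absurd h1 h3.not_gt
    · push Not at hb
      rw [h2, (hd.outside b hb x hx').2]
  · rw [hd.same a x hx, hd.same b x hx]

/-- Two deformations which differ in a rectangle only are related by a local move. -/
noncomputable def rectMove (hg : B.Admissible g) (hg' : B.Admissible g')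
    (hinj : Function.Injective ht) {k : ℕ} {ι : Fin k → Fin K}
    (hd : DifferInRect g g' ι x₀ u h₀ v) :
    LocalMove (B.deform hg hinj) (B.deform hg' hinj) k where
  e := B.e ∘ rectMap x₀ u h₀ v
  e_pos := hd.rect.positive B.e_pos
  src := rectTangle (fun c => g (ι c)) hd.rect fun c x hx => (hd.inside c x hx).1
  tgt := rectTangle (fun c => g' (ι c)) hd.rect fun c x hx => (hd.inside c x hx).2
  same_ends c := by
    have h1 : g' (ι c) (x₀ + u * (-1)) = g (ι c) (x₀ + u * (-1)) :=
      hd.same _ _ fun h => by have := h.1; linarith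
    have h2 : g' (ι c) (x₀ + u * 1) = g (ι c) (x₀ + u * 1) :=
      hd.same _ _ fun h => by have := h.2; linarith
    simp only [rectTangle, h1, h2, and_self]
  comp c := B.comp (ι c)
  θ c x := B.θ (ι c) (x₀ + u * x)
  θ_cont c := by
    refine (B.θ_cont (ι c)).comp (by fun_prop) fun x hx => hd.rect.mem_unit (hd.rect.x_mem hx)
  θ_mono c := by
    have hu := hd.rect.u_pos
    have hm : ∀ x ∈ Icc (-1 : ℝ) 1, x₀ + u * x ∈ Icc (-1 : ℝ) 1 := fun x hx =>
      hd.rect.mem_unit (hd.rect.x_mem hx)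
    rcases B.θ_mono (ι c) with h | h
    · exact Or.inl fun x hx x' hx' hlt => h (hm x hx) (hm x' hx') (by nlinarith)
    · exact Or.inr fun x hx x' hx' hlt => h (hm x hx) (hm x' hx') (by nlinarith)
  θ_domain c x hx := B.θ_domain _ _ (hd.rect.mem_unit (hd.rect.x_mem hx))
  src_eq c x hx := by
    rw [deform_gamma_strand hg hinj _ (hd.rect.mem_unit (hd.rect.x_mem hx))]
    simp only [Function.comp, rectTangle, rectMap_strand hd.rect.v_pos.ne']
  tgt_eq c x hx := by
    rw [deform_gamma_strand hg' hinj _ (hd.rect.mem_unit (hd.rect.x_mem hx))]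
    simp only [Function.comp, rectTangle, rectMap_strand hd.rect.v_pos.ne']
  outside i t hdom := by
    rw [mem_deform_upper hg hinj hdom, mem_deform_upper hg' hinj hdom]
    by_cases hsq : D.γ i t ∈ B.e '' square
    · obtain ⟨a, x, hx, hc, hs, he, he'⟩ := deform_strand_cases hg hinj hdom hsq
      by_cases hin : x ∈ Icc (x₀ - u) (x₀ + u) ∧ ∃ c, ι c = a
      · obtain ⟨hxu, c, rfl⟩ := hin
        obtain ⟨x', hx', rfl⟩ := hd.rect.exists_x hxu
        exact Or.inl ⟨c, x', hx', hc, hs⟩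
      · right
        have hcase : x ∉ Ioo (x₀ - u) (x₀ + u) ∨
            x ∈ Icc (x₀ - u) (x₀ + u) ∧ ∀ c, ι c ≠ a := by
          by_cases hxu : x ∈ Icc (x₀ - u) (x₀ + u)
          · exact Or.inr ⟨hxu, fun c hca => hin ⟨hxu, c, hca⟩⟩
          · exact Or.inl fun h => hxu ⟨h.1.le, h.2.le⟩
        have hsame : g' a x = g a x := by
          rcases hcase with h | ⟨h1, h2⟩
          · exact hd.same a x h
          · exact (hd.outside a h2 x h1).2
        refine ⟨?_, ?_, ?_⟩
        · rw [he', hd.rect.mem_image_iff B.e_pos.1.injective]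
          rintro ⟨hxu, hle⟩
          exact ((hd.outside a (fun c hca => hin ⟨hxu, c, hca⟩) x hxu).1).not_ge hle
        · rw [he', deform_gamma, he, B.move_strand g' hx, hsame]
        · rw [he, B.over_strand hx, B.over_strand hx]
          simp only [hd.over_iff hcase]
    · right
      refine ⟨?_, ?_, ?_⟩
      · rw [deform_gamma, B.move_of_notMem g hsq]
        exact fun h => hsq (hd.rect.image_subset h)
      · rw [deform_gamma, deform_gamma, B.move_of_notMem g hsq, B.move_of_notMem g' hsq]
      · simp only [B.not_over_of_notMem hsq]

lemma rectMove_src_isGraph (hg : B.Admissible g) (hg' : B.Admissible g')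
    (hinj : Function.Injective ht) {k : ℕ} {ι : Fin k → Fin K}
    (hd : DifferInRect g g' ι x₀ u h₀ v) :
    (rectMove hg hg' hinj hd).src.IsGraph fun c x => (g (ι c) (x₀ + u * x) - h₀) / v :=
  fun _ _ _ => rfl

lemma rectMove_tgt_isGraph (hg : B.Admissible g) (hg' : B.Admissible g')
    (hinj : Function.Injective ht) {k : ℕ} {ι : Fin k → Fin K}
    (hd : DifferInRect g g' ι x₀ u h₀ v) :
    (rectMove hg hg' hinj hd).tgt.IsGraph fun c x => (g' (ι c) (x₀ + u * x) - h₀) / v :=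
  fun _ _ _ => rfl

lemma rectMove_isLayered (hg : B.Admissible g) (hg' : B.Admissible g')
    (hinj : Function.Injective ht) {k : ℕ} {ι : Fin k → Fin K} (hι : Function.Injective ι)
    (hd : DifferInRect g g' ι x₀ u h₀ v) :
    (rectMove hg hg' hinj hd).IsLayered (fun c => ht (ι c)) := by
  have hv := hd.rect.v_pos.ne'
  have key : ∀ (f : Fin K → ℝ → ℝ) {c d : Fin k} {x y : ℝ},
      (!₂[x, (f (ι c) (x₀ + u * x) - h₀) / v] : Plane) =
        !₂[y, (f (ι d) (x₀ + u * y) - h₀) / v] →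
      f (ι c) (x₀ + u * x) = f (ι d) (x₀ + u * x) := by
    intro f c d x y h
    have h0 : x = y := by simpa using congrArg (fun q : Plane => q 0) h
    have h1 := congrArg (fun q : Plane => q 1) h
    subst h0
    simp only [Matrix.cons_val_one, Matrix.cons_val_fin_one] at h1
    rw [div_left_inj' hv] at h1
    linarith
  intro c d hcd x hx y hy
  have hm := hd.rect.mem_unit (hd.rect.x_mem hx)
  constructor
  · intro h
    exact mem_deform_upper_crossing hg hinj (hι.ne hcd) hm (key g h)
  · intro h
    exact mem_deform_upper_crossing hg' hinj (hι.ne hcd) hm (key g' h)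

/-- A strand is pushed across a neighbouring one by a second Reidemeister move. -/
lemma step_of_bubble (hg : B.Admissible g) (hg' : B.Admissible g') (hinj : Function.Injective ht)
    {a b : Fin K} (hab : a ≠ b) (hd : DifferInRect g g' ![a, b] x₀ u h₀ v)
    (hlt : ∀ x ∈ Icc (x₀ - u) (x₀ + u), g a x < g b x) {x₁ x₂ : ℝ} (h12 : x₁ < x₂)
    (hx₁ : x₁ ∈ Icc (x₀ - u) (x₀ + u)) (hx₂ : x₂ ∈ Icc (x₀ - u) (x₀ + u))
    (hcross : ∀ x ∈ Icc (x₀ - u) (x₀ + u), g' a x = g' b x ↔ x = x₁ ∨ x = x₂) :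
    Step (B.deform hg hinj) (B.deform hg' hinj) := by
  have hι : Function.Injective ![a, b] := by
    intro c d h
    fin_cases c <;> fin_cases d <;> simp_all
  have hu := hd.rect.u_pos
  have hv := hd.rect.v_pos
  refine Step.omega2 (rectMove hg hg' hinj hd) ⟨⟨_, _, rectMove_src_isGraph hg hg' hinj hd,
    rectMove_tgt_isGraph hg hg' hinj hd, ?_, ?_⟩, _, hinj.comp hι,
    rectMove_isLayered hg hg' hinj hι hd⟩
  · intro x hx
    simp only [Matrix.cons_val_zero, Matrix.cons_val_one]
    have := hlt _ (hd.rect.x_mem hx)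
    gcongr
  · obtain ⟨z₁, hz₁, rfl⟩ := hd.rect.exists_x hx₁
    obtain ⟨z₂, hz₂, rfl⟩ := hd.rect.exists_x hx₂
    refine ⟨z₁, hz₁, z₂, hz₂, by nlinarith, fun x hx => ?_⟩
    simp only [Matrix.cons_val_zero, Matrix.cons_val_one]
    rw [div_left_inj' hv.ne', sub_left_inj, hcross _ (hd.rect.x_mem hx)]
    simp [hu.ne']

/-- A rectangle in which the deformed strands are horizontal lines is a box of the deformed
diagram. -/
noncomputable def subBox (hg : B.Admissible g) (hinj : Function.Injective ht) {k : ℕ}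
    (ι : Fin k → Fin K) (hR : IsRect x₀ u h₀ v) (y : Fin k → ℝ) (hy : StrictMono y)
    (hy1 : ∀ c, |y c| < 1)
    (hin : ∀ c, ∀ x ∈ Icc (x₀ - u) (x₀ + u), g (ι c) x = h₀ + v * y c)
    (hout : ∀ a, (∀ c, ι c ≠ a) → ∀ x ∈ Icc (x₀ - u) (x₀ + u), v < |g a x - h₀|) :
    Box (B.deform hg hinj) k where
  e := B.e ∘ rectMap x₀ u h₀ v
  e_pos := hR.positive B.e_pos
  y := y
  y_mono := hy
  y_mem := hy1
  comp c := B.comp (ι c)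
  θ c x := B.θ (ι c) (x₀ + u * x)
  θ_cont c := by
    refine (B.θ_cont (ι c)).comp (by fun_prop) fun x hx => hR.mem_unit (hR.x_mem hx)
  θ_mono c := by
    have hu := hR.u_pos
    have hm : ∀ x ∈ Icc (-1 : ℝ) 1, x₀ + u * x ∈ Icc (-1 : ℝ) 1 := fun x hx =>
      hR.mem_unit (hR.x_mem hx)
    rcases B.θ_mono (ι c) with h | h
    · exact Or.inl fun x hx x' hx' hlt => h (hm x hx) (hm x' hx') (by nlinarith)
    · exact Or.inr fun x hx x' hx' hlt => h (hm x hx) (hm x' hx') (by nlinarith)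
  θ_domain c x hx := B.θ_domain _ _ (hR.mem_unit (hR.x_mem hx))
  θ_eq c x hx := by
    rw [deform_gamma_strand hg hinj _ (hR.mem_unit (hR.x_mem hx)), hin c _ (hR.x_mem hx)]
    simp only [Function.comp]
    congr 1
  cover i t hdom h := by
    have hsq : D.γ i t ∈ B.e '' square :=
      (hg.move_mem_square_iff hdom).1 (hR.image_subset h)
    obtain ⟨a, x, hx, hc, hs, he, he'⟩ := deform_strand_cases hg hinj hdom hsq
    rw [he', hR.mem_image_iff B.e_pos.1.injective] at h
    obtain ⟨hxu, hle⟩ := h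
    by_cases ha : ∃ c, ι c = a
    · obtain ⟨c, rfl⟩ := ha
      obtain ⟨x', hx', rfl⟩ := hR.exists_x hxu
      exact ⟨c, x', hx', hc, hs⟩
    · push Not at ha
      exact absurd hle (hout a ha x hxu).not_ge

end Box

end Diagrams

/-! ### Ramps and bumps -/

/-- The normalized integral of a bump function. -/
lemma exists_unitRamp : ∃ R : ℝ → ℝ, ContDiff ℝ ∞ R ∧ (∀ x ≤ 0, R x = 0) ∧ (∀ x, 1 ≤ x → R x = 1) ∧
    ∀ x ∈ Ioo (0 : ℝ) 1, 0 < deriv R x := by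
  let b : ContDiffBump (1 / 2 : ℝ) := ⟨1 / 4, 1 / 2, by norm_num, by norm_num⟩
  have hb : ContDiff ℝ ∞ b := b.contDiff
  have hc : Continuous b := hb.continuous
  have hzero : ∀ t, t ∉ Ioo (0 : ℝ) 1 → b t = 0 := by
    intro t ht
    refine b.zero_of_le_dist ?_
    change 1 / 2 ≤ dist t (1 / 2)
    rw [Real.dist_eq]
    by_contra hlt
    have := abs_lt.1 (not_le.1 hlt)
    exact ht ⟨by linarith [this.1], by linarith [this.2]⟩
  have hpos : ∀ t ∈ Ioo (0 : ℝ) 1, 0 < b t := by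
    intro t ht
    refine b.pos_of_mem_ball ?_
    change dist t (1 / 2) < 1 / 2
    rw [Real.dist_eq, abs_lt]
    constructor <;> linarith [ht.1, ht.2]
  have hI : 0 < ∫ t in (0 : ℝ)..1, b t :=
    intervalIntegral.intervalIntegral_pos_of_pos_on (hc.intervalIntegrable _ _) hpos one_pos
  set I := ∫ t in (0 : ℝ)..1, b t with hIdef
  have hd : ∀ u, HasDerivAt (fun u => (∫ t in (0 : ℝ)..u, b t) / I) (b u / I) u := fun u =>
    (intervalIntegral.integral_hasDerivAt_right (hc.intervalIntegrable _ _)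
      hc.stronglyMeasurable.stronglyMeasurableAtFilter hc.continuousAt).div_const I
  refine ⟨fun u => (∫ t in (0 : ℝ)..u, b t) / I, ?_, ?_, ?_, ?_⟩
  · rw [contDiff_infty_iff_deriv]
    refine ⟨fun u => (hd u).differentiableAt, ?_⟩
    rw [funext fun u => (hd u).deriv]
    exact hb.div_const I
  · intro x hx
    have : ∫ t in (0 : ℝ)..x, b t = ∫ t in (0 : ℝ)..x, (0 : ℝ) := by
      refine intervalIntegral.integral_congr fun t ht => hzero t fun h => ?_
      rw [uIcc_of_ge hx] at ht
      exact h.1.not_ge ht.2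
    simp [this]
  · intro x hx
    have h1 : ∫ t in (1 : ℝ)..x, b t = ∫ t in (1 : ℝ)..x, (0 : ℝ) := by
      refine intervalIntegral.integral_congr fun t ht => hzero t fun h => ?_
      rw [uIcc_of_le hx] at ht
      exact h.2.not_ge ht.1
    have h2 := intervalIntegral.integral_add_adjacent_intervals
      (hc.intervalIntegrable (μ := MeasureTheory.volume) 0 1) (hc.intervalIntegrable 1 x)
    rw [h1, intervalIntegral.integral_zero, add_zero] at h2
    simp only
    rw [← h2, ← hIdef, div_self hI.ne']
  · intro x hx
    rw [(hd x).deriv]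
    exact div_pos (hpos x hx) hI

/-- A smooth function which vanishes on `(-∞, p]`, equals `1` on `[q, ∞)` and has a positive
derivative on `(p, q)`. -/
noncomputable def ramp (p q x : ℝ) : ℝ := exists_unitRamp.choose ((x - p) / (q - p))

lemma ramp_smooth (p q : ℝ) : ContDiff ℝ ∞ (ramp p q) :=
  exists_unitRamp.choose_spec.1.comp (by fun_prop)

section Ramp

variable {p q x : ℝ} (h : p < q)

include h

lemma ramp_left (hx : x ≤ p) : ramp p q x = 0 :=
  exists_unitRamp.choose_spec.2.1 _ (div_nonpos_of_nonpos_of_nonneg (by linarith) (by linarith))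

lemma ramp_right (hx : q ≤ x) : ramp p q x = 1 :=
  exists_unitRamp.choose_spec.2.2.1 _ (by rw [le_div_iff₀ (by linarith)]; linarith)

lemma ramp_deriv (hx : x ∈ Ioo p q) : 0 < deriv (ramp p q) x := by
  have hpq : 0 < q - p := by linarith
  have hm : (x - p) / (q - p) ∈ Ioo (0 : ℝ) 1 :=
    ⟨div_pos (by linarith [hx.1]) hpq, by rw [div_lt_one hpq]; linarith [hx.2]⟩
  have h1 := (exists_unitRamp.choose_spec.1.differentiable (by simp) ((x - p) / (q - p))).hasDerivAt
  have h2 : HasDerivAt (fun x => (x - p) / (q - p)) (1 / (q - p)) x :=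
    ((hasDerivAt_id x).sub_const p).div_const (q - p)
  have h3 : HasDerivAt (ramp p q) _ x := h1.comp x h2
  rw [h3.deriv]
  have := exists_unitRamp.choose_spec.2.2.2 _ hm
  positivity

lemma ramp_strictMonoOn : StrictMonoOn (ramp p q) (Icc p q) := by
  refine strictMonoOn_of_deriv_pos (convex_Icc p q) (ramp_smooth p q).continuous.continuousOn ?_
  intro x hx
  rw [interior_Icc] at hx
  exact ramp_deriv h hx

lemma ramp_mem_Ioo (hx : x ∈ Ioo p q) : ramp p q x ∈ Ioo (0 : ℝ) 1 := by
  have hm := ramp_strictMonoOn h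
  have hxI : x ∈ Icc p q := ⟨hx.1.le, hx.2.le⟩
  constructor
  · rw [← ramp_left h le_rfl]
    exact hm (left_mem_Icc.2 h.le) hxI hx.1
  · rw [← ramp_right h le_rfl]
    exact hm hxI (right_mem_Icc.2 h.le) hx.2

lemma ramp_mem_Icc : ramp p q x ∈ Icc (0 : ℝ) 1 := by
  rcases le_or_gt x p with h1 | h1
  · rw [ramp_left h h1]; simp
  · rcases le_or_gt q x with h2 | h2
    · rw [ramp_right h h2]; simp
    · exact Ioo_subset_Icc_self (ramp_mem_Ioo h ⟨h1, h2⟩)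

lemma mem_Ioo_of_ramp (hx : ramp p q x ∈ Ioo (0 : ℝ) 1) : x ∈ Ioo p q := by
  constructor
  · by_contra hn
    rw [ramp_left h (not_lt.1 hn)] at hx
    exact lt_irrefl _ hx.1
  · by_contra hn
    rw [ramp_right h (not_lt.1 hn)] at hx
    exact lt_irrefl _ hx.2

/-- A ramp takes each intermediate value exactly once. -/
lemma ramp_level {l : ℝ} (hl : l ∈ Ioo (0 : ℝ) 1) :
    ∃ z ∈ Ioo p q, ∀ x, ramp p q x = l ↔ x = z := by
  have hivt := intermediate_value_Ioo h.le (ramp_smooth p q).continuous.continuousOn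
  rw [ramp_left h le_rfl, ramp_right h le_rfl] at hivt
  obtain ⟨z, hz, hzl⟩ := hivt hl
  refine ⟨z, hz, fun x => ⟨fun hx => ?_, fun hx => hx ▸ hzl⟩⟩
  have hxI := mem_Ioo_of_ramp h (hx ▸ hl)
  exact (ramp_strictMonoOn h).injOn (Ioo_subset_Icc_self hxI) (Ioo_subset_Icc_self hz)
    (hx.trans hzl.symm)

end Ramp

/-- A smooth function which vanishes outside `(p, q')`, equals `1` on `[p', q]`, is increasing in
between on the left and decreasing in between on the right. -/
noncomputable def bump (p p' q q' x : ℝ) : ℝ := ramp p p' x - ramp q q' x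

lemma bump_smooth (p p' q q' : ℝ) : ContDiff ℝ ∞ (bump p p' q q') :=
  (ramp_smooth p p').sub (ramp_smooth q q')

section Bump

variable {p p' q q' x : ℝ} (h : p < p') (h' : p' < q) (h'' : q < q')

lemma bump_eq_left (h'' : q < q') (hx : x ≤ q) : bump p p' q q' x = ramp p p' x := by
  rw [bump, ramp_left h'' hx, sub_zero]

lemma bump_eq_right (h : p < p') (hx : p' ≤ x) : bump p p' q q' x = 1 - ramp q q' x := by
  rw [bump, ramp_right h hx]

lemma deriv_bump : deriv (bump p p' q q') x = deriv (ramp p p') x - deriv (ramp q q') x := by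
  have h1 := (ramp_smooth p p').differentiable (by simp) x
  have h2 := (ramp_smooth q q').differentiable (by simp) x
  exact deriv_fun_sub h1 h2

lemma bump_one (h : p < p') (h'' : q < q') (hx : p' ≤ x) (hx' : x ≤ q) : bump p p' q q' x = 1 := by
  rw [bump_eq_left h'' hx', ramp_right h hx]

include h h' h''

lemma bump_zero_left (hx : x ≤ p) : bump p p' q q' x = 0 := by
  rw [bump_eq_left h'' (by linarith), ramp_left h hx]

lemma bump_zero_right (hx : q' ≤ x) : bump p p' q q' x = 0 := by
  rw [bump_eq_right h (by linarith), ramp_right h'' hx, sub_self]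

lemma bump_mem_Icc : bump p p' q q' x ∈ Icc (0 : ℝ) 1 := by
  rcases le_total x q with hx | hx
  · rw [bump_eq_left h'' hx]; exact ramp_mem_Icc h
  · rw [bump_eq_right h (by linarith)]
    have := ramp_mem_Icc h'' (x := x)
    constructor <;> linarith [this.1, this.2]

lemma bump_deriv_ne_zero (hx : bump p p' q q' x ∈ Ioo (0 : ℝ) 1) :
    deriv (bump p p' q q') x ≠ 0 := by
  rcases le_total x q with hxq | hxq
  · rw [bump_eq_left h'' hxq] at hx
    have hm := mem_Ioo_of_ramp h hx
    have h0 : ramp q q' =ᶠ[𝓝 x] fun _ => 0 := by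
      filter_upwards [Iio_mem_nhds (hm.2.trans h')] with y hy using ramp_left h'' (le_of_lt hy)
    rw [deriv_bump, h0.deriv_eq, deriv_const, sub_zero]
    exact (ramp_deriv h hm).ne'
  · rw [bump_eq_right h (by linarith)] at hx
    have hm := mem_Ioo_of_ramp h'' (x := x) ⟨by linarith [hx.2], by linarith [hx.1]⟩
    have h0 : ramp p p' =ᶠ[𝓝 x] fun _ => 1 := by
      filter_upwards [Ioi_mem_nhds (h'.trans hm.1)] with y hy using ramp_right h (le_of_lt hy)
    rw [deriv_bump, h0.deriv_eq, deriv_const, zero_sub, neg_ne_zero]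
    exact (ramp_deriv h'' hm).ne'

/-- A bump takes each intermediate value exactly twice. -/
lemma bump_level {l : ℝ} (hl : l ∈ Ioo (0 : ℝ) 1) : ∃ z ∈ Ioo p p', ∃ z' ∈ Ioo q q',
    ∀ x, bump p p' q q' x = l ↔ x = z ∨ x = z' := by
  obtain ⟨z, hz, hzl⟩ := ramp_level h hl
  obtain ⟨z', hz', hzl'⟩ := ramp_level h'' (l := 1 - l) ⟨by linarith [hl.2], by linarith [hl.1]⟩
  refine ⟨z, hz, z', hz', fun x => ?_⟩
  rcases le_total x q with hx | hx
  · rw [bump_eq_left h'' hx, hzl]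
    exact (or_iff_left fun hh => by linarith [hz'.1]).symm
  · rw [bump_eq_right h (by linarith)]
    constructor
    · intro hh; exact Or.inr ((hzl' x).1 (by linarith))
    · rintro (hh | hh)
      · linarith [hz.2]
      · have := (hzl' x).2 hh; linarith

end Bump

section Diagrams

variable {F : Type*} [TopologicalSpace F] [ChartedSpace (EuclideanHalfSpace 2) F]
  {n : ℕ} {Λ : Finset (Fin n)}

namespace Box

/-! ### Permuting the strands of a box -/

section

variable {D : TangleDiagram F n Λ} {K : ℕ} {B : Box D K} {g : Fin K → ℝ → ℝ}

/-- A family is admissible if at each moment all strands but one have pairwise different heights,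
and the exceptional strand crosses the other ones, standing still at that moment, with nonzero
speed. -/
lemma Admissible.of_moving (smooth : ∀ a, ContDiff ℝ ∞ (g a))
    (flat : ∃ r < 1, ∀ a x, r ≤ |x| → g a x = B.y a) (mem : ∀ a x, |g a x| < 1)
    (H : ∀ x, ∃ m, (∀ a b, a ≠ m → b ≠ m → a ≠ b → g a x ≠ g b x) ∧
      ∀ a, a ≠ m → g a x = g m x → deriv (g a) x = 0 ∧ deriv (g m) x ≠ 0) : B.Admissible g where
  smooth := smooth
  flat := flat
  mem := mem
  transverse a b x hab h := by
    obtain ⟨m, h1, h2⟩ := H x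
    by_cases ha : a = m
    · subst ha
      obtain ⟨h3, h4⟩ := h2 b hab.symm h.symm
      rw [h3]; exact h4
    · by_cases hb : b = m
      · subst hb
        obtain ⟨h3, h4⟩ := h2 a hab h
        rw [h3]; exact h4.symm
      · exact absurd h (h1 a b ha hb hab)
  no_triple a b c x hab hac h h' := by
    obtain ⟨m, h1, -⟩ := H x
    by_contra hbc
    by_cases ha : a = m
    · subst ha
      exact h1 b c hab.symm hac.symm hbc (h.symm.trans h')
    · by_cases hb : b = m
      · subst hb
        exact h1 a c hab (Ne.symm hbc) hac h'
      · exact h1 a b ha hb hab h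

/-- The family in which only the strand `a` moves: it makes an excursion to the height `h`. -/
noncomputable def bumpFamily (B : Box D K) (a : Fin K) (h p p' q q' : ℝ) (c : Fin K) (x : ℝ) : ℝ :=
  if c = a then B.y a + (h - B.y a) * bump p p' q q' x else B.y c

lemma bumpFamily_self {a : Fin K} {h p p' q q' : ℝ} (x : ℝ) :
    B.bumpFamily a h p p' q q' a x = B.y a + (h - B.y a) * bump p p' q q' x := if_pos rfl

lemma bumpFamily_of_ne {a c : Fin K} {h p p' q q' : ℝ} (hc : c ≠ a) :
    B.bumpFamily a h p p' q q' c = fun _ => B.y c := by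
  funext x; exact if_neg hc

lemma admissible_bumpFamily {a : Fin K} {h p p' q q' : ℝ} (hp : p < p') (hpq : p' < q) (hq : q < q')
    (hp1 : -1 < p) (hq1 : q' < 1) (hh : |h| < 1) (hah : B.y a < h) (hy : ∀ b, B.y b ≠ h) :
    B.Admissible (B.bumpFamily a h p p' q q') := by
  have hval : ∀ x, B.y a ≤ B.bumpFamily a h p p' q q' a x ∧
      B.bumpFamily a h p p' q q' a x ≤ h := fun x => by
    have := bump_mem_Icc hp hpq hq (x := x)
    rw [bumpFamily_self]
    constructor <;> nlinarith [this.1, this.2]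
  have hsm : ContDiff ℝ ∞ fun x => B.y a + (h - B.y a) * bump p p' q q' x :=
    contDiff_const.add (contDiff_const.mul (bump_smooth _ _ _ _))
  have hself : B.bumpFamily a h p p' q q' a = fun x => B.y a + (h - B.y a) * bump p p' q q' x :=
    funext fun x => bumpFamily_self x
  refine Admissible.of_moving ?_ ⟨max (-p) q', max_lt (by linarith) hq1, ?_⟩ ?_ fun x => ⟨a, ?_, ?_⟩
  · intro c
    by_cases hc : c = a
    · subst hc; rw [hself]; exact hsm
    · rw [bumpFamily_of_ne hc]; exact contDiff_const
  · intro c x hx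
    by_cases hc : c = a
    · subst hc
      have : bump p p' q q' x = 0 := by
        rcases le_total 0 x with h0 | h0
        · rw [abs_of_nonneg h0] at hx
          exact bump_zero_right hp hpq hq ((le_max_right _ _).trans hx)
        · rw [abs_of_nonpos h0] at hx
          exact bump_zero_left hp hpq hq (by linarith [(le_max_left (-p) q').trans hx])
      rw [bumpFamily_self, this]; ring
    · rw [bumpFamily_of_ne hc]
  · intro c x
    by_cases hc : c = a
    · subst hc
      have h1 := hval x
      have h2 := abs_lt.1 hh
      have h3 := abs_lt.1 (B.y_mem c)
      exact abs_lt.2 ⟨by linarith [h3.1], by linarith [h2.2]⟩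
    · rw [bumpFamily_of_ne hc]; exact B.y_mem c
  · intro b c hb hc hbc
    rw [bumpFamily_of_ne hb, bumpFamily_of_ne hc]
    exact fun hh => hbc (B.y_mono.injective hh)
  · intro b hb hx
    rw [bumpFamily_of_ne hb] at hx ⊢
    refine ⟨deriv_const _ _, ?_⟩
    have hd : deriv (B.bumpFamily a h p p' q q' a) x = (h - B.y a) * deriv (bump p p' q q') x := by
      rw [hself, deriv_const_add, deriv_const_mul]
      exact (bump_smooth _ _ _ _).differentiable (by simp) x
    rw [hd]
    refine mul_ne_zero (by linarith) (bump_deriv_ne_zero hp hpq hq ?_)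
    have h01 := bump_mem_Icc hp hpq hq (x := x)
    rw [bumpFamily_self] at hx
    simp only at hx
    constructor
    · refine lt_of_le_of_ne h01.1 fun h0 => hb (B.y_mono.injective ?_)
      rw [hx, ← h0]; ring
    · refine lt_of_le_of_ne h01.2 fun h1 => hy b ?_
      rw [hx, h1]; ring

/-- The strand `c` of the box `B'` is a part of the strand `ι c` of the box `B`. -/
structure Refines {D' : TangleDiagram F n Λ} {k : ℕ} (B' : Box D' k) (B : Box D K)
    (ι : Fin k → Fin K) : Prop where
  comp_eq : ∀ c, B'.comp c = B.comp (ι c)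
  mono : ∀ c, StrictMonoOn (B.θ (ι c)) (Icc (-1) 1) → StrictMonoOn (B'.θ c) (Icc (-1) 1)
  range : ∀ c, ∀ x ∈ Icc (-1 : ℝ) 1, ∃ x' ∈ Icc (-1 : ℝ) 1, B'.θ c x = B.θ (ι c) x'

lemma Refines.refl (B : Box D K) : B.Refines B id :=
  ⟨fun _ => rfl, fun _ h => h, fun _ x hx => ⟨x, hx, rfl⟩⟩

lemma Refines.trans {D' D'' : TangleDiagram F n Λ} {k l : ℕ} {B'' : Box D'' l} {B' : Box D' k}
    {ι : Fin k → Fin K} {κ : Fin l → Fin k} (h' : B''.Refines B' κ) (h : B'.Refines B ι) :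
    B''.Refines B (ι ∘ κ) where
  comp_eq c := (h'.comp_eq c).trans (h.comp_eq _)
  mono c hc := h'.mono c (h.mono _ hc)
  range c x hx := by
    obtain ⟨x', hx', h1⟩ := h'.range c x hx
    obtain ⟨x'', hx'', h2⟩ := h.range _ x' hx'
    exact ⟨x'', hx'', h1.trans h2⟩

end

/-- Room for the strand `a` to pass over its upper neighbour `a'` only. -/
lemma exists_levels {D : TangleDiagram F n Λ} {K : ℕ} (B : Box D K) {a a' : Fin K}
    (haa' : (a' : ℕ) = a + 1) :
    ∃ c h d, -1 < c ∧ c < B.y a ∧ B.y a' < h ∧ h < d ∧ d < 1 ∧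
      ∀ b, b ≠ a → b ≠ a' → B.y b < c ∨ d < B.y b := by
  have h1 : ∀ᶠ d in 𝓝[>] (B.y a'), d < 1 ∧ ∀ b, B.y a' < B.y b → d < B.y b := by
    refine Filter.Eventually.and ?_ (eventually_all.2 fun b => ?_)
    · exact (Iio_mem_nhds (abs_lt.1 (B.y_mem a')).2 |> nhdsWithin_le_nhds)
    · by_cases hb : B.y a' < B.y b
      · filter_upwards [nhdsWithin_le_nhds (Iio_mem_nhds hb)] with d hd _ using hd
      · exact .of_forall fun d h => absurd h hb
  have h2 : ∀ᶠ c in 𝓝[<] (B.y a), -1 < c ∧ ∀ b, B.y b < B.y a → B.y b < c := by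
    refine Filter.Eventually.and ?_ (eventually_all.2 fun b => ?_)
    · exact (Ioi_mem_nhds (abs_lt.1 (B.y_mem a)).1 |> nhdsWithin_le_nhds)
    · by_cases hb : B.y b < B.y a
      · filter_upwards [nhdsWithin_le_nhds (Ioi_mem_nhds hb)] with d hd _ using hd
      · exact .of_forall fun d h => absurd h hb
  obtain ⟨d, ⟨hd1, hd⟩, hd0⟩ := (h1.and self_mem_nhdsWithin).exists
  obtain ⟨c, ⟨hc1, hc⟩, hc0⟩ := (h2.and self_mem_nhdsWithin).exists
  obtain ⟨h, hh, hh'⟩ := exists_between (show B.y a' < d from hd0)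
  refine ⟨c, h, d, hc1, hc0, hh, hh', hd1, fun b hb hb' => ?_⟩
  rcases lt_or_ge b a with hlt | hge
  · exact Or.inl (hc b (B.y_mono hlt))
  · refine Or.inr (hd b (B.y_mono ?_))
    have e1 : (a : ℕ) ≤ b := hge
    have e2 : (b : ℕ) ≠ a := fun h => hb (Fin.ext h)
    have e3 : (b : ℕ) ≠ a' := fun h => hb' (Fin.ext h)
    change (a' : ℕ) < b
    omega

variable [T2Space F] [IsManifold (𝓡∂ 2) ∞ F]
variable {D : TangleDiagram F n Λ} {K : ℕ}

/-- The strands of the box in a rectangle are parts of the strands which enter it. -/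
lemma subBox_refines {B : Box D K} {g : Fin K → ℝ → ℝ} {ht : Fin K → ℕ} (hg : B.Admissible g)
    (hinj : Function.Injective ht) {x₀ u h₀ v : ℝ} {k : ℕ} (ι : Fin k → Fin K)
    (hR : IsRect x₀ u h₀ v) (y : Fin k → ℝ) (hy : StrictMono y) (hy1 : ∀ c, |y c| < 1)
    (hin : ∀ c, ∀ x ∈ Icc (x₀ - u) (x₀ + u), g (ι c) x = h₀ + v * y c)
    (hout : ∀ a, (∀ c, ι c ≠ a) → ∀ x ∈ Icc (x₀ - u) (x₀ + u), v < |g a x - h₀|) :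
    (subBox hg hinj ι hR y hy hy1 hin hout).Refines B ι where
  comp_eq _ := rfl
  mono c hc x hx x' hx' hlt := by
    have hu := hR.u_pos
    exact hc (hR.mem_unit (hR.x_mem hx)) (hR.mem_unit (hR.x_mem hx')) (by nlinarith)
  range c x hx := ⟨_, hR.mem_unit (hR.x_mem hx), rfl⟩

/-- Two neighbouring strands of a box can be exchanged: the middle part of a bubble is a box of the
new diagram. -/
lemma exists_swap (B : Box D K) {a a' : Fin K} (haa' : (a' : ℕ) = a + 1) :
    ∃ (D' : TangleDiagram F n Λ) (B' : Box D' K), Step D D' ∧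
      B'.Refines B (Equiv.swap a a') := by
  obtain ⟨c, h, d, hc1, hca, hah, hhd, hd1, hout⟩ := B.exists_levels haa'
  have hne : a ≠ a' := by rintro rfl; omega
  have hlt : B.y a < B.y a' := B.y_mono (show (a : ℕ) < a' by omega)
  have hinj : Function.Injective (fun c : Fin K => (c : ℕ)) := Fin.val_injective
  have z1 : (-3 / 4 : ℝ) < -1 / 2 := by norm_num
  have z2 : (-1 / 2 : ℝ) < 1 / 2 := by norm_num
  have z3 : (1 / 2 : ℝ) < 3 / 4 := by norm_num
  -- the strand `a` makes an excursion to the height `h` above `a'`, with a plateau over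
  -- `[-1/2, 1/2]`
  have hg : B.Admissible (B.bumpFamily a h (-3 / 4) (-1 / 2) (1 / 2) (3 / 4)) := by
    refine admissible_bumpFamily z1 z2 z3 (by norm_num) (by norm_num) ?_ (by linarith)
      fun b hb => ?_
    · exact abs_lt.2 ⟨by linarith, by linarith⟩
    · by_cases hba : b = a
      · subst hba; linarith
      · by_cases hba' : b = a'
        · subst hba'; linarith
        · rcases hout b hba hba' with h1 | h1 <;> linarith
  set g := B.bumpFamily a h (-3 / 4) (-1 / 2) (1 / 2) (3 / 4) with hgdef
  have hga : ∀ x, g a x = B.y a + (h - B.y a) * bump (-3 / 4) (-1 / 2) (1 / 2) (3 / 4) x :=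
    fun x => bumpFamily_self x
  have hgb : ∀ b, b ≠ a → ∀ x, g b x = B.y b := fun b hb x => congrFun (bumpFamily_of_ne hb) x
  have hgI : ∀ x, B.y a ≤ g a x ∧ g a x ≤ h := fun x => by
    have := bump_mem_Icc z1 z2 z3 (x := x)
    rw [hga]
    constructor <;> nlinarith [this.1, this.2]
  -- between the heights `c` and `d` there are only the strands `a` and `a'`, which form a bubble
  have hstep : Step D (B.deform hg hinj) := by
    have hl : (B.y a' - B.y a) / (h - B.y a) ∈ Ioo (0 : ℝ) 1 :=
      ⟨div_pos (by linarith) (by linarith), by rw [div_lt_one (by linarith)]; linarith⟩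
    obtain ⟨x₁, hx₁, x₂, hx₂, hx⟩ := bump_level z1 z2 z3 hl
    have hR : DifferInRect (fun b _ => B.y b) g ![a, a'] 0 1 ((c + d) / 2) ((d - c) / 2) := by
      refine ⟨⟨by norm_num, by linarith, by norm_num, by norm_num, by linarith, by linarith⟩,
        ?_, ?_, ?_⟩
      · intro b x _
        have := hgI x
        fin_cases b
        · simp only [Fin.zero_eta, Matrix.cons_val_zero, abs_lt]
          refine ⟨⟨?_, ?_⟩, ?_, ?_⟩ <;> linarith
        · simp only [Fin.mk_one, Matrix.cons_val_one, Matrix.cons_val_fin_one, hgb a' hne.symm,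
            abs_lt]
          refine ⟨⟨?_, ?_⟩, ?_, ?_⟩ <;> linarith
      · intro b hb x _
        have hba : b ≠ a := (hb 0).symm
        have hba' : b ≠ a' := (hb 1).symm
        refine ⟨?_, hgb b hba x⟩
        rw [lt_abs]
        rcases hout b hba hba' with h1 | h1
        · right; linarith
        · left; linarith
      · intro b x hx
        obtain ⟨r, hr, hflat⟩ := hg.flat
        refine hflat b x (hr.le.trans ?_)
        by_contra hlt
        have := abs_lt.1 (not_le.1 hlt)
        exact hx ⟨by linarith [this.1], by linarith [this.2]⟩
    have := step_of_bubble (B := B) B.admissible_const hg hinj hne hR (fun _ _ => hlt)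
      (x₁ := x₁) (x₂ := x₂) (by linarith [hx₁.2, hx₂.1])
      ⟨by linarith [hx₁.1], by linarith [hx₁.2]⟩ ⟨by linarith [hx₂.1], by linarith [hx₂.2]⟩
      (fun x _ => by
        rw [← hx, hga, hgb a' hne.symm, eq_div_iff (by linarith)]
        constructor <;> intro hh <;> linarith)
    rwa [deform_const] at this
  have hR : IsRect (0 : ℝ) (1 / 2) 0 1 := by
    constructor <;> norm_num
  have hplateau : ∀ x ∈ Icc (0 - 1 / 2 : ℝ) (0 + 1 / 2), g a x = h := by
    intro x hx
    rw [hga, bump_one z1 z3 (by linarith [hx.1]) (by linarith [hx.2])]; ring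
  -- the heights over the plateau, listed in the new order of the strands
  let y' : Fin K → ℝ := fun b => if b = a then B.y a' else if b = a' then h else B.y b
  have hy'a : y' a = B.y a' := if_pos rfl
  have hy'a' : y' a' = h := by simp [y', hne.symm]
  have hy'b : ∀ b, b ≠ a → b ≠ a' → y' b = B.y b := fun b h1 h2 => by simp [y', h1, h2]
  have hmono : StrictMono y' := by
    intro b b' hbb'
    have hv : (b : ℕ) < b' := hbb'
    by_cases h1 : b = a
    · subst h1
      by_cases h2 : b' = a'
      · subst h2; rw [hy'a, hy'a']; exact hah
      · have h3 : b' ≠ b := hbb'.ne'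
        rw [hy'a, hy'b b' h3 h2]
        refine B.y_mono ?_
        have : (b' : ℕ) ≠ a' := fun h => h2 (Fin.ext h)
        change (a' : ℕ) < b'
        omega
    · by_cases h1' : b = a'
      · subst h1'
        have h2 : b' ≠ a := by rintro rfl; omega
        have h3 : b' ≠ b := hbb'.ne'
        rw [hy'a', hy'b b' h2 h3]
        rcases hout b' h2 h3 with h4 | h4
        · have := B.y_mono hbb'
          linarith
        · linarith
      · rw [hy'b b h1 h1']
        by_cases h2 : b' = a
        · subst h2; rw [hy'a]; exact (B.y_mono hbb').trans hlt
        · by_cases h2' : b' = a'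
          · subst h2'; rw [hy'a']; exact (B.y_mono hbb').trans hah
          · rw [hy'b b' h2 h2']; exact B.y_mono hbb'
  have hy1 : ∀ b, |y' b| < 1 := by
    intro b
    by_cases h1 : b = a
    · subst h1; rw [hy'a]; exact B.y_mem a'
    · by_cases h2 : b = a'
      · subst h2; rw [hy'a']; exact abs_lt.2 ⟨by linarith, by linarith⟩
      · rw [hy'b b h1 h2]; exact B.y_mem b
  have hin : ∀ b, ∀ x ∈ Icc (0 - 1 / 2 : ℝ) (0 + 1 / 2),
      g (Equiv.swap a a' b) x = 0 + 1 * y' b := by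
    intro b x hx
    rw [zero_add, one_mul]
    by_cases h1 : b = a
    · subst h1; rw [Equiv.swap_apply_left, hy'a, hgb a' hne.symm]
    · by_cases h2 : b = a'
      · subst h2; rw [Equiv.swap_apply_right, hy'a', hplateau x hx]
      · rw [Equiv.swap_apply_of_ne_of_ne h1 h2, hy'b b h1 h2, hgb b h1]
  have hno : ∀ b, (∀ c, Equiv.swap a a' c ≠ b) → ∀ x ∈ Icc (0 - 1 / 2 : ℝ) (0 + 1 / 2),
      1 < |g b x - 0| := fun b hb => absurd (Equiv.apply_symm_apply _ b) (hb _)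
  exact ⟨_, subBox hg hinj _ hR y' hmono hy1 hin hno, hstep,
    subBox_refines hg hinj _ hR y' hmono hy1 hin hno⟩

/-- The strands of a box can be brought into any order. -/
lemma exists_permute (B : Box D K) (π : Equiv.Perm (Fin K)) :
    ∃ (D' : TangleDiagram F n Λ) (B' : Box D' K), Relation.EqvGen Step D D' ∧
      B'.Refines B π := by
  cases K with
  | zero =>
    have : π = 1 := Subsingleton.elim _ _
    subst this
    exact ⟨D, B, .refl _, Refines.refl B⟩
  | succ K =>
    have hπ : π ∈ Submonoid.closure
        (Set.range fun i : Fin K => Equiv.swap i.castSucc i.succ) := by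
      rw [Equiv.Perm.mclosure_swap_castSucc_succ]; trivial
    induction hπ using Submonoid.closure_induction_right with
    | one => exact ⟨D, B, .refl _, Refines.refl B⟩
    | mul_right π _ s hs ih =>
      obtain ⟨i, rfl⟩ := hs
      obtain ⟨D', B', h1, h2⟩ := ih
      obtain ⟨D'', B'', h3, h4⟩ := B'.exists_swap (a := i.castSucc) (a' := i.succ) (by simp)
      exact ⟨D'', B'', h1.trans _ _ _ (.rel _ _ h3), h4.trans h2⟩

/-- The lowest `k` strands of a box form a box. -/
lemma exists_lowest (B : Box D K) {k : ℕ} (hk : k ≤ K) :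
    ∃ B' : Box D k, B'.Refines B (Fin.castLE hk) := by
  have hinj : Function.Injective (fun c : Fin K => (c : ℕ)) := Fin.val_injective
  -- a height between the strands `k - 1` and `k`
  obtain ⟨d, hd0, hd1, hlow, hhigh⟩ : ∃ d, -1 < d ∧ d ≤ 1 ∧ (∀ b : Fin K, (b : ℕ) < k → B.y b < d) ∧
      ∀ b : Fin K, k ≤ (b : ℕ) → d < B.y b := by
    by_cases hkK : k < K
    · have h1 : ∀ᶠ d in 𝓝[<] (B.y ⟨k, hkK⟩), -1 < d ∧ ∀ b : Fin K, (b : ℕ) < k → B.y b < d := by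
        refine Filter.Eventually.and ?_ (eventually_all.2 fun b => ?_)
        · exact nhdsWithin_le_nhds (Ioi_mem_nhds (abs_lt.1 (B.y_mem _)).1)
        · by_cases hb : (b : ℕ) < k
          · have : B.y b < B.y ⟨k, hkK⟩ := B.y_mono hb
            filter_upwards [nhdsWithin_le_nhds (Ioi_mem_nhds this)] with d hd _ using hd
          · exact .of_forall fun d h => absurd h hb
      obtain ⟨d, ⟨hd1, hd⟩, hd0⟩ := (h1.and self_mem_nhdsWithin).exists
      have hd0' : d < B.y ⟨k, hkK⟩ := hd0
      refine ⟨d, hd1, (hd0'.trans (abs_lt.1 (B.y_mem _)).2).le, hd, fun b hb => ?_⟩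
      exact hd0'.trans_le (B.y_mono.monotone hb)
    · refine ⟨1, by norm_num, le_rfl, fun b _ => (abs_lt.1 (B.y_mem b)).2, fun b hb => ?_⟩
      exact absurd (b.2.trans_le (not_lt.1 hkK)) hb.not_gt
  have hR : IsRect (0 : ℝ) 1 ((d - 1) / 2) ((d + 1) / 2) := by
    constructor <;> linarith
  let y' : Fin k → ℝ := fun c => (B.y (Fin.castLE hk c) - (d - 1) / 2) / ((d + 1) / 2)
  have hv : 0 < (d + 1) / 2 := by linarith
  have hmono : StrictMono y' := by
    intro b c hbc
    have : B.y (Fin.castLE hk b) < B.y (Fin.castLE hk c) := B.y_mono hbc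
    simp only [y']
    gcongr
  have hy1 : ∀ c, |y' c| < 1 := by
    intro c
    have h1 := hlow (Fin.castLE hk c) c.2
    have h2 := abs_lt.1 (B.y_mem (Fin.castLE hk c))
    simp only [y']
    rw [abs_div, abs_of_pos hv, div_lt_one hv, abs_lt]
    constructor <;> linarith [h2.1]
  have hin : ∀ c, ∀ x ∈ Icc (0 - 1 : ℝ) (0 + 1),
      B.y (Fin.castLE hk c) = (d - 1) / 2 + (d + 1) / 2 * y' c := by
    intro c x _
    simp only [y']
    rw [mul_div_cancel₀ _ hv.ne']; ring
  have hout : ∀ a, (∀ c, Fin.castLE hk c ≠ a) → ∀ x ∈ Icc (0 - 1 : ℝ) (0 + 1),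
      (d + 1) / 2 < |B.y a - (d - 1) / 2| := by
    intro a ha x _
    have : k ≤ (a : ℕ) := by
      by_contra hlt
      exact ha ⟨a, not_le.1 hlt⟩ rfl
    have := hhigh a this
    rw [lt_abs]; left; linarith
  have h1 := subBox_refines (B := B) B.admissible_const hinj _ hR y' hmono hy1 hin hout
  revert h1
  generalize subBox (B := B) B.admissible_const hinj _ hR y' hmono hy1 hin hout = B'
  revert B'
  rw [deform_const]
  exact fun B' h => ⟨B', h⟩

end Box

end Diagrams

/-! ### The triangle of a third Reidemeister move -/

section Bump

variable {p p' q q' x : ℝ}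

lemma bump_deriv_eq_zero (h : p < p') (h' : p' < q) (h'' : q < q')
    (hx : bump p p' q q' x = 0 ∨ bump p p' q q' x = 1) : deriv (bump p p' q q') x = 0 := by
  rcases hx with hx | hx
  · refine IsLocalMin.deriv_eq_zero (.of_forall fun y => ?_)
    rw [hx]; exact (bump_mem_Icc h h' h'').1
  · refine IsLocalMax.deriv_eq_zero (.of_forall fun y => ?_)
    rw [hx]; exact (bump_mem_Icc h h' h'').2

lemma bump_abs_eq_zero {r : ℝ} (h : p < p') (h' : p' < q) (h'' : q < q') (hp : -r ≤ p) (hq : q' ≤ r)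
    (hx : r ≤ |x|) : bump p p' q q' x = 0 := by
  rcases le_abs.1 hx with h1 | h1
  · exact bump_zero_right h h' h'' (hq.trans h1)
  · exact bump_zero_left h h' h'' (by linarith)

end Bump

section Diagrams

variable {F : Type*} [TopologicalSpace F] [ChartedSpace (EuclideanHalfSpace 2) F]
  {n : ℕ} {Λ : Finset (Fin n)}

namespace Box

variable {D : TangleDiagram F n Λ}

/-- The family of the graphs of three functions: `f`, a function with values between `B.y 1` and `A`
described by its relative height `b`, and the constant `B.y 2`. -/
noncomputable def triple (B : Box D 3) (A : ℝ) (f b : ℝ → ℝ) : Fin 3 → ℝ → ℝ :=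
  ![f, fun x => B.y 1 + (A - B.y 1) * b x, fun _ => B.y 2]

variable {B : Box D 3} {A h t : ℝ} {f b : ℝ → ℝ}

@[simp] lemma triple_zero : B.triple A f b 0 = f := rfl

@[simp] lemma triple_one : B.triple A f b 1 = fun x => B.y 1 + (A - B.y 1) * b x := rfl

@[simp] lemma triple_two : B.triple A f b 2 = fun _ => B.y 2 := rfl

/-- Admissibility of a triple in which at each moment one of the two lower strands is at rest. -/
lemma admissible_triple (hf : ContDiff ℝ ∞ f) (hb : ContDiff ℝ ∞ b) (h1 : B.y 1 < h)
    (h2 : h < B.y 2) (hA : B.y 2 < A) (hAt : A < t) (ht : t < 1)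
    (hfl : ∃ r < 1, ∀ x, r ≤ |x| → f x = B.y 0 ∧ b x = 0)
    (hfI : ∀ x, f x ∈ Icc (B.y 0) t) (hbI : ∀ x, b x ∈ Icc (0 : ℝ) 1)
    (hfd : ∀ x, f x ≠ B.y 0 → f x ≠ h → f x ≠ t → deriv f x ≠ 0)
    (hbd : ∀ x, b x ≠ 0 → b x ≠ 1 → deriv b x ≠ 0)
    (hrest : ∀ x, (b x = 0 ∨ b x = 1) ∨ f x = B.y 0 ∨ f x = t) :
    B.Admissible (B.triple A f b) := by
  have h01 : B.y 0 < B.y 1 := B.y_mono (by decide)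
  have hy0 := abs_lt.1 (B.y_mem 0)
  have hA0 : 0 < A - B.y 1 := by linarith
  have hgI : ∀ x, B.y 1 + (A - B.y 1) * b x ∈ Icc (B.y 1) A := fun x =>
    ⟨by nlinarith [(hbI x).1], by nlinarith [(hbI x).2]⟩
  have hd1 : ∀ x, deriv (B.triple A f b 1) x = (A - B.y 1) * deriv b x := fun x => by
    rw [triple_one, deriv_const_add, deriv_const_mul]
    exact hb.differentiable (by simp) x
  refine Admissible.of_moving ?_ ?_ ?_ fun x => ?_
  · intro a
    fin_cases a
    · exact hf
    · exact contDiff_const.add (contDiff_const.mul hb)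
    · exact contDiff_const
  · obtain ⟨r, hr, hfl⟩ := hfl
    refine ⟨r, hr, fun a x hx => ?_⟩
    fin_cases a
    · exact (hfl x hx).1
    · simp [(hfl x hx).2]
    · rfl
  · intro a x
    fin_cases a
    · exact abs_lt.2 ⟨hy0.1.trans_le (hfI x).1, (hfI x).2.trans_lt ht⟩
    · have h3 : -1 < B.y 1 + (A - B.y 1) * b x := by linarith [(hgI x).1, hy0.1]
      have h4 : B.y 1 + (A - B.y 1) * b x < 1 := by linarith [(hgI x).2]
      exact abs_lt.2 ⟨h3, h4⟩
    · exact B.y_mem 2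
  · rcases hrest x with hx | hx
    · have hval : B.triple A f b 1 x = B.y 1 ∨ B.triple A f b 1 x = A := by
        rcases hx with hx | hx
        · left; simp [hx]
        · right; simp [hx]
      have hd : deriv (B.triple A f b 1) x = 0 := by
        rw [hd1]
        have : deriv b x = 0 := by
          rcases hx with hx | hx
          · exact IsLocalMin.deriv_eq_zero (.of_forall fun y => hx ▸ (hbI y).1)
          · exact IsLocalMax.deriv_eq_zero (.of_forall fun y => hx ▸ (hbI y).2)
        rw [this, mul_zero]
      have hne : B.triple A f b 1 x ≠ B.y 2 := by
        rcases hval with h | h <;> rw [h] <;> intro h' <;> linarith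
      refine ⟨0, ?_, ?_⟩
      · intro a c ha hc hac
        fin_cases a <;> fin_cases c
        · exact absurd rfl ha
        · exact absurd rfl ha
        · exact absurd rfl ha
        · exact absurd rfl hc
        · exact absurd rfl hac
        · exact hne
        · exact absurd rfl hc
        · exact fun h => hne h.symm
        · exact absurd rfl hac
      · intro a ha hax
        fin_cases a
        · exact absurd rfl ha
        · refine ⟨hd, hfd x ?_ ?_ ?_⟩ <;> change B.triple A f b 0 x ≠ _ <;> rw [← hax] <;>
            change B.triple A f b 1 x ≠ _ <;> rcases hval with h | h <;> rw [h] <;> intro h' <;>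
            linarith
        · refine ⟨deriv_const _ _, hfd x ?_ ?_ ?_⟩ <;> change B.triple A f b 0 x ≠ _ <;>
            rw [← hax] <;> change B.y 2 ≠ _ <;> intro h' <;> linarith
    · have hg := hgI x
      have hfg : f x ≠ B.y 1 + (A - B.y 1) * b x := by
        rcases hx with hx | hx <;> rw [hx] <;> intro h' <;> linarith [hg.1, hg.2]
      have hf2 : f x ≠ B.y 2 := by
        rcases hx with hx | hx <;> rw [hx] <;> intro h' <;> linarith
      refine ⟨1, ?_, ?_⟩
      · intro a c ha hc hac
        fin_cases a <;> fin_cases c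
        · exact absurd rfl hac
        · exact absurd rfl hc
        · exact hf2
        · exact absurd rfl ha
        · exact absurd rfl ha
        · exact absurd rfl ha
        · exact fun h => hf2 h.symm
        · exact absurd rfl hc
        · exact absurd rfl hac
      · intro a ha hax
        fin_cases a
        · exact absurd hax hfg
        · exact absurd rfl ha
        · refine ⟨deriv_const _ _, ?_⟩
          change B.y 2 = B.y 1 + (A - B.y 1) * b x at hax
          rw [hd1]
          refine mul_ne_zero hA0.ne' (hbd x ?_ ?_) <;> intro h' <;> rw [h'] at hax <;> linarith

/-- The crossing `c` is one of the strand `a` over the strand `b`. -/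
structure IsCrossing {D' : TangleDiagram F n Λ} (B : Box D 3) (a b : Fin 3) (c : Crossing D') :
    Prop where
  overComp_eq : c.overComp = B.comp a
  underComp_eq : c.underComp = B.comp b
  overTime : ∃ x ∈ Icc (-1 : ℝ) 1, c.overTime = B.θ a x
  underTime : ∃ x ∈ Icc (-1 : ℝ) 1, c.underTime = B.θ b x

variable [T2Space F] [IsManifold (𝓡∂ 2) ∞ F]

/-- The crossing of two strands of a deformed box. -/
def crossing {g : Fin 3 → ℝ → ℝ} (hg : B.Admissible g)
    (hθ : ∀ a, ∀ x ∈ Icc (-1 : ℝ) 1, B.θ a x ∈ fundDomain Λ (B.comp a)) {a b : Fin 3}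
    (hab : b < a) {x : ℝ} (hx : x ∈ Icc (-1 : ℝ) 1) (h : g a x = g b x) :
    Crossing (B.deform hg Fin.val_injective) where
  overComp := B.comp a
  overTime := B.θ a x
  underComp := B.comp b
  underTime := B.θ b x
  over_dom := hθ a x hx
  under_dom := hθ b x hx
  meet := by rw [deform_gamma_strand hg _ a hx, deform_gamma_strand hg _ b hx, h]
  upper_mem := (mem_deform_upper_crossing hg _ hab.ne' hx h).2 hab
  upper_notMem := fun h' =>
    hab.not_gt ((mem_deform_upper_crossing hg Fin.val_injective hab.ne hx h.symm).1 h')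

lemma isCrossing_crossing {g : Fin 3 → ℝ → ℝ} (hg : B.Admissible g)
    (hθ : ∀ a, ∀ x ∈ Icc (-1 : ℝ) 1, B.θ a x ∈ fundDomain Λ (B.comp a)) {a b : Fin 3}
    (hab : b < a) {x : ℝ} (hx : x ∈ Icc (-1 : ℝ) 1) (h : g a x = g b x) :
    B.IsCrossing a b (crossing hg hθ hab hx h) :=
  ⟨rfl, rfl, ⟨x, hx, rfl⟩, ⟨x, hx, rfl⟩⟩

lemma isSourceCrossing_crossing {g g' : Fin 3 → ℝ → ℝ} (hg : B.Admissible g)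
    (hg' : B.Admissible g') {x₀ u h₀ v : ℝ} (hd : DifferInRect g g' id x₀ u h₀ v)
    (hθ : ∀ a, ∀ x ∈ Icc (-1 : ℝ) 1, B.θ a x ∈ fundDomain Λ (B.comp a)) {a b : Fin 3}
    (hab : b < a) {x : ℝ} (hx : x ∈ Icc (-1 : ℝ) 1) (hxR : x ∈ Icc (x₀ - u) (x₀ + u))
    (h : g a x = g b x) :
    (rectMove hg hg' Fin.val_injective hd).IsSourceCrossing a b (crossing hg hθ hab hx h) := by
  obtain ⟨z, hz, rfl⟩ := hd.rect.exists_x hxR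
  have key : ∀ c, g c (x₀ + u * z) = g a (x₀ + u * z) →
      (crossing hg hθ hab hx h).point =
      (rectMove hg hg' Fin.val_injective hd).e
        ((rectMove hg hg' Fin.val_injective hd).src.strand c z) := by
    intro c hc
    rw [← (rectMove hg hg' Fin.val_injective hd).src_eq c z hz]
    change (B.deform hg _).γ (B.comp a) (B.θ a _) = (B.deform hg _).γ (B.comp c) (B.θ c _)
    rw [deform_gamma_strand hg _ a hx, deform_gamma_strand hg _ c hx, hc]
  exact ⟨z, hz, z, hz, key a rfl, key b h.symm⟩

end Box

end Diagrams

section Diagrams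

variable {F : Type*} [TopologicalSpace F] [ChartedSpace (EuclideanHalfSpace 2) F]
  {n : ℕ} {Λ : Finset (Fin n)} {D : TangleDiagram F n Λ} {T : TangleDiagram F n Λ}

namespace Box

/-- The path of the lowest strand: it rises to the height `h` on `[-0.6, -0.5]`, then, as far as
`s` prescribes, towards the height `t` on `[-0.4, -0.3]`, and comes back symmetrically. -/
noncomputable def stairs (y h t : ℝ) (s : ℝ) (x : ℝ) : ℝ :=
  y + (h - y) * bump (-0.6) (-0.5) 0.7 0.8 x + s * ((t - h) * bump (-0.4) (-0.3) 0.5 0.6 x)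

lemma stairs_smooth (y h t s : ℝ) : ContDiff ℝ ∞ (stairs y h t s) :=
  (contDiff_const.add (contDiff_const.mul (bump_smooth _ _ _ _))).add
    (contDiff_const.mul (contDiff_const.mul (bump_smooth _ _ _ _)))

section Stairs

variable {y h t : ℝ}

lemma outer_one {x : ℝ} (hx : -0.5 ≤ x) (hx' : x ≤ 0.7) : bump (-0.6) (-0.5) 0.7 0.8 x = 1 :=
  bump_one (by norm_num) (by norm_num) hx hx'

lemma outer_zero {x : ℝ} (hx : x ≤ -0.6 ∨ 0.8 ≤ x) : bump (-0.6) (-0.5) 0.7 0.8 x = 0 := by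
  rcases hx with hx | hx
  · exact bump_zero_left (by norm_num) (by norm_num) (by norm_num) hx
  · exact bump_zero_right (by norm_num) (by norm_num) (by norm_num) hx

lemma outer_mem (x : ℝ) : bump (-0.6) (-0.5) 0.7 0.8 x ∈ Icc (0 : ℝ) 1 :=
  bump_mem_Icc (by norm_num) (by norm_num) (by norm_num)

lemma inner_one {x : ℝ} (hx : -0.3 ≤ x) (hx' : x ≤ 0.5) : bump (-0.4) (-0.3) 0.5 0.6 x = 1 :=
  bump_one (by norm_num) (by norm_num) hx hx'

lemma inner_zero {x : ℝ} (hx : x ≤ -0.4 ∨ 0.6 ≤ x) : bump (-0.4) (-0.3) 0.5 0.6 x = 0 := by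
  rcases hx with hx | hx
  · exact bump_zero_left (by norm_num) (by norm_num) (by norm_num) hx
  · exact bump_zero_right (by norm_num) (by norm_num) (by norm_num) hx

lemma inner_mem (x : ℝ) : bump (-0.4) (-0.3) 0.5 0.6 x ∈ Icc (0 : ℝ) 1 :=
  bump_mem_Icc (by norm_num) (by norm_num) (by norm_num)

lemma inner_cases (x : ℝ) : bump (-0.4) (-0.3) 0.5 0.6 x = 0 ∨ (-0.5 ≤ x ∧ x ≤ 0.7) := by
  by_cases h1 : x ≤ -0.4
  · exact .inl (inner_zero (.inl h1))
  · by_cases h2 : 0.6 ≤ x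
    · exact .inl (inner_zero (.inr h2))
    · right
      push Not at h1 h2
      constructor <;> linarith

lemma stairs_of_inner_zero {s x : ℝ} (hx : bump (-0.4) (-0.3) 0.5 0.6 x = 0) :
    stairs y h t s x = y + (h - y) * bump (-0.6) (-0.5) 0.7 0.8 x := by
  rw [stairs, hx]; ring

lemma stairs_of_outer_one {s x : ℝ} (hx : -0.5 ≤ x) (hx' : x ≤ 0.7) :
    stairs y h t s x = h + s * ((t - h) * bump (-0.4) (-0.3) 0.5 0.6 x) := by
  rw [stairs, outer_one hx hx']; ring

lemma stairs_flat {s x : ℝ} (hx : 0.95 ≤ |x|) : stairs y h t s x = y := by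
  have h1 : bump (-0.6) (-0.5) 0.7 0.8 x = 0 :=
    bump_abs_eq_zero (by norm_num) (by norm_num) (by norm_num) (by norm_num) (by norm_num) hx
  have h2 : bump (-0.4) (-0.3) 0.5 0.6 x = 0 :=
    bump_abs_eq_zero (by norm_num) (by norm_num) (by norm_num) (by norm_num) (by norm_num) hx
  rw [stairs_of_inner_zero h2, h1]; ring

lemma stairs_mem {s : ℝ} (hs : s ∈ Icc (0 : ℝ) 1) (hyh : y < h) (hht : h < t) (x : ℝ) :
    stairs y h t s x ∈ Icc y t := by
  have h1 := outer_mem x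
  have h2 := inner_mem x
  rcases inner_cases x with h3 | h3
  · rw [stairs_of_inner_zero h3]
    constructor <;> nlinarith [h1.1, h1.2]
  · rw [stairs_of_outer_one h3.1 h3.2]
    have h4 : 0 ≤ s * ((t - h) * bump (-0.4) (-0.3) 0.5 0.6 x) :=
      mul_nonneg hs.1 (mul_nonneg (by linarith) h2.1)
    have h5 : s * ((t - h) * bump (-0.4) (-0.3) 0.5 0.6 x) ≤ 1 * ((t - h) * 1) :=
      mul_le_mul hs.2 (by nlinarith [h2.2]) (mul_nonneg (by linarith) h2.1) zero_le_one
    constructor <;> linarith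

lemma stairs_le_of_inner_zero {s x : ℝ} (hyh : y < h) (hx : bump (-0.4) (-0.3) 0.5 0.6 x = 0) :
    stairs y h t s x ≤ h := by
  rw [stairs_of_inner_zero hx]
  nlinarith [(outer_mem x).2]

lemma le_stairs_of_outer_one {s x : ℝ} (hs : 0 ≤ s) (hht : h < t) (hx : -0.5 ≤ x) (hx' : x ≤ 0.7) :
    h ≤ stairs y h t s x := by
  rw [stairs_of_outer_one hx hx']
  have := mul_nonneg hs (mul_nonneg (by linarith : 0 ≤ t - h) (inner_mem x).1)
  linarith

lemma stairs_deriv {s : ℝ} (hs : s = 0 ∨ s = 1) (hyh : y < h) (hht : h < t) (x : ℝ)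
    (h0 : stairs y h t s x ≠ y) (h1 : stairs y h t s x ≠ h) (h2 : stairs y h t s x ≠ t) :
    deriv (stairs y h t s) x ≠ 0 := by
  have hd1 := (bump_smooth (-0.6) (-0.5) 0.7 0.8).differentiable (by simp) x
  have hd2 := (bump_smooth (-0.4) (-0.3) 0.5 0.6).differentiable (by simp) x
  have hd : deriv (stairs y h t s) x = (h - y) * deriv (bump (-0.6) (-0.5) 0.7 0.8) x +
      s * ((t - h) * deriv (bump (-0.4) (-0.3) 0.5 0.6) x) :=
    (((hd1.hasDerivAt.const_mul (h - y)).const_add y).add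
      ((hd2.hasDerivAt.const_mul (t - h)).const_mul s)).deriv
  rw [hd]
  rcases inner_cases x with h3 | h3
  · rw [bump_deriv_eq_zero (by norm_num) (by norm_num) (by norm_num) (.inl h3), mul_zero, mul_zero,
      add_zero]
    rw [stairs_of_inner_zero h3] at h0 h1
    have hm := outer_mem x
    refine mul_ne_zero (by linarith) (bump_deriv_ne_zero (by norm_num) (by norm_num) (by norm_num)
      ⟨lt_of_le_of_ne hm.1 fun h => h0 ?_, lt_of_le_of_ne hm.2 fun h => h1 ?_⟩)
    · rw [← h]; ring
    · rw [h]; ring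
  · have h4 := outer_one h3.1 h3.2
    rw [bump_deriv_eq_zero (by norm_num) (by norm_num) (by norm_num) (.inr h4), mul_zero, zero_add]
    rw [stairs_of_outer_one h3.1 h3.2] at h1 h2
    rcases hs with rfl | rfl
    · exact absurd (by ring) h1
    have hm := inner_mem x
    rw [one_mul]
    refine mul_ne_zero (by linarith) (bump_deriv_ne_zero (by norm_num) (by norm_num) (by norm_num)
      ⟨lt_of_le_of_ne hm.1 fun h => h1 ?_, lt_of_le_of_ne hm.2 fun h => h2 ?_⟩)
    · rw [← h]; ring
    · rw [h]; ring

/-- On the way up a level below `h` is passed once. -/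
lemma stairs_level_low {l : ℝ} (hyl : y < l) (hlh : l < h) (hht : h < t) :
    ∃ z ∈ Ioo (-0.6 : ℝ) (-0.5), ∀ x ≤ 0.5, stairs y h t 1 x = l ↔ x = z := by
  have hl : (l - y) / (h - y) ∈ Ioo (0 : ℝ) 1 :=
    ⟨div_pos (by linarith) (by linarith), by rw [div_lt_one (by linarith)]; linarith⟩
  obtain ⟨z, hz, hzl⟩ := ramp_level (p := -0.6) (q := -0.5) (by norm_num) hl
  refine ⟨z, hz, fun x hx => ?_⟩
  rcases le_total x (-0.5) with h1 | h1
  · rw [stairs_of_inner_zero (inner_zero (.inl (by linarith))), ← hzl,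
      bump_eq_left (by norm_num) (by linarith), eq_div_iff (by linarith)]
    constructor <;> intro hh <;> linarith
  · have := le_stairs_of_outer_one (y := y) (h := h) (t := t) zero_le_one hht h1 (by linarith)
    constructor
    · intro hh; linarith
    · intro hh; linarith [hz.2]

/-- On the way up a level above `h` is passed once; the levels are passed in their order. -/
lemma stairs_level_high (hyh : y < h) (hht : h < t) : ∃ z : ℝ → ℝ,
    (∀ l ∈ Ioo h t, z l ∈ Ioo (-0.4 : ℝ) (-0.3) ∧ ∀ x ≤ 0.5, stairs y h t 1 x = l ↔ x = z l) ∧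
    ∀ l ∈ Ioo h t, ∀ l' ∈ Ioo h t, l < l' → z l < z l' := by
  have hr : (-0.4 : ℝ) < -0.3 := by norm_num
  have hl : ∀ l ∈ Ioo h t, (l - h) / (t - h) ∈ Ioo (0 : ℝ) 1 := fun l hl =>
    ⟨div_pos (by linarith [hl.1]) (by linarith),
      by rw [div_lt_one (by linarith)]; linarith [hl.2]⟩
  have hex : ∀ l, ∃ z, l ∈ Ioo h t → z ∈ Ioo (-0.4 : ℝ) (-0.3) ∧
      ∀ x, ramp (-0.4) (-0.3) x = (l - h) / (t - h) ↔ x = z := fun l => by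
    by_cases h1 : l ∈ Ioo h t
    · obtain ⟨z, hz, hzl⟩ := ramp_level (p := -0.4) (q := -0.3) hr (hl l h1)
      exact ⟨z, fun _ => ⟨hz, hzl⟩⟩
    · exact ⟨0, fun h2 => absurd h2 h1⟩
  choose z hz using hex
  refine ⟨z, fun l h1 => ⟨(hz l h1).1, fun x hx => ?_⟩, fun l h1 l' h2 hlt => ?_⟩
  · obtain ⟨hz1, hzl⟩ := hz l h1
    rcases le_total x (-0.4) with h3 | h3
    · have := stairs_le_of_inner_zero (y := y) (h := h) (t := t) (s := 1) hyh
        (inner_zero (.inl h3))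
      constructor
      · intro hh; linarith [h1.1]
      · intro hh; linarith [hz1.1]
    · rw [stairs_of_outer_one (by linarith) (by linarith), ← hzl,
        bump_eq_left (by norm_num) hx, eq_div_iff (by linarith)]
      constructor <;> intro hh <;> linarith
  · obtain ⟨hz1, hzl⟩ := hz l h1
    obtain ⟨hz2, hzl'⟩ := hz l' h2
    rw [← (ramp_strictMonoOn hr).lt_iff_lt (Ioo_subset_Icc_self hz1) (Ioo_subset_Icc_self hz2),
      (hzl _).2 rfl, (hzl' _).2 rfl]
    have : 0 < t - h := by linarith
    gcongr

end Stairs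

end Box

end Diagrams

lemma bump_cases {p p' q q' : ℝ} (h : p < p') (h' : p' < q) (h'' : q < q') (x : ℝ) :
    (bump p p' q q' x = 0 ∨ bump p p' q q' x = 1) ∨ x ∈ Ioo p p' ∨ x ∈ Ioo q q' := by
  by_cases h1 : x ≤ p
  · exact .inl (.inl (bump_zero_left h h' h'' h1))
  by_cases h2 : x < p'
  · exact .inr (.inl ⟨not_le.1 h1, h2⟩)
  by_cases h3 : x ≤ q
  · exact .inl (.inr (bump_one h h'' (not_lt.1 h2) h3))
  by_cases h4 : x < q'
  · exact .inr (.inr ⟨not_le.1 h3, h4⟩)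
  · exact .inl (.inl (bump_zero_right h h' h'' (not_lt.1 h4)))

section Diagrams

variable {F : Type*} [TopologicalSpace F] [ChartedSpace (EuclideanHalfSpace 2) F]
  {n : ℕ} {Λ : Finset (Fin n)} {D : TangleDiagram F n Λ} {T : TangleDiagram F n Λ}

namespace Box

lemma stairs_rest {y h t x : ℝ} (hx : x ∈ Icc (-0.3) 0.5) : stairs y h t 1 x = t := by
  rw [stairs_of_outer_one (by linarith [hx.1]) (by linarith [hx.2]), inner_one hx.1 hx.2]; ring

lemma stairs_start {y h t s x : ℝ} (hx : x ≤ -0.6) : stairs y h t s x = y := by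
  rw [stairs_of_inner_zero (inner_zero (.inl (by linarith))), outer_zero (.inl hx)]; ring

/-- Heights which leave room for the moves that create a triangle. -/
structure Levels (B : Box D 3) (h A t : ℝ) : Prop where
  lt_h : B.y 1 < h
  h_lt : h < B.y 2
  lt_A : B.y 2 < A
  A_lt : A < t
  t_lt : t < 1

variable {B : Box D 3} {A h t : ℝ}

lemma admissible_stairs {s : ℝ} (hs : s = 0 ∨ s = 1) (hL : B.Levels h A t) :
    B.Admissible (B.triple A (stairs (B.y 0) h t s) fun _ => 0) := by
  have h01 : B.y 0 < B.y 1 := B.y_mono (by decide)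
  obtain ⟨h1, h2, hA, hAt, ht⟩ := id hL
  refine admissible_triple (stairs_smooth _ _ _ _) contDiff_const hL.lt_h hL.h_lt hL.lt_A
    hL.A_lt hL.t_lt
    ⟨0.95, by norm_num, fun x hx => ⟨stairs_flat hx, rfl⟩⟩ (stairs_mem ?_ ?_ ?_) (fun x => by simp)
    (stairs_deriv hs ?_ ?_) (fun x hx => absurd rfl hx) (fun x => .inl (.inl rfl))
  · rcases hs with rfl | rfl <;> simp
  all_goals linarith

lemma admissible_stairs_bump {p p' q q' : ℝ} (hp : p < p') (hpq : p' < q) (hq : q < q')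
    (hp1 : -0.95 ≤ p) (hq1 : q' ≤ 0.95) (hL : B.Levels h A t)
    (hrest : ∀ x, x ∈ Ioo p p' ∨ x ∈ Ioo q q' → x ≤ -0.6 ∨ x ∈ Icc (-0.3) 0.5) :
    B.Admissible (B.triple A (stairs (B.y 0) h t 1) (bump p p' q q')) := by
  have h01 : B.y 0 < B.y 1 := B.y_mono (by decide)
  obtain ⟨h1, h2, hA, hAt, ht⟩ := id hL
  refine admissible_triple (stairs_smooth _ _ _ _) (bump_smooth _ _ _ _) hL.lt_h hL.h_lt hL.lt_A
    hL.A_lt hL.t_lt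
    ⟨0.95, by norm_num, fun x hx => ⟨stairs_flat hx, bump_abs_eq_zero hp hpq hq hp1 hq1 hx⟩⟩
    (stairs_mem (by simp) ?_ ?_) (fun x => bump_mem_Icc hp hpq hq)
    (stairs_deriv (.inr rfl) ?_ ?_) (fun x hx hx' => ?_) (fun x => ?_)
  · linarith
  · linarith
  · linarith
  · linarith
  · have := bump_mem_Icc hp hpq hq (x := x)
    exact bump_deriv_ne_zero hp hpq hq ⟨lt_of_le_of_ne this.1 hx.symm, lt_of_le_of_ne this.2 hx'⟩
  · rcases bump_cases hp hpq hq x with hx | hx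
    · exact .inl hx
    · right
      rcases hrest x hx with hx' | hx'
      · exact .inl (stairs_start hx')
      · exact .inr (stairs_rest hx')

/-- The lowest strand makes an excursion to the height `h`, between the strands `1` and `2`. -/
lemma admissible_low : B.Levels h A t →
    B.Admissible (B.triple A (stairs (B.y 0) h t 0) fun _ => 0) :=
  admissible_stairs (.inl rfl)

/-- The lowest strand makes an excursion to the height `t`, above the two other strands. -/
lemma admissible_high : B.Levels h A t →
    B.Admissible (B.triple A (stairs (B.y 0) h t 1) fun _ => 0) :=
  admissible_stairs (.inr rfl)

/-- The strand `1` crosses the strand `2` to the right of the points where the strand `0` crosses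
both of them on its way up. -/
lemma admissible_before (hL : B.Levels h A t) :
    B.Admissible (B.triple A (stairs (B.y 0) h t 1) (bump (-0.1) 0 0.2 0.3)) :=
  admissible_stairs_bump (by norm_num) (by norm_num) (by norm_num) (by norm_num) (by norm_num) hL
    (by
      rintro x (hx | hx) <;> right <;> constructor <;> linarith [hx.1, hx.2])

/-- The strand `1` crosses the strand `2` already before the strand `0` begins to rise. -/
lemma admissible_after (hL : B.Levels h A t) :
    B.Admissible (B.triple A (stairs (B.y 0) h t 1) (bump (-0.9) (-0.8) 0.2 0.3)) :=
  admissible_stairs_bump (by norm_num) (by norm_num) (by norm_num) (by norm_num) (by norm_num) hL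
    (by
      rintro x (hx | hx)
      · left; linarith [hx.2]
      · right; constructor <;> linarith [hx.1, hx.2])

/-- The two positions of the strand `1` agree on the right of `0.1`, and the rectangle over
`[-0.95, 0.1]` contains the crossings of both triangles. -/
lemma differInRect_before_after (B : Box D 3) (A h t : ℝ) (hL : B.Levels h A t) :
    DifferInRect (B.triple A (stairs (B.y 0) h t 1) (bump (-0.1) 0 0.2 0.3))
      (B.triple A (stairs (B.y 0) h t 1) (bump (-0.9) (-0.8) 0.2 0.3)) id (-0.425) 0.525 0 1 := by
  have a₃ := admissible_before hL
  have a₄ := admissible_after hL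
  set f₂ := stairs (B.y 0) h t 1 with hf₂
  set b₃ := bump (-0.1) 0 0.2 0.3 with hb₃
  set b₄ := bump (-0.9) (-0.8) 0.2 0.3 with hb₄
  refine ⟨⟨by norm_num, by norm_num, by norm_num, by norm_num, by norm_num, by norm_num⟩,
    fun c x _ => ?_, fun a ha x hx => absurd rfl (ha a), fun a x hx => ?_⟩
  · rw [sub_zero, sub_zero]
    exact ⟨a₃.mem _ x, a₄.mem _ x⟩
  · fin_cases a
    · rfl
    · change B.y 1 + (A - B.y 1) * b₄ x = B.y 1 + (A - B.y 1) * b₃ x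
      have : b₄ x = b₃ x := by
        by_cases hx1 : x ≤ -0.9
        · rw [hb₄, hb₃, bump_zero_left (by norm_num) (by norm_num) (by norm_num) hx1,
            bump_zero_left (by norm_num) (by norm_num) (by norm_num) (by linarith)]
        · have : 0.1 ≤ x := by
            by_contra hn
            push Not at hx1 hn
            exact hx ⟨by linarith, by linarith⟩
          rw [hb₄, hb₃, bump_eq_right (by norm_num) (by linarith),
            bump_eq_right (by norm_num) (by linarith)]
      rw [this]
    · rfl

variable [T2Space F] [IsManifold (𝓡∂ 2) ∞ F]

/-- The strand `0` passes under the strand `1`. -/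
lemma step_low (hL : B.Levels h A t) :
    Step D (B.deform (admissible_low hL) Fin.val_injective) := by
  have hinj : Function.Injective (fun c : Fin 3 => (c : ℕ)) := Fin.val_injective
  have h01 : B.y 0 < B.y 1 := B.y_mono (by decide)
  have h12 : B.y 1 < B.y 2 := B.y_mono (by decide)
  have hy0 := (abs_lt.1 (B.y_mem 0)).1
  obtain ⟨hh1, hh2, hA, hAt, ht⟩ := id hL
  have a₁ := admissible_low hL
  set f₁ := stairs (B.y 0) h t 0 with hf₁
  have hI₁ : ∀ x, f₁ x ∈ Icc (B.y 0) t := stairs_mem (by simp) (by linarith) (by linarith)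
  have hf₁' : ∀ x, f₁ x = B.y 0 + (h - B.y 0) * bump (-0.6) (-0.5) 0.7 0.8 x := fun x => by
    rw [hf₁, stairs]; ring
  have hf₁h : ∀ x, f₁ x ≤ h := fun x => by
    rw [hf₁']; nlinarith [(outer_mem x).2]
  have key : Step (B.deform B.admissible_const hinj) (B.deform a₁ hinj) := by
    have hR : DifferInRect (fun b _ => B.y b) (B.triple A f₁ fun _ => 0) ![0, 1] 0.1 0.8
        (((h + B.y 2) / 2 - 1) / 2) (((h + B.y 2) / 2 + 1) / 2) := by
      refine ⟨⟨by norm_num, by linarith, by norm_num, by norm_num, by linarith, by linarith⟩,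
        fun c x _ => ?_, fun a ha x _ => ?_, fun a x hx => ?_⟩
      · have := hI₁ x
        have := hf₁h x
        fin_cases c
        · simp only [Fin.zero_eta, Matrix.cons_val_zero, triple_zero, abs_lt]
          refine ⟨⟨?_, ?_⟩, ?_, ?_⟩ <;> linarith [(hI₁ x).1]
        · simp only [Fin.mk_one, Matrix.cons_val_one, Matrix.cons_val_fin_one, triple_one, mul_zero,
            add_zero, and_self, abs_lt]
          constructor <;> linarith
      · fin_cases a
        · exact absurd rfl (ha 0)
        · exact absurd rfl (ha 1)
        · refine ⟨?_, rfl⟩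
          change _ < |B.y 2 - _|
          rw [lt_abs]; left; linarith
      · fin_cases a
        · change f₁ x = B.y 0
          rw [hf₁', outer_zero, mul_zero, add_zero]
          by_contra hn
          push Not at hn
          exact hx ⟨by linarith [hn.1], by linarith [hn.2]⟩
        · simp
        · rfl
    have hl : (B.y 1 - B.y 0) / (h - B.y 0) ∈ Ioo (0 : ℝ) 1 :=
      ⟨div_pos (by linarith) (by linarith), by rw [div_lt_one (by linarith)]; linarith⟩
    obtain ⟨x₁, hx₁, x₂, hx₂, hx⟩ := bump_level (p := -0.6) (p' := -0.5) (q := 0.7) (q' := 0.8)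
      (by norm_num) (by norm_num) (by norm_num) hl
    refine step_of_bubble (B := B) B.admissible_const a₁ hinj (by decide) hR (fun _ _ => h01)
      (x₁ := x₁) (x₂ := x₂) (by linarith [hx₁.2, hx₂.1])
      ⟨by linarith [hx₁.1], by linarith [hx₁.2]⟩ ⟨by linarith [hx₂.1], by linarith [hx₂.2]⟩
      fun x _ => ?_
    rw [← hx, triple_zero, triple_one, hf₁', eq_div_iff (by linarith)]
    constructor <;> intro hh <;> linarith
  rwa [deform_const] at key

/-- The higher part of the strand `0` passes under the strand `2`. -/
lemma step_high (hL : B.Levels h A t) : Step (B.deform (admissible_low hL) Fin.val_injective)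
    (B.deform (admissible_high hL) Fin.val_injective) := by
  have hinj : Function.Injective (fun c : Fin 3 => (c : ℕ)) := Fin.val_injective
  have h01 : B.y 0 < B.y 1 := B.y_mono (by decide)
  have h12 : B.y 1 < B.y 2 := B.y_mono (by decide)
  have hy0 := (abs_lt.1 (B.y_mem 0)).1
  obtain ⟨hh1, hh2, hA, hAt, ht⟩ := id hL
  have a₁ := admissible_low hL
  have a₂ := admissible_high hL
  set f₁ := stairs (B.y 0) h t 0 with hf₁
  set f₂ := stairs (B.y 0) h t 1 with hf₂
  have hI₁ : ∀ x, f₁ x ∈ Icc (B.y 0) t := stairs_mem (by simp) (by linarith) (by linarith)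
  have hI₂ : ∀ x, f₂ x ∈ Icc (B.y 0) t := stairs_mem (by simp) (by linarith) (by linarith)
  have hf₁' : ∀ x, f₁ x = B.y 0 + (h - B.y 0) * bump (-0.6) (-0.5) 0.7 0.8 x := fun x => by
    rw [hf₁, stairs]; ring
  have hf₁h : ∀ x, f₁ x ≤ h := fun x => by
    rw [hf₁']; nlinarith [(outer_mem x).2]
  have hR : DifferInRect (B.triple A f₁ fun _ => 0) (B.triple A f₂ fun _ => 0) ![0, 2] 0.1 0.55
      ((1 + (B.y 1 + h) / 2) / 2) ((1 - (B.y 1 + h) / 2) / 2) := by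
    refine ⟨⟨by norm_num, by linarith, by norm_num, by norm_num, by linarith, by linarith⟩,
      fun c x hx => ?_, fun a ha x _ => ?_, fun a x hx => ?_⟩
    · have h1 : h ≤ f₁ x := le_stairs_of_outer_one le_rfl (by linarith) (by linarith [hx.1])
        (by linarith [hx.2])
      have h2 : h ≤ f₂ x := le_stairs_of_outer_one zero_le_one (by linarith)
        (by linarith [hx.1]) (by linarith [hx.2])
      fin_cases c
      · simp only [Fin.zero_eta, Matrix.cons_val_zero, triple_zero, abs_lt]
        refine ⟨⟨?_, ?_⟩, ?_, ?_⟩ <;> linarith [(hI₁ x).2, (hI₂ x).2]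
      · simp only [Fin.mk_one, Matrix.cons_val_one, Matrix.cons_val_fin_one, triple_two,
          and_self, abs_lt]
        constructor <;> linarith
    · fin_cases a
      · exact absurd rfl (ha 0)
      · refine ⟨?_, rfl⟩
        change _ < |B.y 1 + (A - B.y 1) * 0 - _|
        rw [lt_abs]; right; linarith
      · exact absurd rfl (ha 1)
    · fin_cases a
      · change stairs _ _ _ _ x = stairs _ _ _ _ x
        have : bump (-0.4) (-0.3) 0.5 0.6 x = 0 := by
          refine inner_zero ?_
          by_contra hn
          push Not at hn
          exact hx ⟨by linarith [hn.1], by linarith [hn.2]⟩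
        rw [stairs_of_inner_zero this, stairs_of_inner_zero this]
      · rfl
      · rfl
  have hl : (B.y 2 - h) / (t - h) ∈ Ioo (0 : ℝ) 1 :=
    ⟨div_pos (by linarith) (by linarith), by rw [div_lt_one (by linarith)]; linarith⟩
  obtain ⟨x₁, hx₁, x₂, hx₂, hx⟩ := bump_level (p := -0.4) (p' := -0.3) (q := 0.5) (q' := 0.6)
    (by norm_num) (by norm_num) (by norm_num) hl
  refine step_of_bubble (B := B) a₁ a₂ hinj (by decide) hR (fun x _ => (hf₁h x).trans_lt hh2)
    (x₁ := x₁) (x₂ := x₂) (by linarith [hx₁.2, hx₂.1])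
    ⟨by linarith [hx₁.1], by linarith [hx₁.2]⟩ ⟨by linarith [hx₂.1], by linarith [hx₂.2]⟩
    fun x hxR => ?_
  rw [← hx, triple_zero, triple_two, hf₂,
    stairs_of_outer_one (by linarith [hxR.1]) (by linarith [hxR.2]), eq_div_iff (by linarith)]
  constructor <;> intro hh <;> linarith

/-- The strand `1` passes under the strand `2`. -/
lemma step_before (hL : B.Levels h A t) : Step (B.deform (admissible_high hL) Fin.val_injective)
    (B.deform (admissible_before hL) Fin.val_injective) := by
  have hinj : Function.Injective (fun c : Fin 3 => (c : ℕ)) := Fin.val_injective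
  have h01 : B.y 0 < B.y 1 := B.y_mono (by decide)
  have h12 : B.y 1 < B.y 2 := B.y_mono (by decide)
  have hy0 := (abs_lt.1 (B.y_mem 0)).1
  obtain ⟨hh1, hh2, hA, hAt, ht⟩ := id hL
  have a₂ := admissible_high hL
  have a₃ := admissible_before hL
  set f₂ := stairs (B.y 0) h t 1 with hf₂
  set b₃ := bump (-0.1) 0 0.2 0.3 with hb₃
  have hI₃ : ∀ x, b₃ x ∈ Icc (0 : ℝ) 1 := fun x =>
    bump_mem_Icc (by norm_num) (by norm_num) (by norm_num)
  have hR : DifferInRect (B.triple A f₂ fun _ => 0) (B.triple A f₂ b₃) ![1, 2] 0.1 0.3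
      (((A + t) / 2 + B.y 0) / 2) (((A + t) / 2 - B.y 0) / 2) := by
    refine ⟨⟨by norm_num, by linarith, by norm_num, by norm_num, by linarith, by linarith⟩,
      fun c x hx => ?_, fun a ha x hx => ?_, fun a x hx => ?_⟩
    · have h1 := mul_nonneg (by linarith : 0 ≤ A - B.y 1) (hI₃ x).1
      have h2 := mul_le_mul_of_nonneg_left (hI₃ x).2 (by linarith : 0 ≤ A - B.y 1)
      fin_cases c
      · simp only [Fin.zero_eta, Matrix.cons_val_zero, triple_one, abs_lt]
        refine ⟨⟨?_, ?_⟩, ?_, ?_⟩ <;> linarith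
      · simp only [Fin.mk_one, Matrix.cons_val_one, Matrix.cons_val_fin_one, triple_two,
          and_self, abs_lt]
        constructor <;> linarith
    · fin_cases a
      · refine ⟨?_, rfl⟩
        change _ < |f₂ x - _|
        rw [hf₂, stairs_rest ⟨by linarith [hx.1], by linarith [hx.2]⟩, lt_abs]
        left; linarith
      · exact absurd rfl (ha 0)
      · exact absurd rfl (ha 1)
    · fin_cases a
      · rfl
      · change B.y 1 + (A - B.y 1) * b₃ x = B.y 1 + (A - B.y 1) * 0
        have : b₃ x = 0 := by
          by_cases hx1 : x ≤ -0.1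
          · exact bump_zero_left (by norm_num) (by norm_num) (by norm_num) hx1
          · refine bump_zero_right (by norm_num) (by norm_num) (by norm_num) ?_
            by_contra hn
            push Not at hx1 hn
            exact hx ⟨by linarith, by linarith⟩
        rw [this]
      · rfl
  have hl : (B.y 2 - B.y 1) / (A - B.y 1) ∈ Ioo (0 : ℝ) 1 :=
    ⟨div_pos (by linarith) (by linarith), by rw [div_lt_one (by linarith)]; linarith⟩
  obtain ⟨x₁, hx₁, x₂, hx₂, hx⟩ := bump_level (p := -0.1) (p' := 0) (q := 0.2) (q' := 0.3)
    (by norm_num) (by norm_num) (by norm_num) hl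
  refine step_of_bubble (B := B) a₂ a₃ hinj (by decide) hR (fun x _ => by simpa using h12)
    (x₁ := x₁) (x₂ := x₂) (by linarith [hx₁.2, hx₂.1])
    ⟨by linarith [hx₁.1], by linarith [hx₁.2]⟩ ⟨by linarith [hx₂.1], by linarith [hx₂.2]⟩
    fun x hxR => ?_
  change B.y 1 + (A - B.y 1) * b₃ x = B.y 2 ↔ _
  rw [← hx, ← hb₃, eq_div_iff (by linarith)]
  constructor <;> intro hh <;> linarith

/-- The left part of the picture is a triangle, and the other position of the strand `1` is the
result of the move `Ω₃b` for this triangle. -/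
lemma isOmega3b_before_after (hL : B.Levels h A t)
    (hmono : ∀ a, StrictMonoOn (B.θ a) (Icc (-1) 1)) :
    (rectMove (admissible_before hL) (admissible_after hL) Fin.val_injective
      (differInRect_before_after B A h t hL)).IsOmega3b ∧
    ∃ z₀₁ ∈ Icc (-0.95 : ℝ) 0.1, ∃ z₀₂ ∈ Icc (-0.95 : ℝ) 0.1, ∃ z₁₂ ∈ Icc (-0.95 : ℝ) 0.1,
      stairs (B.y 0) h t 1 z₀₁ = B.y 1 + (A - B.y 1) * bump (-0.1) 0 0.2 0.3 z₀₁ ∧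
      stairs (B.y 0) h t 1 z₀₂ = B.y 2 ∧
      B.y 1 + (A - B.y 1) * bump (-0.1) 0 0.2 0.3 z₁₂ = B.y 2 := by
  have hinj : Function.Injective (fun c : Fin 3 => (c : ℕ)) := Fin.val_injective
  have h01 : B.y 0 < B.y 1 := B.y_mono (by decide)
  have h12 : B.y 1 < B.y 2 := B.y_mono (by decide)
  have hy0 := (abs_lt.1 (B.y_mem 0)).1
  obtain ⟨hh1, hh2, hA, hAt, ht⟩ := id hL
  have a₃ := admissible_before hL
  have a₄ := admissible_after hL
  have hd := differInRect_before_after B A h t hL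
  set f₂ := stairs (B.y 0) h t 1 with hf₂
  set b₃ := bump (-0.1) 0 0.2 0.3 with hb₃
  set b₄ := bump (-0.9) (-0.8) 0.2 0.3 with hb₄
  have hI₃ : ∀ x, b₃ x ∈ Icc (0 : ℝ) 1 := fun x =>
    bump_mem_Icc (by norm_num) (by norm_num) (by norm_num)
  have hI₄ : ∀ x, b₄ x ∈ Icc (0 : ℝ) 1 := fun x =>
    bump_mem_Icc (by norm_num) (by norm_num) (by norm_num)
  have hx0 : ∀ x ∈ Icc (-1 : ℝ) 1, (-0.425 : ℝ) + 0.525 * x ∈ Icc (-0.95 : ℝ) 0.1 := fun x hx =>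
    ⟨by linarith [hx.1], by linarith [hx.2]⟩
  have hex : ∀ z ∈ Icc (-0.95 : ℝ) 0.1, ∃ w ∈ Icc (-1 : ℝ) 1, z = (-0.425 : ℝ) + 0.525 * w :=
    fun z hz => hd.rect.exists_x ⟨by linarith [hz.1], by linarith [hz.2]⟩
  obtain ⟨z₀₁, hz₀₁, hz₀₁'⟩ := stairs_level_low h01 hh1 (by linarith : h < t)
  obtain ⟨z, hz, hzlt⟩ := stairs_level_high (by linarith : B.y 0 < h) (by linarith : h < t)
  have hy2 : B.y 2 ∈ Ioo h t := ⟨hh2, by linarith⟩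
  have hAm : A ∈ Ioo h t := ⟨by linarith, hAt⟩
  have hl : (B.y 2 - B.y 1) / (A - B.y 1) ∈ Ioo (0 : ℝ) 1 :=
    ⟨div_pos (by linarith) (by linarith), by rw [div_lt_one (by linarith)]; linarith⟩
  obtain ⟨z₁₂, hz₁₂, hz₁₂'⟩ := ramp_level (p := -0.1) (q := 0) (by norm_num) hl
  obtain ⟨y₁₂, hy₁₂, hy₁₂'⟩ := ramp_level (p := -0.9) (q := -0.8) (by norm_num) hl
  -- before the move the crossings of `0, 1`, of `0, 2` and of `1, 2` follow each other from left to
  -- right; after the move those of `1, 2`, of `0, 2` and of `0, 1` do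
  have e₀₁ : ∀ x ≤ (0.1 : ℝ), f₂ x = B.y 1 + (A - B.y 1) * b₃ x ↔ x = z₀₁ := by
    intro x hx
    rcases le_total x (-0.1) with h1 | h1
    · have : b₃ x = 0 := bump_zero_left (by norm_num) (by norm_num) (by norm_num) h1
      rw [this, mul_zero, add_zero, hf₂, hz₀₁' x (by linarith)]
    · have h2 := mul_le_mul_of_nonneg_left (hI₃ x).2 (by linarith : 0 ≤ A - B.y 1)
      rw [hf₂, stairs_rest ⟨by linarith, by linarith⟩]
      constructor <;> intro hh
      · linarith
      · linarith [hz₀₁.2]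
  have e₀₂ : ∀ x ≤ (0.1 : ℝ), f₂ x = B.y 2 ↔ x = z (B.y 2) := fun x hx =>
    (hz _ hy2).2 x (by linarith)
  have e₁₂ : ∀ x ≤ (0.1 : ℝ), B.y 1 + (A - B.y 1) * b₃ x = B.y 2 ↔ x = z₁₂ := by
    intro x hx
    rw [hb₃, bump_eq_left (by norm_num) (by linarith), ← hz₁₂', eq_div_iff (by linarith)]
    constructor <;> intro hh <;> linarith
  have e₀₁' : ∀ x ≤ (0.1 : ℝ), f₂ x = B.y 1 + (A - B.y 1) * b₄ x ↔ x = z A := by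
    intro x hx
    rcases le_total x (-0.7) with h1 | h1
    · have h2 := mul_nonneg (by linarith : 0 ≤ A - B.y 1) (hI₄ x).1
      rw [hf₂, stairs_start (by linarith)]
      constructor <;> intro hh
      · linarith
      · linarith [(hz A hAm).1.1]
    · have : b₄ x = 1 := bump_one (by norm_num) (by norm_num) (by linarith) (by linarith)
      rw [this, mul_one, add_sub_cancel, hf₂, (hz A hAm).2 x (by linarith)]
  have e₁₂' : ∀ x ≤ (0.1 : ℝ), B.y 1 + (A - B.y 1) * b₄ x = B.y 2 ↔ x = y₁₂ := by
    intro x hx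
    rw [hb₄, bump_eq_left (by norm_num) (by linarith), ← hy₁₂', eq_div_iff (by linarith)]
    constructor <;> intro hh <;> linarith
  have hzy2 := (hz _ hy2).1
  have hzA := (hz _ hAm).1
  have m₀₁ : z₀₁ ∈ Icc (-0.95 : ℝ) 0.1 := ⟨by linarith [hz₀₁.1], by linarith [hz₀₁.2]⟩
  have m₀₂ : z (B.y 2) ∈ Icc (-0.95 : ℝ) 0.1 := ⟨by linarith [hzy2.1], by linarith [hzy2.2]⟩
  have m₁₂ : z₁₂ ∈ Icc (-0.95 : ℝ) 0.1 := ⟨by linarith [hz₁₂.1], by linarith [hz₁₂.2]⟩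
  refine ⟨?_, z₀₁, m₀₁, z (B.y 2), m₀₂, z₁₂, m₁₂, (e₀₁ _ m₀₁.2).2 rfl, (e₀₂ _ m₀₂.2).2 rfl,
    (e₁₂ _ m₁₂.2).2 rfl⟩
  refine ⟨⟨_, _, rectMove_src_isGraph a₃ a₄ hinj hd, rectMove_tgt_isGraph a₃ a₄ hinj hd,
    ?_, ?_, ?_, ?_⟩, rectMove_isLayered a₃ a₄ hinj Function.injective_id hd, ?_⟩
  · have h1 : b₃ (-0.425 + 0.525 * (-1)) = 0 :=
      bump_zero_left (by norm_num) (by norm_num) (by norm_num) (by norm_num)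
    have h2 : f₂ (-0.425 + 0.525 * (-1)) = B.y 0 := stairs_start (by norm_num)
    simp only [id, triple_zero, triple_one, h1, h2]
    linarith
  · have h1 : b₃ (-0.425 + 0.525 * (-1)) = 0 :=
      bump_zero_left (by norm_num) (by norm_num) (by norm_num) (by norm_num)
    simp only [id, triple_two, triple_one, h1]
    linarith
  · obtain ⟨w₁, hw₁, rfl⟩ := hex z₀₁ ⟨by linarith [hz₀₁.1], by linarith [hz₀₁.2]⟩
    obtain ⟨w₂, hw₂, hw₂'⟩ := hex (z (B.y 2)) ⟨by linarith [hzy2.1], by linarith [hzy2.2]⟩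
    obtain ⟨w₃, hw₃, rfl⟩ := hex z₁₂ ⟨by linarith [hz₁₂.1], by linarith [hz₁₂.2]⟩
    refine ⟨w₁, hw₁, w₂, hw₂, w₃, hw₃, by linarith [hz₀₁.2, hzy2.1], by linarith [hz₁₂.1, hzy2.2],
      fun x hx => ?_⟩
    have hle := (hx0 x hx).2
    simp only [id, triple_zero, triple_two, triple_one, sub_zero, div_one]
    rw [e₀₁ _ hle, e₀₂ _ hle, e₁₂ _ hle, hw₂']
    norm_num
  · obtain ⟨w₁, hw₁, hw₁'⟩ := hex (z A) ⟨by linarith [hzA.1], by linarith [hzA.2]⟩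
    obtain ⟨w₂, hw₂, hw₂'⟩ := hex (z (B.y 2)) ⟨by linarith [hzy2.1], by linarith [hzy2.2]⟩
    obtain ⟨w₃, hw₃, rfl⟩ := hex y₁₂ ⟨by linarith [hy₁₂.1], by linarith [hy₁₂.2]⟩
    have hlt := hzlt _ hy2 _ hAm hA
    refine ⟨w₁, hw₁, w₂, hw₂, w₃, hw₃, by linarith [hy₁₂.2, hzy2.1], by linarith,
      fun x hx => ?_⟩
    have hle := (hx0 x hx).2
    simp only [id, triple_zero, triple_two, triple_one, sub_zero, div_one]
    rw [e₀₁' _ hle, e₀₂ _ hle, e₁₂' _ hle, hw₁', hw₂']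
    norm_num
  · intro a x hx x' hx' hlt
    have h1 := hx0 x hx
    have h2 := hx0 x' hx'
    exact hmono a ⟨by linarith [h1.1], by linarith [h1.2]⟩ ⟨by linarith [h2.1], by linarith [h2.2]⟩
      (by linarith)

/-- In a box with three co-oriented strands a triangle of a move `Ω₃b` is created by three second
Reidemeister moves. -/
lemma exists_triangle {τ : Labelling T (ZMod 2)} (hτ : IsOrder τ) (hD : D ∈ DiagramsOf T)
    (B : Box D 3) (hmono : ∀ a, StrictMonoOn (B.θ a) (Icc (-1) 1))
    (hθ : ∀ a, ∀ x ∈ Icc (-1 : ℝ) 1, B.θ a x ∈ fundDomain Λ (B.comp a)) :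
    ∃ (D' : DiagramsOf T) (c₁ c₂ c₃ : Crossing D'.1), B.IsCrossing 2 1 c₁ ∧ B.IsCrossing 2 0 c₂ ∧
      B.IsCrossing 1 0 c₃ ∧ ¬ (τ D' c₁ = τ D' c₃ ∧ τ D' c₃ ≠ τ D' c₂) := by
  have hinj : Function.Injective (fun c : Fin 3 => (c : ℕ)) := Fin.val_injective
  have h01 : B.y 0 < B.y 1 := B.y_mono (by decide)
  have h12 : B.y 1 < B.y 2 := B.y_mono (by decide)
  have hy0 := (abs_lt.1 (B.y_mem 0)).1
  obtain ⟨h, hh1, hh2⟩ := exists_between h12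
  obtain ⟨A, hA, hA1⟩ := exists_between (abs_lt.1 (B.y_mem 2)).2
  obtain ⟨t, hAt, ht⟩ := exists_between hA1
  have hL : B.Levels h A t := ⟨hh1, hh2, hA, hAt, ht⟩
  have a₃ := admissible_before hL
  have a₄ := admissible_after hL
  have hd := differInRect_before_after B A h t hL
  have hD₃ : B.deform a₃ hinj ∈ DiagramsOf T :=
    Relation.EqvGen.trans _ _ _ hD (((Relation.EqvGen.rel _ _ (step_low hL)).trans _ _ _
      (.rel _ _ (step_high hL))).trans _ _ _ (.rel _ _ (step_before hL)))
  obtain ⟨hΩ, z₀₁, m₀₁, z₀₂, m₀₂, z₁₂, m₁₂, e₀₁, e₀₂, e₁₂⟩ := isOmega3b_before_after hL hmono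
  have hD₄ : B.deform a₄ hinj ∈ DiagramsOf T :=
    Relation.EqvGen.trans _ _ _ hD₃ (.rel _ _ (.omega3 _ ⟨hΩ.1, _, Fin.val_injective, hΩ.2.1⟩))
  have hu : ∀ w ∈ Icc (-0.95 : ℝ) 0.1, w ∈ Icc (-1 : ℝ) 1 := fun w hw =>
    ⟨by linarith [hw.1], by linarith [hw.2]⟩
  have hr : ∀ w ∈ Icc (-0.95 : ℝ) 0.1, w ∈ Icc (-0.425 - 0.525 : ℝ) (-0.425 + 0.525) := fun w hw =>
    ⟨by linarith [hw.1], by linarith [hw.2]⟩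
  set g := B.triple A (stairs (B.y 0) h t 1) (bump (-0.1) 0 0.2 0.3)
  have c₁₂ : g 2 z₁₂ = g 1 z₁₂ := e₁₂.symm
  have c₀₂ : g 2 z₀₂ = g 0 z₀₂ := e₀₂.symm
  have c₀₁ : g 1 z₀₁ = g 0 z₀₁ := e₀₁.symm
  refine ⟨⟨_, hD₃⟩, crossing a₃ hθ (by decide) (hu _ m₁₂) c₁₂,
    crossing a₃ hθ (by decide) (hu _ m₀₂) c₀₂, crossing a₃ hθ (by decide) (hu _ m₀₁) c₀₁,
    isCrossing_crossing _ _ _ _ _, isCrossing_crossing _ _ _ _ _, isCrossing_crossing _ _ _ _ _, ?_⟩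
  exact hτ.source_triangle ⟨_, hD₃⟩ ⟨_, hD₄⟩ (rectMove a₃ a₄ hinj hd) hΩ _ _ _
    (isSourceCrossing_crossing a₃ a₄ hd hθ _ _ (hr _ m₁₂) c₁₂)
    (isSourceCrossing_crossing a₃ a₄ hd hθ _ _ (hr _ m₀₂) c₀₂)
    (isSourceCrossing_crossing a₃ a₄ hd hθ _ _ (hr _ m₀₁) c₀₁)

end Box

end Diagrams

/-! ### The interior of the surface and finite sets of points -/

section Topology

/-- A dense subset which is locally connected enough is connected together with the space. -/
lemma isPreconnected_of_dense {X : Type*} [TopologicalSpace X] [PreconnectedSpace X] {s : Set X}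
    (hs : Dense s) (h : ∀ x, ∃ V, IsOpen V ∧ x ∈ V ∧ IsPreconnected (V ∩ s)) :
    IsPreconnected s := by
  rw [isPreconnected_iff_subset_of_disjoint]
  intro u v hu hv hsuv huv
  let A : Set X := {x | ∃ V, IsOpen V ∧ x ∈ V ∧ V ∩ s ⊆ u}
  let B : Set X := {x | ∃ V, IsOpen V ∧ x ∈ V ∧ V ∩ s ⊆ v}
  have hA : IsOpen A := isOpen_iff_forall_mem_open.2 fun x ⟨V, hV, hx, hVu⟩ =>
    ⟨V, fun y hy => ⟨V, hV, hy, hVu⟩, hV, hx⟩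
  have hB : IsOpen B := isOpen_iff_forall_mem_open.2 fun x ⟨V, hV, hx, hVu⟩ =>
    ⟨V, fun y hy => ⟨V, hV, hy, hVu⟩, hV, hx⟩
  have hcover : univ ⊆ A ∪ B := fun x _ => by
    obtain ⟨V, hV, hx, hc⟩ := h x
    have hempty : V ∩ s ∩ (u ∩ v) = ∅ := by
      rw [inter_assoc, huv, inter_empty]
    rcases isPreconnected_iff_subset_of_disjoint.1 hc u v hu hv
      (inter_subset_right.trans hsuv) hempty with h' | h'
    · exact .inl ⟨V, hV, hx, h'⟩
    · exact .inr ⟨V, hV, hx, h'⟩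
  have hAB : A ∩ B = ∅ := by
    rw [eq_empty_iff_forall_notMem]
    rintro x ⟨⟨V, hV, hx, hVu⟩, W, hW, hx', hWv⟩
    obtain ⟨y, hyVW, hys⟩ := hs.inter_open_nonempty _ (hV.inter hW) ⟨x, hx, hx'⟩
    have : y ∈ s ∩ (u ∩ v) := ⟨hys, hVu ⟨hyVW.1, hys⟩, hWv ⟨hyVW.2, hys⟩⟩
    rw [huv] at this
    exact this
  rcases isPreconnected_iff_subset_of_disjoint.1 (isPreconnected_univ (α := X)) A B hA hB hcover
    (by rw [hAB, inter_empty]) with h' | h'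
  · left
    intro x hx
    obtain ⟨V, -, hxV, hVu⟩ := h' (mem_univ x)
    exact hVu ⟨hxV, hx⟩
  · right
    intro x hx
    obtain ⟨V, -, hxV, hVu⟩ := h' (mem_univ x)
    exact hVu ⟨hxV, hx⟩

end Topology

section Extend

variable {F : Type*}

open Classical in
/-- The map of the surface which is `ψ` in the coordinates given by `e`. -/
noncomputable def extendMap (e : Plane → F) (ψ : Plane → Plane) (q : F) : F :=
  if q ∈ range e then e (ψ (Function.invFun e q)) else q

lemma extendMap_apply [TopologicalSpace F]
    [ChartedSpace (EuclideanHalfSpace 2) F] {e : Plane → F} (he : IsPlaneEmbedding e)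
    (ψ : Plane → Plane) (p : Plane) :
    extendMap e ψ (e p) = e (ψ p) := by
  rw [extendMap, if_pos (mem_range_self p), he.invFun_apply]

lemma extendMap_of_notMem {e : Plane → F} {ψ : Plane → Plane} {q : F} (hq : q ∉ range e) :
    extendMap e ψ q = q := if_neg hq

end Extend

section Surface

variable {F : Type*} [TopologicalSpace F] [ChartedSpace (EuclideanHalfSpace 2) F]

/-- A diffeomorphism of the plane supported in the disk of radius `2` extends by the identity, and
so moves embedded planes to embedded planes. -/
lemma IsPlaneEmbedding.extendMap_comp [T2Space F] {e e' : Plane → F} (he : IsPlaneEmbedding e)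
    (he' : IsPlaneEmbedding e') {ψ : Plane → Plane}
    (hψ : IsLocalDiffeomorph 𝓘(ℝ, Plane) 𝓘(ℝ, Plane) ∞ ψ) (hinj : Function.Injective ψ)
    (hid : ∀ x, 2 ≤ ‖x‖ → ψ x = x) : IsPlaneEmbedding (extendMap e ψ ∘ e') := by
  have hinj' : Function.Injective (extendMap e ψ) := by
    intro q q' h
    by_cases hq : q ∈ range e
    · obtain ⟨p, rfl⟩ := hq
      rw [extendMap_apply he] at h
      by_cases hq' : q' ∈ range e
      · obtain ⟨p', rfl⟩ := hq'
        rw [extendMap_apply he] at h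
        rw [hinj (he.injective h)]
      · rw [extendMap_of_notMem hq'] at h
        exact absurd ⟨_, h⟩ hq'
    · rw [extendMap_of_notMem hq] at h
      by_cases hq' : q' ∈ range e
      · obtain ⟨p', rfl⟩ := hq'
        rw [extendMap_apply he] at h
        exact absurd ⟨_, h.symm⟩ hq
      · rwa [extendMap_of_notMem hq'] at h
  refine isPlaneEmbedding_of_injective (fun x => localDiffeo_comp (he'.2 x) ?_)
    (hinj'.comp he'.injective)
  generalize e' x = q
  by_cases hq : q ∈ e '' Metric.closedBall 0 2
  · obtain ⟨p, -, rfl⟩ := hq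
    have h1 := localDiffeo_comp (localDiffeo_comp (he.localDiffeo_invFun p)
      (g := ψ) (by rw [he.invFun_apply]; exact hψ p)) (g := e) (by
        simp only [Function.comp, he.invFun_apply]; exact he.2 (ψ p))
    refine localDiffeo_congr h1 ?_
    filter_upwards [he.1.isOpen_range.mem_nhds (mem_range_self p)] with q hq
    rw [extendMap, if_pos hq]
    rfl
  · have hc : IsClosed (e '' Metric.closedBall 0 2) :=
      ((isCompact_closedBall _ _).image he.1.continuous).isClosed
    refine localDiffeo_congr (localDiffeo_id q) ?_
    filter_upwards [hc.isOpen_compl.mem_nhds hq] with q' hq'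
    by_cases h : q' ∈ range e
    · obtain ⟨p, rfl⟩ := h
      rw [extendMap_apply he, hid p]
      · rfl
      · by_contra hlt
        exact hq' ⟨p, by simpa using (not_le.1 hlt).le, rfl⟩
    · exact extendMap_of_notMem h

variable [IsManifold (𝓡∂ 2) ∞ F]

/-- Every point has an open neighbourhood whose interior part is a half-disk or a disk. -/
lemma exists_preconnected_nhds (x : F) : ∃ V : Set F, IsOpen V ∧ x ∈ V ∧
    IsPreconnected (V ∩ (𝓡∂ 2).interior F) := by
  have hM : IsManifold (𝓡∂ 2) 1 F := IsManifold.of_le (n := ∞) (by simp)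
  set φ := extChartAt (𝓡∂ 2) x with hφ
  obtain ⟨r, hr, hball⟩ := Metric.mem_nhdsWithin_iff.1
    (extChartAt_target_mem_nhdsWithin (I := 𝓡∂ 2) x)
  rw [← hφ] at hball
  have hsub : ∀ p ∈ Metric.ball (φ x) r, p ∈ interior φ.target ↔ p ∈ interior (range (𝓡∂ 2)) := by
    intro p hp
    constructor
    · exact fun h => interior_mono (extChartAt_target_subset_range x) h
    · intro h
      refine mem_interior.2 ⟨Metric.ball (φ x) r ∩ interior (range (𝓡∂ 2)), ?_,
        Metric.isOpen_ball.inter isOpen_interior, hp, h⟩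
      exact (inter_subset_inter_right _ interior_subset).trans hball
  refine ⟨φ.source ∩ φ ⁻¹' Metric.ball (φ x) r,
    isOpen_extChartAt_preimage' x Metric.isOpen_ball, ⟨mem_extChartAt_source x,
      Metric.mem_ball_self hr⟩, ?_⟩
  have heq : φ.source ∩ φ ⁻¹' Metric.ball (φ x) r ∩ (𝓡∂ 2).interior F =
      φ.symm '' (Metric.ball (φ x) r ∩ interior (range (𝓡∂ 2))) := by
    ext y
    constructor
    · rintro ⟨⟨hy, hyb⟩, hyi⟩
      refine ⟨φ y, ⟨hyb, (hsub _ hyb).1 ?_⟩, φ.left_inv hy⟩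
      exact ((𝓡∂ 2).isInteriorPoint_iff_of_mem_atlas one_ne_zero (chart_mem_atlas _ x)
        (by rwa [extChartAt_source] at hy)).1 hyi
    · rintro ⟨p, ⟨hpb, hpi⟩, rfl⟩
      have hpt : p ∈ φ.target := hball ⟨hpb, interior_subset hpi⟩
      have hys := φ.map_target hpt
      refine ⟨⟨hys, ?_⟩, ?_⟩
      · rw [mem_preimage, φ.right_inv hpt]; exact hpb
      · refine ((𝓡∂ 2).isInteriorPoint_iff_of_mem_atlas one_ne_zero (chart_mem_atlas _ x)
          (by rwa [extChartAt_source] at hys)).2 ?_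
        change φ (φ.symm p) ∈ interior φ.target
        rw [φ.right_inv hpt]
        exact (hsub _ hpb).2 hpi
  rw [heq]
  refine IsPreconnected.image ?_ _ ((continuousOn_extChartAt_symm x).mono fun p hp =>
    hball ⟨hp.1, interior_subset hp.2⟩)
  exact ((convex_ball _ _).inter (𝓡∂ 2).convex_range.interior).isPreconnected

lemma dense_interior : Dense ((𝓡∂ 2).interior F) := by
  have hM : IsManifold (𝓡∂ 2) 1 F := IsManifold.of_le (n := ∞) (by simp)
  intro x
  set φ := extChartAt (𝓡∂ 2) x with hφ
  have hx : φ x ∈ closure (interior (range (𝓡∂ 2))) :=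
    (𝓡∂ 2).range_subset_closure_interior
      (extChartAt_target_subset_range x (mem_extChartAt_target x))
  rw [mem_closure_iff_nhds]
  intro t ht
  -- a point of the interior of the model near `φ x`
  have h1 : φ.symm ⁻¹' t ∈ 𝓝[range (𝓡∂ 2)] φ x := by
    have h := continuousAt_extChartAt_symm (I := 𝓡∂ 2) x
    rw [ContinuousAt, ← hφ, φ.left_inv (mem_extChartAt_source x)] at h
    exact nhdsWithin_le_nhds (h ht)
  obtain ⟨s, hs, hst⟩ := mem_nhdsWithin_iff_exists_mem_nhds_inter.1
    (inter_mem h1 (extChartAt_target_mem_nhdsWithin (I := 𝓡∂ 2) x))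
  obtain ⟨U, hUs, hU, hxU⟩ := mem_nhds_iff.1 hs
  obtain ⟨p, hpU, hpi⟩ := mem_closure_iff.1 hx U hU hxU
  have hUt : ∀ q ∈ U ∩ interior (range (𝓡∂ 2)), φ.symm q ∈ t ∧ q ∈ φ.target := fun q hq =>
    hst ⟨hUs hq.1, interior_subset hq.2⟩
  obtain ⟨hpt, hptar⟩ := hUt p ⟨hpU, hpi⟩
  refine ⟨φ.symm p, hpt, ?_⟩
  have hys := φ.map_target hptar
  refine ((𝓡∂ 2).isInteriorPoint_iff_of_mem_atlas one_ne_zero (chart_mem_atlas _ x)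
    (by rwa [extChartAt_source] at hys)).2 ?_
  change φ (φ.symm p) ∈ interior φ.target
  rw [φ.right_inv hptar]
  exact mem_interior.2 ⟨U ∩ interior (range (𝓡∂ 2)), fun q hq => (hUt q hq).2,
    hU.inter isOpen_interior, hpU, hpi⟩

lemma isPreconnected_interior [ConnectedSpace F] : IsPreconnected ((𝓡∂ 2).interior F) :=
  isPreconnected_of_dense dense_interior exists_preconnected_nhds

lemma exists_planeEmbedding_of_interior {p : F} (hp : p ∈ (𝓡∂ 2).interior F) :
    ∃ e : Plane → F, IsPlaneEmbedding e ∧ e 0 = p := by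
  have hM : IsManifold (𝓡∂ 2) 1 F := IsManifold.of_le (n := ∞) (by simp)
  set φ := extChartAt (𝓡∂ 2) p with hφ
  have hpi : φ p ∈ interior φ.target :=
    ((𝓡∂ 2).isInteriorPoint_iff_of_mem_atlas one_ne_zero (chart_mem_atlas _ p)
      (mem_chart_source _ p)).1 hp
  let Ψ : PartialDiffeomorph 𝓘(ℝ, Plane) (𝓡∂ 2) Plane F ∞ :=
    { toFun := φ.symm
      invFun := φ
      source := interior φ.target
      target := φ.source ∩ φ ⁻¹' interior φ.target
      map_source' := fun q hq => ⟨φ.map_target (interior_subset hq), by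
        rw [mem_preimage, φ.right_inv (interior_subset hq)]; exact hq⟩
      map_target' := fun q hq => hq.2
      left_inv' := fun q hq => φ.right_inv (interior_subset hq)
      right_inv' := fun q hq => φ.left_inv hq.1
      open_source := isOpen_interior
      open_target := isOpen_extChartAt_preimage' p isOpen_interior
      contMDiffOn_toFun := (contMDiffOn_extChartAt_symm p).mono interior_subset
      contMDiffOn_invFun := (contMDiffOn_extChartAt (x := p)).mono fun q hq => by
        have := hq.1
        rwa [hφ, extChartAt_source] at this }
  have h1 : IsLocalDiffeomorphAt 𝓘(ℝ, Plane) (𝓡∂ 2) ∞ φ.symm (φ p) := ⟨Ψ, hpi, fun _ _ => rfl⟩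
  have h2 : IsLocalDiffeomorphAt 𝓘(ℝ, Plane) 𝓘(ℝ, Plane) ∞ (fun q : Plane => φ p + q) 0 := by
    refine localDiffeo_of_fderiv (.of_forall fun y => ContDiff.contDiffAt (by fun_prop))
      fun v hv => ?_
    rw [fderiv_const_add] at hv
    simpa using hv
  have h3 := localDiffeo_comp h2 (g := φ.symm) (by simpa using h1)
  obtain ⟨e, he, heq⟩ := exists_planeEmbedding_germ h3
  refine ⟨e, he, ?_⟩
  rw [heq.self_of_nhds]
  change φ.symm (φ p + 0) = p
  rw [add_zero]
  exact φ.left_inv (mem_extChartAt_source p)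

/-- A small translation of the plane, cut off outside a disk. -/
lemma exists_push : ∃ r > 0, ∀ w : Plane, ‖w‖ < r → ∃ ψ : Plane → Plane,
    IsLocalDiffeomorph 𝓘(ℝ, Plane) 𝓘(ℝ, Plane) ∞ ψ ∧ Function.Injective ψ ∧ ψ w = 0 ∧
    ∀ x, 2 ≤ ‖x‖ → ψ x = x := by
  let b : ContDiffBump (0 : Plane) := ⟨1, 2, one_pos, one_lt_two⟩
  have hb : ContDiff ℝ ∞ b := b.contDiff
  obtain ⟨L, hL⟩ := hb.lipschitzWith_of_hasCompactSupport b.hasCompactSupport (by simp)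
  have hL1 : (0 : ℝ) < L + 1 := by positivity
  refine ⟨min 1 (1 / (L + 1)), lt_min one_pos (by positivity), fun w hw => ?_⟩
  have hw1 : ‖w‖ < 1 := hw.trans_le (min_le_left _ _)
  have hwL : L * ‖w‖ < 1 := by
    have := hw.trans_le (min_le_right _ _)
    rw [lt_div_iff₀ hL1] at this
    nlinarith [norm_nonneg w]
  have hsm : ContDiff ℝ ∞ fun x : Plane => x - b x • w := contDiff_id.sub (hb.smul contDiff_const)
  refine ⟨fun x => x - b x • w, fun x => ?_, fun x y hxy => ?_, ?_, fun x hx => ?_⟩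
  · refine localDiffeo_of_fderiv (.of_forall fun y => hsm.contDiffAt) fun v hv => ?_
    have hd : HasFDerivAt b (fderiv ℝ b x) x := (hb.differentiable (by simp) x).hasFDerivAt
    have hd' : HasFDerivAt (fun x : Plane => x - b x • w)
        (ContinuousLinearMap.id ℝ Plane - (fderiv ℝ b x).smulRight w) x :=
      (hasFDerivAt_id x).sub (hd.smul_const w)
    rw [hd'.fderiv] at hv
    have hv' : v = fderiv ℝ b x v • w := by
      simpa [sub_eq_zero] using hv
    have h1 : ‖v‖ ≤ L * ‖w‖ * ‖v‖ := by
      calc ‖v‖ = ‖fderiv ℝ b x v‖ * ‖w‖ := by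
            conv_lhs => rw [hv', norm_smul]
        _ ≤ (L * ‖v‖) * ‖w‖ := by
            gcongr
            exact ((fderiv ℝ b x).le_opNorm v).trans
              (mul_le_mul_of_nonneg_right (norm_fderiv_le_of_lipschitz ℝ hL) (norm_nonneg v))
        _ = _ := by ring
    by_contra hne
    have := norm_pos_iff.2 hne
    nlinarith
  · have h0 : x - y = (b x - b y) • w := by
      rw [sub_smul]
      exact sub_eq_sub_iff_sub_eq_sub.1 hxy
    have h1 : ‖x - y‖ ≤ L * ‖w‖ * ‖x - y‖ := by
      calc ‖x - y‖ = ‖b x - b y‖ * ‖w‖ := by rw [h0, norm_smul]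
        _ ≤ (L * ‖x - y‖) * ‖w‖ := by
            gcongr
            exact hL.norm_sub_le x y
        _ = _ := by ring
    by_contra hne
    have := norm_pos_iff.2 (sub_ne_zero.2 hne)
    nlinarith
  · have : b w = 1 := b.one_of_mem_closedBall (by simpa [b] using hw1.le)
    simp [this]
  · have : b x = 0 := b.zero_of_le_dist (by simpa [b] using hx)
    simp [this]

/-- A finite set of interior points of a connected surface lies in one embedded plane. -/
lemma exists_planeEmbedding_of_finite [T2Space F] [ConnectedSpace F] {s : Set F} (hs : s.Finite)
    (hi : s ⊆ (𝓡∂ 2).interior F) : ∃ e : Plane → F, IsPlaneEmbedding e ∧ s ⊆ range e := by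
  have hM : IsManifold (𝓡∂ 2) 1 F := IsManifold.of_le (n := ∞) (by simp)
  induction s, hs using Set.Finite.induction_on with
  | empty =>
    obtain ⟨p, hp⟩ := (dense_interior (F := F)).nonempty
    obtain ⟨e, he, -⟩ := exists_planeEmbedding_of_interior hp
    exact ⟨e, he, empty_subset _⟩
  | @insert p s _ hs ih =>
    obtain ⟨e₀, he₀, hse₀⟩ := ih fun q hq => hi (mem_insert_of_mem _ hq)
    -- the points which lie in an embedded plane together with `s`
    let W : Set F := {q | ∃ e : Plane → F, IsPlaneEmbedding e ∧ s ⊆ range e ∧ q ∈ range e}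
    have hW : IsOpen W := isOpen_iff_forall_mem_open.2 fun q ⟨e, he, hse, hq⟩ =>
      ⟨range e, fun q' hq' => ⟨e, he, hse, hq'⟩, he.1.isOpen_range, hq⟩
    -- if `q'` is near `q` and lies in a plane with `s`, pushing `q'` to `q` moves this plane to a
    -- plane through `q`, and leaves `s` fixed
    have hWc : IsOpen ((𝓡∂ 2).interior F \ W) := by
      refine isOpen_iff_mem_nhds.2 fun q ⟨hqi, hqW⟩ => ?_
      have hqs : q ∉ s := fun h => hqW ⟨e₀, he₀, hse₀, hse₀ h⟩
      obtain ⟨e, he, rfl⟩ := exists_planeEmbedding_of_interior hqi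
      -- a scaled copy of `e` which avoids `s`
      have h1 : e ⁻¹' sᶜ ∈ 𝓝 (0 : Plane) :=
        he.1.continuous.continuousAt (hs.isClosed.isOpen_compl.mem_nhds hqs)
      obtain ⟨δ, hδ, hball⟩ := coord_abs_lt_mem_nhds 0 h1
      obtain ⟨σ, hσ, hσ', hσδ, hσid⟩ := exists_squeeze hδ
      have he₁ : IsPlaneEmbedding (e ∘ prodPlane σ σ) :=
        he.comp (localDiffeo_prodPlane hσ hσ (fun u => (hσ' u).ne') fun u => (hσ' u).ne')
          (injective_prodPlane (strictMono_of_deriv_pos hσ').injective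
            (strictMono_of_deriv_pos hσ').injective)
      have hdis : ∀ x, (e ∘ prodPlane σ σ) x ∉ s := fun x =>
        hball _ (by simpa using hσδ _) (by simpa using hσδ _)
      have he₁0 : (e ∘ prodPlane σ σ) 0 = e 0 := by
        have h0 : σ 0 = 0 := hσid.self_of_nhds
        refine congrArg e (plane_ext ?_ ?_) <;> simp [h0]
      rw [← he₁0] at hqi hqW ⊢
      generalize e ∘ prodPlane σ σ = e at *
      obtain ⟨r, hr, hpush⟩ := exists_push
      have h2 : e '' Metric.ball 0 r ∈ 𝓝 (e 0) :=
        he₁.1.isOpenMap.image_mem_nhds (Metric.ball_mem_nhds 0 hr)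
      filter_upwards [h2, ((𝓡∂ 2).isOpen_interior one_ne_zero).mem_nhds hqi] with q' hq' hq'i
      refine ⟨hq'i, ?_⟩
      rintro ⟨e', he', hse', w', hw'⟩
      obtain ⟨w, hw, rfl⟩ := hq'
      obtain ⟨ψ, hψ, hψi, hψw, hψid⟩ := hpush w (by simpa using hw)
      refine hqW ⟨extendMap e ψ ∘ e', he₁.extendMap_comp he' hψ hψi hψid, ?_, w', ?_⟩
      · intro z hz
        obtain ⟨x, rfl⟩ := hse' hz
        refine ⟨x, extendMap_of_notMem ?_⟩
        rintro ⟨y, hy⟩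
        exact hdis y (hy ▸ hz)
      · simp only [Function.comp]
        rw [hw', extendMap_apply he₁, hψw]
    have hcon := isPreconnected_iff_subset_of_disjoint.1 (isPreconnected_interior (F := F)) W
      ((𝓡∂ 2).interior F \ W) hW hWc (fun q hq => by
        by_cases h : q ∈ W
        · exact .inl h
        · exact .inr ⟨hq, h⟩) (by
        rw [eq_empty_iff_forall_notMem]
        rintro q ⟨-, h1, -, h2⟩
        exact h2 h1)
    have hint : e₀ 0 ∈ (𝓡∂ 2).interior F := by
      rw [← (𝓡∂ 2).compl_boundary]
      exact he₀.notMem_boundary 0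
    rcases hcon with h | h
    · obtain ⟨e, he, hse, hpe⟩ := h (hi (mem_insert _ _))
      exact ⟨e, he, insert_subset hpe hse⟩
    · exact absurd ⟨e₀, he₀, hse₀, mem_range_self 0⟩ (h hint).2

end Surface

/-! ### A line transverse to the diagram -/

section Calculus

lemma localDiffeo_of_inverse {E : Type*} [NormedAddCommGroup E] [NormedSpace ℝ E] {f g : E → E}
    (hf : ContDiff ℝ ∞ f) (hg : ContDiff ℝ ∞ g) (hgf : ∀ x, g (f x) = x) (hfg : ∀ x, f (g x) = x) :
    IsLocalDiffeomorph 𝓘(ℝ, E) 𝓘(ℝ, E) ∞ f := fun x =>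
  ⟨{ toFun := f
     invFun := g
     source := univ
     target := univ
     map_source' := fun _ _ => trivial
     map_target' := fun _ _ => trivial
     left_inv' := fun x _ => hgf x
     right_inv' := fun x _ => hfg x
     open_source := isOpen_univ
     open_target := isOpen_univ
     contMDiffOn_toFun := hf.contMDiff.contMDiffOn
     contMDiffOn_invFun := hg.contMDiff.contMDiffOn }, mem_univ x, fun _ _ => rfl⟩

/-- Hermite interpolation: a smooth function with given values and derivatives. -/
lemma exists_hermite {m : ℕ} {y : Fin m → ℝ} (hy : Function.Injective y) (u v : Fin m → ℝ) :
    ∃ P : ℝ → ℝ, ContDiff ℝ ∞ P ∧ ∀ a, P (y a) = u a ∧ deriv P (y a) = v a := by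
  set s : Finset (Fin m) := Finset.univ
  have hinj : InjOn y s := hy.injOn
  set N := Lagrange.nodal s y
  have hN : ∀ a, N.derivative.eval (y a) ≠ 0 := fun a => by
    rw [Lagrange.eval_nodal_derivative_eval_node_eq (Finset.mem_univ a), Lagrange.eval_nodal,
      Finset.prod_ne_zero_iff]
    intro b hb
    exact sub_ne_zero.2 (hy.ne (Finset.ne_of_mem_erase hb).symm)
  set L := Lagrange.interpolate s y u
  set M := Lagrange.interpolate s y fun a =>
    (v a - L.derivative.eval (y a)) / N.derivative.eval (y a)
  -- `L` has the values `u`, and the multiple of the nodal polynomial `N` corrects the derivatives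
  refine ⟨fun x => (L + N * M).eval x, by
    simpa [Polynomial.coe_aeval_eq_eval] using (L + N * M).contDiff_aeval (R := ℝ) (𝕜 := ℝ) ∞,
    fun a => ?_⟩
  have hLa : L.eval (y a) = u a := Lagrange.eval_interpolate_at_node _ hinj (Finset.mem_univ a)
  have hMa : M.eval (y a) = (v a - L.derivative.eval (y a)) / N.derivative.eval (y a) :=
    Lagrange.eval_interpolate_at_node _ hinj (Finset.mem_univ a)
  have hNa : N.eval (y a) = 0 := Lagrange.eval_nodal_at_node (Finset.mem_univ a)
  constructor
  · simp [hLa, hNa]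
  · rw [Polynomial.deriv]
    simp only [Polynomial.derivative_add, Polynomial.derivative_mul, Polynomial.eval_add,
      Polynomial.eval_mul, hNa, hMa, zero_mul, add_zero]
    rw [mul_div_cancel₀ _ (hN a)]; ring

/-- The critical values of a function on the line form a null set. -/
lemma volume_critical_values {f : ℝ → ℝ} {s : Set ℝ} (hf : ∀ t ∈ s, HasDerivAt f 0 t) :
    MeasureTheory.volume (f '' s) = 0 := by
  refine MeasureTheory.addHaar_image_eq_zero_of_det_fderivWithin_eq_zero _
    (f' := fun _ => ContinuousLinearMap.toSpanSingleton ℝ (0 : ℝ))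
    (fun t ht => (hf t ht).hasFDerivAt.hasFDerivWithinAt) fun t _ => ?_
  rw [ContinuousLinearMap.toSpanSingleton_zero]
  simp [ContinuousLinearMap.det]

end Calculus

section Diagrams

variable {F : Type*} [TopologicalSpace F] [ChartedSpace (EuclideanHalfSpace 2) F]
  {n : ℕ} {Λ : Finset (Fin n)}

/-- The component `i` of the diagram `D` in the coordinates given by `e`. -/
noncomputable def planarCurve (D : TangleDiagram F n Λ) (e : Plane → F) (i : Fin n) (t : ℝ) :
    Plane :=
  Function.invFun e (D.γ i t)

variable {D : TangleDiagram F n Λ} {e : Plane → F}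

lemma apply_planarCurve {i : Fin n} {t : ℝ} (h : D.γ i t ∈ range e) :
    e (planarCurve D e i t) = D.γ i t := apply_invFun h

/-- In the coordinates of an embedded plane the curves of a diagram are smooth and regular. -/
lemma planarCurve_spec [IsManifold (𝓡∂ 2) ∞ F] (he : IsPlaneEmbedding e) {i : Fin n} {t : ℝ}
    (ht : t ∈ paramDomain Λ i) (h : D.γ i t ∈ range e) :
    (∀ᶠ s in 𝓝 t, D.γ i s ∈ range e) ∧ (∀ᶠ s in 𝓝 t, ContDiffAt ℝ ∞ (planarCurve D e i) s) ∧
      deriv (planarCurve D e i) t ≠ 0 := by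
  have hreg := mem_Ioo_of_notMem_boundary D ht (by
    obtain ⟨p, hp⟩ := h
    rw [← hp]; exact he.notMem_boundary p)
  obtain ⟨e₁, he₁, h₁⟩ := D.immersed i t hreg
  exact planar_curve he he₁ h₁ h

lemma deriv_coord {c : ℝ → Plane} {t : ℝ} (h : DifferentiableAt ℝ c t) (k : Fin 2) :
    HasDerivAt (fun s => c s k) (deriv c t k) t :=
  (EuclideanSpace.proj k : Plane →L[ℝ] ℝ).hasFDerivAt.comp_hasDerivAt t h.hasDerivAt

/-- Given finitely many points of the diagram inside an embedded plane, the coordinates may be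
changed in such a way that these points lie on the vertical axis and that the diagram passes them
from left to right. -/
lemma exists_vertical [IsManifold (𝓡∂ 2) ∞ F] (he : IsPlaneEmbedding e) {m : ℕ} {i : Fin m → Fin n}
    {s : Fin m → ℝ} (hs : ∀ a, s a ∈ paramDomain Λ (i a)) (hr : ∀ a, D.γ (i a) (s a) ∈ range e)
    (hinj : Function.Injective fun a => D.γ (i a) (s a)) :
    ∃ e' : Plane → F, IsPlaneEmbedding e' ∧ ∀ a, D.γ (i a) (s a) ∈ range e' ∧
      planarCurve D e' (i a) (s a) 0 = 0 ∧
      0 < deriv (fun t => planarCurve D e' (i a) t 0) (s a) := by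
  set c := fun a => planarCurve D e (i a) with hc
  have hd : ∀ a, DifferentiableAt ℝ (c a) (s a) := fun a =>
    (planarCurve_spec he (hs a) (hr a)).2.1.self_of_nhds.differentiableAt (by simp)
  set v := fun a => deriv (c a) (s a) with hv
  have hv0 : ∀ a, v a ≠ 0 := fun a => (planarCurve_spec he (hs a) (hr a)).2.2
  have hcinj : Function.Injective fun a => c a (s a) := fun a b hab => hinj (by
    change D.γ (i a) (s a) = D.γ (i b) (s b)
    rw [← apply_planarCurve (hr a), ← apply_planarCurve (hr b)]
    exact congrArg e hab)
  -- all but finitely many shears make the second coordinates different and changing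
  obtain ⟨k, hk1, hk2⟩ : ∃ k : ℝ, (Function.Injective fun a => c a (s a) 1 + k * c a (s a) 0) ∧
      ∀ a, v a 1 + k * v a 0 ≠ 0 := by
    have hsub : ∀ p q : ℝ, ¬ (q = 0 ∧ p = 0) → {k : ℝ | p + k * q = 0}.Finite := by
      intro p q hpq
      refine Set.Subsingleton.finite fun k hk k' hk' => ?_
      simp only [mem_ofPred_eq] at hk hk'
      have hq : q ≠ 0 := fun h => hpq ⟨h, by simpa [h] using hk⟩
      have : (k - k') * q = 0 := by linear_combination hk - hk'
      rcases mul_eq_zero.1 this with h | h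
      · linarith
      · exact absurd h hq
    have h1 : (⋃ a, {k : ℝ | v a 1 + k * v a 0 = 0}).Finite := by
      refine finite_iUnion fun a => hsub _ _ fun h => hv0 a ?_
      exact plane_ext (by simpa using h.1) (by simpa using h.2)
    have h2 : (⋃ p : {p : Fin m × Fin m // p.1 ≠ p.2}, {k : ℝ |
        (c p.1.1 (s p.1.1) 1 - c p.1.2 (s p.1.2) 1) +
          k * (c p.1.1 (s p.1.1) 0 - c p.1.2 (s p.1.2) 0) = 0}).Finite := by
      refine finite_iUnion fun p => hsub _ _ fun h => p.2 (hcinj ?_)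
      exact plane_ext (sub_eq_zero.1 h.1) (sub_eq_zero.1 h.2)
    obtain ⟨k, hk⟩ := (h1.union h2).infinite_compl.nonempty
    simp only [mem_compl_iff, mem_union, mem_iUnion, mem_ofPred_eq, not_or, not_exists] at hk
    refine ⟨k, fun a b hab => ?_, hk.1⟩
    by_contra hne
    refine hk.2 ⟨(a, b), hne⟩ ?_
    simp only at hab ⊢
    linear_combination hab
  set w := fun a => c a (s a) 1 + k * c a (s a) 0 with hw
  obtain ⟨P, hP, hPa⟩ := exists_hermite (y := w) hk1 (fun a => c a (s a) 0) fun a =>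
    (v a 0 - 1) / (v a 1 + k * v a 0)
  -- after the shear, the horizontal translation by `P` moves the points to the axis; the
  -- derivatives of `P` are chosen so that the new horizontal velocities are equal to `1`
  let φ : Plane → Plane := fun q => !₂[q 0 + P (q 1), q 1 - k * (q 0 + P (q 1))]
  let ψ : Plane → Plane := fun p => !₂[p 0 - P (p 1 + k * p 0), p 1 + k * p 0]
  have x0 := contDiff_coord 0
  have x1 := contDiff_coord 1
  have hφ : ContDiff ℝ ∞ φ := contDiff_pt (x0.add (hP.comp x1))
    (x1.sub (contDiff_const.mul (x0.add (hP.comp x1))))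
  have hψ : ContDiff ℝ ∞ ψ := contDiff_pt
    (x0.sub (hP.comp (x1.add (contDiff_const.mul x0)))) (x1.add (contDiff_const.mul x0))
  have hψφ : ∀ q, ψ (φ q) = q := fun q => by
    refine plane_ext ?_ ?_ <;> simp [φ, ψ]
  have hφψ : ∀ q, φ (ψ q) = q := fun q => by
    refine plane_ext ?_ ?_ <;> simp [φ, ψ]
  have he' : IsPlaneEmbedding (e ∘ φ) := he.comp (localDiffeo_of_inverse hφ hψ hψφ hφψ)
    (Function.LeftInverse.injective hψφ)
  have hinv : ∀ q ∈ range e, Function.invFun (e ∘ φ) q = ψ (Function.invFun e q) := by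
    rintro _ ⟨p, rfl⟩
    rw [he.invFun_apply]
    conv_lhs => rw [← hφψ p]
    exact he'.invFun_apply (ψ p)
  refine ⟨e ∘ φ, he', fun a => ?_⟩
  have hca : planarCurve D (e ∘ φ) (i a) (s a) = ψ (c a (s a)) := hinv _ (hr a)
  refine ⟨⟨ψ (c a (s a)), ?_⟩, ?_, ?_⟩
  · simp only [Function.comp, hφψ]
    exact apply_planarCurve (hr a)
  · rw [hca]
    change c a (s a) 0 - P (w a) = 0
    rw [(hPa a).1, sub_self]
  · have heq : (fun t => planarCurve D (e ∘ φ) (i a) t 0) =ᶠ[𝓝 (s a)]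
        fun t => c a t 0 - P (c a t 1 + k * c a t 0) := by
      filter_upwards [(planarCurve_spec he (hs a) (hr a)).1] with t ht
      rw [planarCurve, hinv _ ht]
      rfl
    have d0 := deriv_coord (hd a) 0
    have d1 := deriv_coord (hd a) 1
    have dP : HasDerivAt P ((v a 0 - 1) / (v a 1 + k * v a 0)) (w a) := by
      rw [← (hPa a).2]
      exact (hP.differentiable (by simp) _).hasDerivAt
    have d2 := dP.comp (s a) (d1.add (d0.const_mul k))
    have d3 : HasDerivAt (fun t => c a t 0 - P (c a t 1 + k * c a t 0)) _ (s a) := d0.sub d2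
    rw [heq.deriv_eq, d3.deriv]
    change 0 < v a 0 - (v a 0 - 1) / (v a 1 + k * v a 0) * (v a 1 + k * v a 0)
    rw [div_mul_cancel₀ _ (hk2 a)]
    norm_num

/-- The vertical line `x = c` of the plane `e` is in general position to the diagram. -/
structure IsRegularLine (D : TangleDiagram F n Λ) (e : Plane → F) (c : ℝ) : Prop where
  deriv_ne : ∀ i, ∀ t ∈ paramDomain Λ i, D.γ i t ∈ range e → planarCurve D e i t 0 = c →
    deriv (fun s => planarCurve D e i s 0) t ≠ 0
  not_double : ∀ i s j t, IsDoublePair Λ D.γ i s j t → D.γ i s ∈ range e →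
    planarCurve D e i s 0 ≠ c

/-- Almost all vertical lines are in general position. -/
lemma ae_isRegularLine [IsManifold (𝓡∂ 2) ∞ F] (he : IsPlaneEmbedding e) :
    ∀ᵐ c : ℝ, IsRegularLine D e c := by
  let crit : Fin n → Set ℝ := fun i => {t | t ∈ paramDomain Λ i ∧ D.γ i t ∈ range e ∧
    deriv (fun s => planarCurve D e i s 0) t = 0}
  have h1 : ∀ᵐ c : ℝ, ∀ i, c ∉ (fun s => planarCurve D e i s 0) '' crit i := by
    refine MeasureTheory.ae_all_iff.2 fun i => ?_
    refine MeasureTheory.measure_eq_zero_iff_ae_notMem.1 (volume_critical_values fun t ht => ?_)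
    have hd := deriv_coord ((planarCurve_spec he ht.1 ht.2.1).2.1.self_of_nhds.differentiableAt
      (by simp)) 0
    rw [← ht.2.2]
    exact hd.differentiableAt.hasDerivAt
  have h2 : ∀ᵐ c : ℝ, c ∉ (fun p : (Fin n × ℝ) × (Fin n × ℝ) => planarCurve D e p.1.1 p.1.2 0) ''
      {p | IsDoublePair Λ D.γ p.1.1 p.1.2 p.2.1 p.2.2} :=
    MeasureTheory.measure_eq_zero_iff_ae_notMem.1
      ((D.finite_double.image _).measure_zero _)
  filter_upwards [h1, h2] with c hc1 hc2
  refine ⟨fun i t ht hr hX hd => hc1 i ⟨t, ⟨ht, hr, hd⟩, hX⟩, fun i s j t hdp _ hX => ?_⟩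
  exact hc2 ⟨((i, s), (j, t)), hdp, hX⟩

/-- A regular vertical line which passes given pieces of the diagram from left to right. -/
lemma exists_regularLine [IsManifold (𝓡∂ 2) ∞ F] [T2Space F] [ConnectedSpace F]
    (D : TangleDiagram F n Λ) {m : ℕ} {i : Fin m → Fin n} {U : Fin m → Set ℝ}
    (hU : ∀ a, IsOpen (U a)) (hne : ∀ a, (U a).Nonempty) (hU01 : ∀ a, U a ⊆ Ioo 0 1)
    (hdis : ∀ a b, a ≠ b → i a = i b → Disjoint (U a) (U b)) :
    ∃ (e : Plane → F) (c : ℝ) (s : Fin m → ℝ), IsPlaneEmbedding e ∧ IsRegularLine D e c ∧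
      ∀ a, s a ∈ U a ∧ D.γ (i a) (s a) ∈ range e ∧ planarCurve D e (i a) (s a) 0 = c ∧
        0 < deriv (fun t => planarCurve D e (i a) t 0) (s a) := by
  have hfund : ∀ a, ∀ t ∈ U a, t ∈ fundDomain Λ (i a) := fun a t ht =>
    ⟨(hU01 a ht).1.le, (hU01 a ht).2.le, fun _ => (hU01 a ht).2⟩
  -- choose points which are not crossings
  have hex : ∀ a, ∃ s ∈ U a, ∀ j t, ¬ IsDoublePair Λ D.γ (i a) s j t := by
    intro a
    obtain ⟨x, hx⟩ := hne a
    have hinf : (U a).Infinite := infinite_of_mem_nhds x ((hU a).mem_nhds hx)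
    have hfin : ((fun p : (Fin n × ℝ) × (Fin n × ℝ) => p.1.2) ''
      {p | IsDoublePair Λ D.γ p.1.1 p.1.2 p.2.1 p.2.2}).Finite := D.finite_double.image _
    obtain ⟨s, hs, hs'⟩ := (hinf.sdiff hfin).nonempty
    exact ⟨s, hs, fun j t h => hs' ⟨((i a, s), (j, t)), h, rfl⟩⟩
  choose s₀ hs₀ hnd using hex
  have hinj : Function.Injective fun a => D.γ (i a) (s₀ a) := by
    intro a b hab
    by_contra hne'
    refine hnd a (i b) (s₀ b) ⟨hfund a _ (hs₀ a), hfund b _ (hs₀ b), fun h => ?_, hab⟩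
    obtain ⟨h1, h2⟩ := Prod.mk.inj h
    exact disjoint_left.1 (hdis a b hne' h1) (hs₀ a) (h2 ▸ hs₀ b)
  have hint : range (fun a => D.γ (i a) (s₀ a)) ⊆ (𝓡∂ 2).interior F := by
    rintro _ ⟨a, rfl⟩
    rw [← (𝓡∂ 2).compl_boundary, mem_compl_iff, D.boundary_iff _ _ (hfund a _ (hs₀ a))]
    rintro ⟨-, h | h⟩
    · exact (hU01 a (hs₀ a)).1.ne' h
    · exact (hU01 a (hs₀ a)).2.ne h
  obtain ⟨e₀, he₀, hr₀⟩ := exists_planeEmbedding_of_finite (finite_range _) hint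
  have hpar : ∀ a, s₀ a ∈ paramDomain Λ (i a) := fun a =>
    fundDomain_subset_paramDomain (hfund a _ (hs₀ a))
  obtain ⟨e, he, hea⟩ := exists_vertical he₀ hpar (fun a => hr₀ (mem_range_self a)) hinj
  -- vertical lines near the axis meet the arcs in the same way, and almost all of them are regular
  have hev : ∀ᶠ c in 𝓝 (0 : ℝ), ∀ a, ∃ s ∈ U a, D.γ (i a) s ∈ range e ∧
      planarCurve D e (i a) s 0 = c ∧ 0 < deriv (fun t => planarCurve D e (i a) t 0) s := by
    refine eventually_all.2 fun a => ?_
    obtain ⟨hra, hX, hX'⟩ := hea a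
    obtain ⟨h1, h2, -⟩ := planarCurve_spec he (hpar a) hra
    have hsm : ContDiffAt ℝ ∞ (fun t => planarCurve D e (i a) t 0) (s₀ a) :=
      (contDiff_coord 0).contDiffAt.comp _ h2.self_of_nhds
    have hst : HasStrictDerivAt (fun t => planarCurve D e (i a) t 0)
        (deriv (fun t => planarCurve D e (i a) t 0) (s₀ a)) (s₀ a) :=
      hsm.hasStrictDerivAt (by simp)
    have hmap := hst.map_nhds_eq hX'.ne'
    have hdc : ContinuousAt (deriv fun t => planarCurve D e (i a) t 0) (s₀ a) := by
      have := (hsm.fderiv_right (m := 0) (by simp)).continuousAt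
      have h3 : deriv (fun t => planarCurve D e (i a) t 0) =
        fun x => fderiv ℝ (fun t => planarCurve D e (i a) t 0) x 1 := by
        funext x; exact (fderiv_apply_one_eq_deriv).symm
      rw [h3]
      exact this.clm_apply continuousAt_const
    have hgood : {s | s ∈ U a ∧ D.γ (i a) s ∈ range e ∧
        0 < deriv (fun t => planarCurve D e (i a) t 0) s} ∈ 𝓝 (s₀ a) := by
      filter_upwards [(hU a).mem_nhds (hs₀ a), h1, hdc.eventually (lt_mem_nhds hX')] with s q1 q2 q3
        using ⟨q1, q2, q3⟩
    have := image_mem_map (m := fun t => planarCurve D e (i a) t 0) hgood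
    rw [hmap, hX] at this
    filter_upwards [this] with c ⟨s, hs, hsc⟩
    exact ⟨s, hs.1, hs.2.1, hsc, hs.2.2⟩
  obtain ⟨c, hreg, hc⟩ :=
    (MeasureTheory.Measure.dense_of_ae (ae_isRegularLine (D := D) he)).inter_nhds_nonempty hev
  choose s hs using hc
  exact ⟨e, c, s, he, hreg, hs⟩

end Diagrams

/-! ### A box around a regular line -/

section Calculus

/-- A local inverse of a function with nonzero derivative. -/
lemma exists_localInverse {X : ℝ → ℝ} {t : ℝ} (h : ∀ᶠ s in 𝓝 t, ContDiffAt ℝ ∞ X s)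
    (hd : deriv X t ≠ 0) {W : Set ℝ} (hW : W ∈ 𝓝 t) :
    ∃ (g : ℝ → ℝ) (ρ : ℝ), 0 < ρ ∧ (∀ x, |x - X t| < ρ →
      g x ∈ W ∧ X (g x) = x ∧ ContDiffAt ℝ ∞ g x ∧ 0 < deriv g x * deriv X t) ∧
      ∀ᶠ s in 𝓝 t, g (X s) = s := by
  have hX : ContDiffAt ℝ ∞ X t := h.self_of_nhds
  have hdX : HasDerivAt X (deriv X t) t := (hX.differentiableAt (by simp)).hasDerivAt
  have hdc : ContinuousAt (deriv X) t := by
    have := (hX.fderiv_right (m := 0) (by simp)).continuousAt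
    have h3 : deriv X = fun x => fderiv ℝ X x 1 := funext fun x => fderiv_apply_one_eq_deriv.symm
    rw [h3]
    exact this.clm_apply continuousAt_const
  have hsign : ∀ᶠ s in 𝓝 t, 0 < deriv X s * deriv X t :=
    (hdc.mul continuousAt_const).eventually (lt_mem_nhds (mul_self_pos.2 hd))
  let Φ := hX.toOpenPartialHomeomorph X (hdX.hasFDerivAt_equiv hd) (by simp)
  have hΦ : ∀ s, Φ s = X s := fun s => rfl
  have hts : t ∈ Φ.source := hX.mem_toOpenPartialHomeomorph_source _ _
  have htt : X t ∈ Φ.target := Φ.map_source hts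
  have hgt : Φ.symm (X t) = t := Φ.left_inv hts
  have hgc : Tendsto Φ.symm (𝓝 (X t)) (𝓝 t) := by
    have := (Φ.continuousAt_symm htt).tendsto
    rwa [hgt] at this
  have hev : ∀ᶠ x in 𝓝 (X t), Φ.symm x ∈ W ∧ X (Φ.symm x) = x ∧ ContDiffAt ℝ ∞ Φ.symm x ∧
      0 < deriv Φ.symm x * deriv X t := by
    filter_upwards [hgc.eventually hW, hgc.eventually h, hgc.eventually hsign,
      Φ.open_target.mem_nhds htt] with x h1 h2 h3 h4
    have hne : deriv X (Φ.symm x) ≠ 0 := fun h0 => by simp [h0] at h3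
    have hd' : HasDerivAt X (deriv X (Φ.symm x)) (Φ.symm x) :=
      (h2.differentiableAt (by simp)).hasDerivAt
    refine ⟨h1, Φ.right_inv h4, Φ.contDiffAt_symm_deriv hne h4 hd' h2, ?_⟩
    rw [(Φ.hasDerivAt_symm h4 hne hd').deriv]
    have h5 : (deriv X (Φ.symm x))⁻¹ * deriv X t =
        deriv X (Φ.symm x) * deriv X t * ((deriv X (Φ.symm x))⁻¹) ^ 2 := by
      field_simp
    rw [h5]
    have := inv_ne_zero hne
    positivity
  obtain ⟨ρ, hρ, hball⟩ := Metric.eventually_nhds_iff.1 hev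
  refine ⟨Φ.symm, ρ, hρ, fun x hx => hball (by rwa [Real.dist_eq]), ?_⟩
  filter_upwards [Φ.open_source.mem_nhds hts] with s hs using Φ.left_inv hs

/-- A smooth function with bounded derivative which is `1` at a point and `0` at finitely many
other points. -/
lemma exists_nodeBump {S : Set ℝ} (hS : S.Finite) {y : ℝ} (hy : y ∉ S) :
    ∃ χ : ℝ → ℝ, ContDiff ℝ ∞ χ ∧ χ y = 1 ∧ (∀ z ∈ S, χ z = 0) ∧ ∃ M, ∀ v, |deriv χ v| ≤ M := by
  obtain ⟨d, hd, hball⟩ := Metric.isOpen_iff.1 hS.isClosed.isOpen_compl y hy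
  let b : ContDiffBump y := ⟨d / 2, d, by positivity, by linarith⟩
  have hb : ContDiff ℝ ∞ b := b.contDiff
  obtain ⟨L, hL⟩ := hb.lipschitzWith_of_hasCompactSupport b.hasCompactSupport (by simp)
  refine ⟨b, hb, b.one_of_mem_closedBall (Metric.mem_closedBall_self b.rIn_pos.le),
    fun z hz => ?_, L,
    fun v => norm_deriv_le_of_lipschitz hL⟩
  refine b.zero_of_le_dist ?_
  by_contra hlt
  exact hball (show z ∈ Metric.ball y d from not_le.1 hlt) hz

end Calculus

section Surface

variable {F : Type*} [TopologicalSpace F] [ChartedSpace (EuclideanHalfSpace 2) F]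

/-- Graphs of smooth functions over a small interval are straightened by a change of the
coordinates which preserves the vertical lines. -/
lemma exists_straight {e : Plane → F} (he : IsPlaneEmbedding e) {c A B ρ : ℝ} (hAB : A < B)
    (hρ : 0 < ρ) {K : ℕ} {y : Fin K → ℝ} (hy : Function.Injective y) (hyA : ∀ k, y k ≠ A)
    (hyB : ∀ k, y k ≠ B) {f : Fin K → ℝ → ℝ} (hf : ∀ k x, |x - c| < ρ → ContDiffAt ℝ ∞ (f k) x)
    (hfc : ∀ k, f k c = y k) : ∃ ε₀ > 0, ∀ ε, 0 < ε → ε < ε₀ → ∃ E : Plane → F,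
      IsPlaneEmbedding E ∧
      (∀ k, ∀ x ∈ Icc (-1 : ℝ) 1, E !₂[x, (y k - (A + B) / 2) / ((B - A) / 2)] =
        e !₂[c + ε * x, f k (c + ε * x)]) ∧
      ∀ p ∈ square, ∃ y' ∈ Icc A B, E p = e !₂[c + ε * p 0, y'] := by
  have hχ : ∀ k, ∃ χ : ℝ → ℝ, ContDiff ℝ ∞ χ ∧ χ (y k) = 1 ∧
      (∀ z ∈ insert A (insert B (y '' {l | l ≠ k})), χ z = 0) ∧ ∃ M, ∀ v, |deriv χ v| ≤ M := by
    intro k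
    refine exists_nodeBump (((toFinite _).image y).insert B |>.insert A) ?_
    rintro (h | h | ⟨l, hl, h⟩)
    · exact hyA k h
    · exact hyB k h
    · exact hl (hy h)
  choose χ hχs hχ1 hχ0 M hM using hχ
  have hχA : ∀ k, χ k A = 0 := fun k => hχ0 k A (mem_insert _ _)
  have hχB : ∀ k, χ k B = 0 := fun k => hχ0 k B (mem_insert_of_mem _ (mem_insert _ _))
  have hχne : ∀ k l, l ≠ k → χ k (y l) = 0 := fun k l h =>
    hχ0 k _ (mem_insert_of_mem _ (mem_insert_of_mem _ ⟨l, h, rfl⟩))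
  -- over a small interval the graphs deviate little from horizontal lines
  have hev : ∀ᶠ x in 𝓝 c, ∑ k, |f k x - y k| * |M k| < 1 := by
    have hcont : ContinuousAt (fun x => ∑ k, |f k x - y k| * |M k|) c := by
      refine tendsto_finsetSum _ fun k _ => ?_
      exact ((((hf k c (by simpa using hρ)).continuousAt).sub continuousAt_const).abs.mul
        continuousAt_const)
    exact hcont.eventually (gt_mem_nhds (by simp [hfc]))
  obtain ⟨r₀, hr₀, hball⟩ := Metric.eventually_nhds_iff.1 hev
  obtain ⟨σ, hσ, hσ', hσr, hσid⟩ := exists_squeeze (lt_min hr₀ hρ)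
  obtain ⟨ε₀, hε₀, hid⟩ := Metric.eventually_nhds_iff.1 hσid
  have hsmall : ∀ u, ∑ k, |f k (c + σ u) - y k| * |M k| < 1 := fun u => hball (by
    rw [Real.dist_eq, add_sub_cancel_left]
    exact (hσr u).trans_le (min_le_left _ _))
  have hfσ : ∀ k, ContDiff ℝ ∞ fun u => f k (c + σ u) := fun k => by
    rw [contDiff_iff_contDiffAt]
    intro u
    have h1 : ContDiffAt ℝ ∞ (fun u => c + σ u) u := (contDiff_const.add hσ).contDiffAt
    exact (hf k _ (by
      rw [add_sub_cancel_left]; exact (hσr u).trans_le (min_le_right _ _))).comp u h1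
  -- a change of the heights which takes `y k` to the `k`-th graph and fixes `A` and `B`; it is
  -- increasing since the graphs deviate little
  let h : ℝ → ℝ → ℝ := fun u v => v + ∑ k, (f k (c + σ u) - y k) * χ k v
  have hdv : ∀ u v, HasDerivAt (h u) (1 + ∑ k, (f k (c + σ u) - y k) * deriv (χ k) v) v := by
    intro u v
    refine (hasDerivAt_id v).add (HasDerivAt.fun_sum fun k _ => ?_)
    exact (((hχs k).differentiable (by simp) v).hasDerivAt).const_mul _
  have hpos : ∀ u v, 0 < 1 + ∑ k, (f k (c + σ u) - y k) * deriv (χ k) v := by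
    intro u v
    have h1 : |∑ k, (f k (c + σ u) - y k) * deriv (χ k) v| ≤
        ∑ k, |f k (c + σ u) - y k| * |M k| := by
      refine (Finset.abs_sum_le_sum_abs _ _).trans (Finset.sum_le_sum fun k _ => ?_)
      rw [abs_mul]
      exact mul_le_mul_of_nonneg_left ((hM k v).trans (le_abs_self _)) (abs_nonneg _)
    have h2 := neg_abs_le (∑ k, (f k (c + σ u) - y k) * deriv (χ k) v)
    linarith [hsmall u]
  have hmono : ∀ u, StrictMono (h u) := fun u => strictMono_of_deriv_pos fun v => by
    rw [(hdv u v).deriv]; exact hpos u v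
  have hhA : ∀ u, h u A = A := fun u => by simp [h, hχA]
  have hhB : ∀ u, h u B = B := fun u => by simp [h, hχB]
  have hhy : ∀ u k, h u (y k) = f k (c + σ u) := fun u k => by
    simp only [h]
    rw [Finset.sum_eq_single k (fun l _ hl => by rw [hχne l k hl.symm, mul_zero])
      (fun hk => absurd (Finset.mem_univ k) hk), hχ1]
    ring
  -- the straightening map
  let τ : Plane → Plane := fun q => !₂[q 0, h (q 0) (q 1)]
  have hh : ContDiff ℝ ∞ fun q : Plane => h (q 0) (q 1) :=
    (contDiff_coord 1).add (ContDiff.sum fun k _ =>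
      (((hfσ k).comp (contDiff_coord 0)).sub contDiff_const).mul ((hχs k).comp (contDiff_coord 1)))
  have hτ : IsLocalDiffeomorph 𝓘(ℝ, Plane) 𝓘(ℝ, Plane) ∞ τ := fun p => by
    refine localDiffeo_triangular (.of_forall fun q => hh.contDiffAt) ?_
    have h1 : HasDerivAt (fun s : ℝ => p + s • (!₂[0, 1] : Plane)) !₂[0, 1] 0 := by
      simpa using ((hasDerivAt_id (0 : ℝ)).smul_const (!₂[0, 1] : Plane)).const_add p
    have h2 : HasFDerivAt (fun q : Plane => h (q 0) (q 1))
        (fderiv ℝ (fun q : Plane => h (q 0) (q 1)) p) (p + (0 : ℝ) • (!₂[0, 1] : Plane)) := by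
      rw [zero_smul, add_zero]
      exact (hh.differentiable (by simp) p).hasFDerivAt
    have h3 := h2.comp_hasDerivAt (0 : ℝ) h1
    have h4 : HasDerivAt (fun s : ℝ => h (p 0) (p 1 + s)) _ 0 :=
      HasDerivAt.comp_const_add (p 1) 0 (by simpa using hdv (p 0) (p 1))
    have h5 : ((fun q : Plane => h (q 0) (q 1)) ∘ fun s : ℝ => p + s • (!₂[0, 1] : Plane)) =
        fun s : ℝ => h (p 0) (p 1 + s) := by
      funext s; simp
    rw [h5] at h3
    rw [h3.unique h4]
    exact (hpos _ _).ne'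
  have hτi : Function.Injective τ := fun p q hpq => by
    have h0 : τ p 0 = τ q 0 := by rw [hpq]
    have h1 : τ p 1 = τ q 1 := by rw [hpq]
    replace h0 : p 0 = q 0 := h0
    replace h1 : h (p 0) (p 1) = h (q 0) (q 1) := h1
    rw [h0] at h1
    exact plane_ext h0 ((hmono _).injective h1)
  have hdσ : ∀ u, deriv (fun u => c + σ u) u = deriv σ u := fun u => deriv_const_add _
  have hcσ : ContDiff ℝ ∞ fun u => c + σ u := contDiff_const.add hσ
  have he₁ : IsPlaneEmbedding (e ∘ prodPlane (fun u => c + σ u) id) :=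
    he.comp (localDiffeo_prodPlane hcσ contDiff_id (fun u => by rw [hdσ]; exact (hσ' u).ne')
      fun u => by simp) (injective_prodPlane (strictMono_of_deriv_pos fun u => by
        rw [hdσ]; exact hσ' u).injective Function.injective_id)
  refine ⟨ε₀, hε₀, fun ε hε hεε => ?_⟩
  have hN : 0 < (B - A) / 2 := by linarith
  have hεid : ∀ x ∈ Icc (-1 : ℝ) 1, σ (ε * x) = ε * x := fun x hx => hid (by
    rw [Real.dist_eq, sub_zero, abs_mul, abs_of_pos hε]
    have := abs_le.2 hx
    nlinarith)
  have hE : IsPlaneEmbedding ((e ∘ prodPlane (fun u => c + σ u) id) ∘ τ ∘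
      prodPlane (fun x => ε * x) fun v => (A + B) / 2 + (B - A) / 2 * v) := by
    have := (he₁.comp hτ hτi).comp (φ := prodPlane (fun x => ε * x) fun v =>
      (A + B) / 2 + (B - A) / 2 * v) (localDiffeo_prodPlane (by fun_prop) (by fun_prop)
        (fun u => by simpa using hε.ne') (fun u => by simpa using hN.ne')) (injective_prodPlane
          (fun a b hab => mul_left_cancel₀ hε.ne' hab)
          fun a b hab => mul_left_cancel₀ hN.ne' (add_left_cancel hab))
    exact this
  have hEp : ∀ x v, x ∈ Icc (-1 : ℝ) 1 → ((e ∘ prodPlane (fun u => c + σ u) id) ∘ τ ∘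
      prodPlane (fun x => ε * x) fun v => (A + B) / 2 + (B - A) / 2 * v) !₂[x, v] =
      e !₂[c + ε * x, h (ε * x) ((A + B) / 2 + (B - A) / 2 * v)] := fun x v hx => by
    refine congrArg e (plane_ext ?_ ?_)
    · simp [τ, hεid x hx]
    · simp [τ]
  refine ⟨_, hE, fun k x hx => ?_, fun p hp => ?_⟩
  · rw [hEp x _ hx, mul_div_cancel₀ _ hN.ne', add_sub_cancel, hhy, hεid x hx]
  · have h0 : p 0 ∈ Icc (-1 : ℝ) 1 := abs_le.1 hp.1
    have h1 := abs_le.1 hp.2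
    refine ⟨_, ⟨?_, ?_⟩, by rw [← hEp (p 0) (p 1) h0, pt_eta]⟩
    · conv_lhs => rw [← hhA (ε * p 0)]
      exact (hmono _).monotone (by nlinarith)
    · conv_rhs => rw [← hhB (ε * p 0)]
      exact (hmono _).monotone (by nlinarith)

end Surface

section Diagrams

variable {F : Type*} [TopologicalSpace F] [ChartedSpace (EuclideanHalfSpace 2) F]
  {n : ℕ} {Λ : Finset (Fin n)} {D : TangleDiagram F n Λ} {e : Plane → F}

lemma continuous_halfPlanePoint : Continuous halfPlanePoint :=
  Continuous.subtype_mk (continuous_pt (by fun_prop) continuous_const) _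

lemma continuousOn_gamma (D : TangleDiagram F n Λ) (i : Fin n) :
    ContinuousOn (D.γ i) (Icc 0 1) := by
  intro t ht
  by_cases hi : i ∈ Λ
  · rcases eq_or_lt_of_le ht.1 with rfl | h0
    · obtain ⟨e, he, hu⟩ := D.neat_start i hi
      have h1 : ContinuousWithinAt (fun u => e (halfPlanePoint u)) (Ici 0) 0 :=
        (he.1.continuous.comp continuous_halfPlanePoint).continuousWithinAt
      exact (h1.congr_of_eventuallyEq hu (hu.self_of_nhdsWithin (mem_Ici.2 le_rfl))).mono
        Icc_subset_Ici_self
    · rcases eq_or_lt_of_le ht.2 with rfl | h1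
      · obtain ⟨e, he, hu⟩ := D.neat_end i hi
        have h2 : ContinuousWithinAt (fun u => e (halfPlanePoint u)) (Ici 0) 0 :=
          (he.1.continuous.comp continuous_halfPlanePoint).continuousWithinAt
        have h3 : ContinuousWithinAt (fun u => D.γ i (1 - u)) (Ici 0) 0 :=
          h2.congr_of_eventuallyEq hu (hu.self_of_nhdsWithin (mem_Ici.2 le_rfl))
        have h4 : ContinuousWithinAt (fun s : ℝ => 1 - s) (Icc 0 1) 1 := by
          exact Continuous.continuousWithinAt (by fun_prop)
        have h5 := ContinuousWithinAt.comp (t := Ici 0) (x := (1 : ℝ)) (f := fun s : ℝ => 1 - s)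
          (by simpa using h3) h4 (fun s hs => by simpa using hs.2)
        refine h5.congr (fun s _ => ?_) ?_ <;> simp [Function.comp]
      · exact (continuousAt_gamma D fun _ => ⟨h0, h1⟩).continuousWithinAt
  · exact (continuousAt_gamma D fun h => absurd h hi).continuousWithinAt

/-- An embedded plane in which a square meets the diagram in horizontal strands gives a box. If the
embedding reverses the orientation, it is reflected in the horizontal axis; this reverses the
vertical order of the strands, but not their directions. -/
lemma exists_box_of_planeEmbedding [IsManifold (𝓡∂ 2) ∞ F] [OrientedSurface F]
    (D : TangleDiagram F n Λ) {K : ℕ} {E : Plane → F} (hE : IsPlaneEmbedding E) {y : Fin K → ℝ}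
    (hy : StrictMono y) (hy1 : ∀ k, |y k| < 1) {j : Fin K → Fin n} {θ : Fin K → ℝ → ℝ}
    (hc : ∀ k, ContinuousOn (θ k) (Icc (-1) 1))
    (hm : ∀ k, StrictMonoOn (θ k) (Icc (-1) 1) ∨ StrictAntiOn (θ k) (Icc (-1) 1))
    (hd : ∀ k, ∀ x ∈ Icc (-1 : ℝ) 1, θ k x ∈ paramDomain Λ (j k))
    (hθ : ∀ k, ∀ x ∈ Icc (-1 : ℝ) 1, D.γ (j k) (θ k x) = E !₂[x, y k])
    (hcov : ∀ i, ∀ t ∈ paramDomain Λ i, D.γ i t ∈ E '' square →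
      ∃ k, ∃ x ∈ Icc (-1 : ℝ) 1, j k = i ∧ SameParam Λ i t (θ k x)) :
    ∃ (B : Box D K) (ρ : Fin K → Fin K), ∀ k, B.comp (ρ k) = j k ∧ B.θ (ρ k) = θ k := by
  rcases hE.positive_or with hp | hp
  · exact ⟨⟨E, hp, y, hy, hy1, j, θ, hc, hm, hd, hθ, hcov⟩, id, fun k => ⟨rfl, rfl⟩⟩
  · refine ⟨⟨_, hp, fun k => -y k.rev, fun k l hkl => neg_lt_neg (hy (Fin.rev_lt_rev.2 hkl)),
      fun k => by rw [abs_neg]; exact hy1 _, fun k => j k.rev, fun k => θ k.rev, fun k => hc _,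
      fun k => hm _, fun k => hd _, fun k x hx => ?_, fun i t ht h => ?_⟩, Fin.rev, fun k => ?_⟩
    · rw [hθ _ x hx]
      refine congrArg E (plane_ext ?_ ?_) <;> simp
    · obtain ⟨p, hp, hpe⟩ := h
      obtain ⟨k, x, hx, h1, h2⟩ := hcov i t ht ⟨_, ⟨by simpa using hp.1, by simpa using hp.2⟩, hpe⟩
      exact ⟨k.rev, x, hx, by simpa using h1, by simpa using h2⟩
    · simp

/-- A regular line passes through finitely many points of the diagram in a bounded part. -/
lemma IsRegularLine.finite [IsManifold (𝓡∂ 2) ∞ F] [T2Space F] (he : IsPlaneEmbedding e) {c : ℝ}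
    (hreg : IsRegularLine D e c) (R : ℝ) :
    {p : Fin n × ℝ | p.2 ∈ fundDomain Λ p.1 ∧ D.γ p.1 p.2 ∈ range e ∧
      planarCurve D e p.1 p.2 0 = c ∧ |planarCurve D e p.1 p.2 1| ≤ R}.Finite := by
  set C : Set F := e '' {p | (c ≤ p 0 ∧ p 0 ≤ c) ∧ (-R ≤ p 1 ∧ p 1 ≤ R)}
  have hC : IsClosed C := ((isCompact_rect _ _ _ _).image he.1.continuous).isClosed
  have hT : ∀ i, (Icc (0 : ℝ) 1 ∩ D.γ i ⁻¹' C).Finite := by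
    intro i
    have hcl := (continuousOn_gamma D i).preimage_isClosed_of_isClosed isClosed_Icc hC
    refine finite_of_isolated (isCompact_Icc.of_isClosed_subset hcl inter_subset_left) ?_
    rintro t ⟨ht, p, ⟨⟨h1, h2⟩, -⟩, hp⟩
    have hX : ∀ s q, (c ≤ q 0 ∧ q 0 ≤ c) → e q = D.γ i s → planarCurve D e i s 0 = c :=
      fun s q hq hqs => by
        rw [planarCurve, ← hqs, he.invFun_apply]
        exact le_antisymm hq.2 hq.1
    have hne := hreg.deriv_ne i t (fun _ => ht) ⟨p, hp⟩ (hX t p ⟨h1, h2⟩ hp)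
    have hev := eventually_eq_of_deriv_ne_zero (f := fun s => planarCurve D e i s 0 - c) (x := t)
      (by rwa [deriv_sub_const])
    filter_upwards [hev] with s hs hsT
    obtain ⟨-, q, ⟨hq, -⟩, hqs⟩ := hsT
    exact hs (sub_eq_zero.2 (hX s q hq hqs))
  refine (finite_iUnion fun i => (hT i).image (Prod.mk i)).subset ?_
  rintro ⟨i, t⟩ ⟨ht, hr, hX, hY⟩
  refine mem_iUnion.2 ⟨i, t, ⟨⟨ht.1, ht.2.1⟩, planarCurve D e i t, ?_, apply_planarCurve hr⟩, rfl⟩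
  exact ⟨⟨hX.ge, hX.le⟩, abs_le.1 hY⟩

end Diagrams

section Diagrams

variable {F : Type*} [TopologicalSpace F] [ChartedSpace (EuclideanHalfSpace 2) F]
  {n : ℕ} {Λ : Finset (Fin n)} {D : TangleDiagram F n Λ} {e : Plane → F}

lemma sameParam_iff {i : Fin n} {s t : ℝ} :
    SameParam Λ i s t ↔ ∃ m : ℤ, (m = 0 ∨ i ∉ Λ) ∧ s - m = t := by
  constructor
  · rintro (rfl | ⟨h, m, rfl⟩)
    · exact ⟨0, .inl rfl, by simp⟩
    · exact ⟨m, .inr h, by simp⟩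
  · rintro ⟨m, rfl | h, rfl⟩
    · exact .inl (by simp)
    · exact .inr ⟨h, m, by simp⟩

lemma isOpen_sameParam {V : Set ℝ} (hV : IsOpen V) (i : Fin n) :
    IsOpen {t | ∃ t' ∈ V, SameParam Λ i t t'} := by
  have : {t | ∃ t' ∈ V, SameParam Λ i t t'} =
      ⋃ m : ℤ, ⋃ _ : m = 0 ∨ i ∉ Λ, (fun t : ℝ => t - m) ⁻¹' V := by
    ext t
    simp only [sameParam_iff, mem_ofPred_eq, mem_iUnion, mem_preimage, exists_prop]
    constructor
    · rintro ⟨t', h, m, hm, rfl⟩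
      exact ⟨m, hm, h⟩
    · rintro ⟨m, hm, h⟩
      exact ⟨_, h, m, hm, rfl⟩
  rw [this]
  exact isOpen_iUnion fun m => isOpen_iUnion fun _ => hV.preimage (by fun_prop)

/-- Near a vertical line, the diagram consists of small arcs around the points on the line. -/
lemma eventually_near_line [IsManifold (𝓡∂ 2) ∞ F] [T2Space F] (he : IsPlaneEmbedding e)
    {c A B : ℝ} {K : ℕ} {j : Fin K → Fin n} {t : Fin K → ℝ} {V : Fin K → Set ℝ}
    (hV : ∀ k, V k ∈ 𝓝 (t k))
    (hall : ∀ i, ∀ s ∈ fundDomain Λ i, D.γ i s ∈ range e → planarCurve D e i s 0 = c →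
      planarCurve D e i s 1 ∈ Icc A B → ∃ k, j k = i ∧ t k = s) :
    ∀ᶠ δ in 𝓝[>] (0 : ℝ), ∀ i, ∀ s ∈ fundDomain Λ i, ∀ p : Plane, D.γ i s = e p → |p 0 - c| ≤ δ →
      p 1 ∈ Icc A B → ∃ k, j k = i ∧ ∃ t' ∈ V k, SameParam Λ i s t' := by
  rw [eventually_all]
  intro i
  set O : Set ℝ := ⋃ k, ⋃ _ : j k = i, {s | ∃ t' ∈ interior (V k), SameParam Λ i s t'}
  have hO : IsOpen O := isOpen_iUnion fun k => isOpen_iUnion fun _ =>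
    isOpen_sameParam isOpen_interior i
  set C : Set F := e '' {p | (c - 1 ≤ p 0 ∧ p 0 ≤ c + 1) ∧ (A ≤ p 1 ∧ p 1 ≤ B)} with hCdef
  have hC : IsClosed C := ((isCompact_rect _ _ _ _).image he.1.continuous).isClosed
  have hN : IsCompact ((Icc (0 : ℝ) 1 ∩ D.γ i ⁻¹' C) \ O) :=
    (isCompact_Icc.of_isClosed_subset
      ((continuousOn_gamma D i).preimage_isClosed_of_isClosed isClosed_Icc hC)
      inter_subset_left).diff hO
  have hpar : ∀ s ∈ Icc (0 : ℝ) 1, s ∈ paramDomain Λ i := fun s hs _ => hs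
  have hcont : ContinuousOn (fun s => |planarCurve D e i s 0 - c|)
      ((Icc (0 : ℝ) 1 ∩ D.γ i ⁻¹' C) \ O) := by
    rintro s ⟨⟨hs, p, hp, hps⟩, -⟩
    have h1 := (planarCurve_spec he (hpar s hs) ⟨p, hps⟩).2.1.self_of_nhds.continuousAt
    have h2 : ContinuousAt (fun s => planarCurve D e i s 0) s :=
      (contDiff_coord 0).continuous.continuousAt.comp h1
    exact (h2.sub continuousAt_const).abs.continuousWithinAt
  have hpos : ∀ s ∈ (Icc (0 : ℝ) 1 ∩ D.γ i ⁻¹' C) \ O, 0 < |planarCurve D e i s 0 - c| := by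
    rintro s ⟨⟨hs, p, hp, hps⟩, hsO⟩
    rw [abs_pos]
    intro h0
    apply hsO
    have hsame := sameParam_rep (Λ := Λ) (i := i) (t := s)
    have hγ : D.γ i (rep Λ i s) = D.γ i s := (gamma_eq_of_sameParam D hsame).symm
    have hpc : planarCurve D e i (rep Λ i s) = planarCurve D e i s := by
      simp only [planarCurve, hγ]
    have hps' : planarCurve D e i s = p := by
      simp only [planarCurve, ← hps, he.invFun_apply]
    obtain ⟨k, hk, hkt⟩ := hall i _ (rep_mem (hpar s hs)) (by rw [hγ]; exact ⟨p, hps⟩)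
      (by rw [hpc]; linarith) (by rw [hpc, hps']; exact hp.2)
    exact mem_iUnion₂.2 ⟨k, hk, t k, mem_interior_iff_mem_nhds.2 (hV k), by rwa [hkt]⟩
  obtain ⟨δ₀, hδ₀, hle⟩ := hN.exists_forall_le' hcont hpos
  filter_upwards [Ioo_mem_nhdsGT (lt_min hδ₀ one_pos)] with δ hδ s hs p hsp hp0 hp1
  by_contra hnot
  have hsO : s ∉ O := fun h => by
    obtain ⟨k, hk, t', ht', hst⟩ := mem_iUnion₂.1 h
    exact hnot ⟨k, hk, t', interior_subset ht', hst⟩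
  have h1 : δ < 1 := hδ.2.trans_le (min_le_right _ _)
  have h2 : δ < δ₀ := hδ.2.trans_le (min_le_left _ _)
  have h3 := abs_le.1 hp0
  have h4 := hle s ⟨⟨⟨hs.1, hs.2.1⟩, p, ⟨⟨by linarith, by linarith⟩, hp1⟩, hsp.symm⟩, hsO⟩
  simp only [planarCurve, hsp, he.invFun_apply] at h4
  linarith

/-- There is a box with co-oriented strands through prescribed short arcs of the diagram. -/
theorem exists_box [IsManifold (𝓡∂ 2) ∞ F] [OrientedSurface F] [T2Space F] [ConnectedSpace F]
    (D : TangleDiagram F n Λ) {m : ℕ} {i : Fin m → Fin n} {U : Fin m → Set ℝ}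
    (hU : ∀ a, IsOpen (U a)) (hne : ∀ a, (U a).Nonempty) (hU01 : ∀ a, U a ⊆ Ioo 0 1)
    (hdis : ∀ a b, a ≠ b → i a = i b → Disjoint (U a) (U b)) :
    ∃ (K : ℕ) (B : Box D K) (κ : Fin m → Fin K), ∀ a, B.comp (κ a) = i a ∧
      StrictMonoOn (B.θ (κ a)) (Icc (-1) 1) ∧ ∀ x ∈ Icc (-1 : ℝ) 1, B.θ (κ a) x ∈ U a := by
  obtain ⟨e, c, s, he, hreg, hs⟩ := exists_regularLine D hU hne hU01 hdis
  have hfund : ∀ a, s a ∈ fundDomain Λ (i a) := fun a =>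
    ⟨(hU01 a (hs a).1).1.le, (hU01 a (hs a).1).2.le, fun _ => (hU01 a (hs a).1).2⟩
  -- the finitely many points of the diagram on a segment of the line
  set R := ∑ a, |planarCurve D e (i a) (s a) 1|
  have hR : ∀ a, |planarCurve D e (i a) (s a) 1| ≤ R := fun a =>
    Finset.single_le_sum (f := fun a => |planarCurve D e (i a) (s a) 1|)
      (fun _ _ => abs_nonneg _) (Finset.mem_univ a)
  set Cr := {p : Fin n × ℝ | p.2 ∈ fundDomain Λ p.1 ∧ D.γ p.1 p.2 ∈ range e ∧
      planarCurve D e p.1 p.2 0 = c ∧ |planarCurve D e p.1 p.2 1| ≤ R + 1} with hCr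
  have hfin : Cr.Finite := hreg.finite he (R + 1)
  set YS := (fun p : Fin n × ℝ => planarCurve D e p.1 p.2 1) '' Cr
  have hYS : YS.Finite := hfin.image _
  obtain ⟨A, hA, hAY⟩ := (Ioo_infinite (show -R - 1 < -R by linarith)).exists_notMem_finite hYS
  obtain ⟨B, hB, hBY⟩ := (Ioo_infinite (show R < R + 1 by linarith)).exists_notMem_finite hYS
  have hR0 : 0 ≤ R := Finset.sum_nonneg fun _ _ => abs_nonneg _
  have hAB : A < B := by linarith [hA.2, hB.1]
  set S := (hYS.inter_of_left (Ioo A B)).toFinset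
  set y := S.orderEmbOfFin rfl with hydef
  have hyS : ∀ k, y k ∈ YS ∩ Ioo A B := fun k => by
    have := S.orderEmbOfFin_mem rfl k
    rwa [Finite.mem_toFinset] at this
  choose p hp hpy using fun k => (hyS k).1
  have hpr : ∀ k, (p k).2 ∈ paramDomain Λ (p k).1 := fun k => fundDomain_subset_paramDomain (hp k).1
  -- the points are determined by their heights, since no crossing lies on the line
  have hall : ∀ l, ∀ u ∈ fundDomain Λ l, D.γ l u ∈ range e → planarCurve D e l u 0 = c →
      planarCurve D e l u 1 ∈ Icc A B → ∃ k, (p k).1 = l ∧ (p k).2 = u := by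
    intro l u hu hur hX hY
    have hmem : (l, u) ∈ Cr := ⟨hu, hur, hX, abs_le.2 ⟨by linarith [hY.1, hA.1], by
      linarith [hY.2, hB.2]⟩⟩
    have hYm : planarCurve D e l u 1 ∈ YS := ⟨_, hmem, rfl⟩
    have hYS' : planarCurve D e l u 1 ∈ S := by
      rw [Finite.mem_toFinset]
      exact ⟨hYm, lt_of_le_of_ne hY.1 fun h => hAY (h ▸ hYm),
        lt_of_le_of_ne hY.2 fun h => hBY (h ▸ hYm)⟩
    have hrange : planarCurve D e l u 1 ∈ range y := by
      rw [hydef, Finset.range_orderEmbOfFin]; exact hYS'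
    obtain ⟨k, hk⟩ := hrange
    have hne : (l, u) = p k := by
      by_contra hne
      refine hreg.not_double l u (p k).1 (p k).2 ⟨hu, (hp k).1, hne, ?_⟩ hur hX
      rw [← apply_planarCurve hur, ← apply_planarCurve (hp k).2.1]
      exact congrArg e (plane_ext (hX.trans (hp k).2.2.1.symm) (hk.symm.trans (hpy k).symm))
    exact ⟨k, by rw [← hne], by rw [← hne]⟩
  choose κ hκ hκs using fun a => hall (i a) (s a) (hfund a) (hs a).2.1 (hs a).2.2.1
    ⟨by linarith [hA.2, (abs_le.1 (hR a)).1], by linarith [hB.1, (abs_le.1 (hR a)).2]⟩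
  -- the arcs through these points are graphs
  let W : Fin S.card → Set ℝ := fun k => {u | u ∈ paramDomain Λ (p k).1 ∧
    D.γ (p k).1 u ∈ range e ∧ ContDiffAt ℝ ∞ (planarCurve D e (p k).1) u ∧
    ∀ a, κ a = k → u ∈ U a}
  have hW : ∀ k, W k ∈ 𝓝 (p k).2 := by
    intro k
    obtain ⟨h1, h2, -⟩ := planarCurve_spec he (hpr k) (hp k).2.1
    have h3 := eventually_mem_paramDomain (mem_Ioo_of_notMem_boundary D (hpr k) (by
      obtain ⟨q, hq⟩ := (hp k).2.1
      rw [← hq]; exact he.notMem_boundary q))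
    have h4 : ∀ᶠ u in 𝓝 (p k).2, ∀ a, κ a = k → u ∈ U a := by
      rw [eventually_all]
      intro a
      by_cases h : κ a = k
      · subst h
        rw [hκs]
        filter_upwards [(hU a).mem_nhds (hs a).1] with u hu _ using hu
      · exact .of_forall fun u hu => absurd hu h
    filter_upwards [h1, h2, h3, h4] with u h1 h2 h3 h4 using ⟨h3, h1, h2, h4⟩
  have hloc := fun k => exists_localInverse (X := fun u => planarCurve D e (p k).1 u 0)
    ((planarCurve_spec he (hpr k) (hp k).2.1).2.1.mono fun u hu =>
      (contDiff_coord 0).contDiffAt.comp u hu)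
    (hreg.deriv_ne _ _ (hpr k) (hp k).2.1 (hp k).2.2.1) (hW k)
  choose g r hr hg hgX using hloc
  simp only [(hp _).2.2.1] at hg
  have hgc : ∀ k, g k c = (p k).2 := fun k => by
    have := (hgX k).self_of_nhds
    rwa [(hp k).2.2.1] at this
  obtain ⟨ρ, hρr, hρ⟩ : ∃ ρ, (∀ k, ρ < r k) ∧ 0 < ρ :=
    ((eventually_all.2 fun k =>
      (Ioo_mem_nhdsGT (hr k) : ∀ᶠ ρ in 𝓝[>] (0 : ℝ), ρ ∈ Ioo 0 (r k))).mono
      fun ρ h k => (h k).2).and self_mem_nhdsWithin |>.exists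
  replace hg := fun k x (hx : |x - c| < ρ) => hg k x (hx.trans (hρr k))
  obtain ⟨ε₀, hε₀, hstr⟩ := exists_straight he hAB hρ y.injective (fun k => (hyS k).2.1.ne')
    (fun k => (hyS k).2.2.ne) (f := fun k x => planarCurve D e (p k).1 (g k x) 1)
    (fun k x hx => (contDiff_coord 1).contDiffAt.comp x
      ((hg k x hx).1.2.2.1.comp x (hg k x hx).2.2.1))
    (fun k => by rw [hgc]; exact hpy k)
  obtain ⟨ε, ⟨hcov, hερ⟩, hεε⟩ := (((eventually_near_line he (V := fun k => {u | g k _ = u}) hgX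
    hall).and (Ioo_mem_nhdsGT hρ)).and (Ioo_mem_nhdsGT hε₀)).exists
  have hε : 0 < ε := hεε.1
  obtain ⟨E, hE, hEy, hEsq⟩ := hstr ε hε hεε.2
  have hN : 0 < (B - A) / 2 := by linarith
  have hball : ∀ x ∈ Icc (-1 : ℝ) 1, c + ε * x ∈ Ioo (c - ρ) (c + ρ) := fun x hx =>
    ⟨by nlinarith [hx.1, hερ.2], by nlinarith [hx.2, hερ.2]⟩
  have habs : ∀ x ∈ Ioo (c - ρ) (c + ρ), |x - c| < ρ := fun x hx =>
    abs_lt.2 ⟨by linarith [hx.1], by linarith [hx.2]⟩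
  have hlin : StrictMonoOn (fun x => c + ε * x) (Icc (-1) 1) := fun x _ x' _ h => by
    have := mul_lt_mul_of_pos_left h hε
    simpa using this
  have hgcont : ∀ k, ContinuousOn (g k) (Ioo (c - ρ) (c + ρ)) := fun k x hx =>
    (hg k x (habs x hx)).2.2.1.continuousAt.continuousWithinAt
  have hup : ∀ k, 0 < deriv (fun u => planarCurve D e (p k).1 u 0) (p k).2 →
      StrictMonoOn (fun x => g k (c + ε * x)) (Icc (-1) 1) := fun k hk => by
    have : StrictMonoOn (g k) (Ioo (c - ρ) (c + ρ)) :=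
      strictMonoOn_of_deriv_pos (convex_Ioo _ _) (hgcont k) fun x hx =>
        pos_of_mul_pos_left (hg k x (habs x (interior_subset hx))).2.2.2 hk.le
    exact this.comp hlin hball
  have hdown : ∀ k, deriv (fun u => planarCurve D e (p k).1 u 0) (p k).2 < 0 →
      StrictAntiOn (fun x => g k (c + ε * x)) (Icc (-1) 1) := fun k hk => by
    have : StrictAntiOn (g k) (Ioo (c - ρ) (c + ρ)) :=
      strictAntiOn_of_deriv_neg (convex_Ioo _ _) (hgcont k) fun x hx => by
        have := (hg k x (habs x (interior_subset hx))).2.2.2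
        nlinarith
    exact this.comp_strictMonoOn hlin hball
  obtain ⟨Bx, ι, hι⟩ := exists_box_of_planeEmbedding D hE
    (y := fun k => (y k - (A + B) / 2) / ((B - A) / 2))
    (fun k l hkl => by
      have := y.strictMono hkl
      simp only
      gcongr)
    (fun k => by
      have h := (hyS k).2
      rw [abs_lt, lt_div_iff₀ hN, div_lt_iff₀ hN]
      constructor <;> linarith [h.1, h.2])
    (j := fun k => (p k).1) (θ := fun k x => g k (c + ε * x))
    (fun k => (hgcont k).comp (by fun_prop) hball)
    (fun k => (lt_or_gt_of_ne (hreg.deriv_ne _ _ (hpr k) (hp k).2.1 (hp k).2.2.1)).symm.imp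
      (hup k) (hdown k))
    (fun k x hx => (hg k _ (habs _ (hball x hx))).1.1)
    (fun k x hx => by
      obtain ⟨⟨-, h1, -⟩, h2, -⟩ := hg k _ (habs _ (hball x hx))
      rw [hEy k x hx, ← apply_planarCurve h1]
      exact congrArg e (plane_ext (by simpa using h2) (by simp)))
    (fun l u hu h => by
      obtain ⟨q, hq, hqu⟩ := h
      obtain ⟨y', hy', hqe⟩ := hEsq q hq
      have hsame := sameParam_rep (Λ := Λ) (i := l) (t := u)
      have hq0 : q 0 ∈ Icc (-1 : ℝ) 1 := abs_le.1 hq.1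
      have hγ : D.γ l u = e !₂[c + ε * q 0, y'] := hqu.symm.trans hqe
      obtain ⟨k, hk, t', ht', hst⟩ := hcov l _ (rep_mem hu) !₂[c + ε * q 0, y']
        ((gamma_eq_of_sameParam D hsame).symm.trans hγ)
        (by simpa [abs_mul, abs_of_pos hε] using mul_le_of_le_one_right hε.le hq.1)
        (by simpa using hy')
      refine ⟨k, q 0, hq0, hk, ?_⟩
      have h1 : planarCurve D e l t' 0 = c + ε * q 0 := by
        rw [planarCurve, ← gamma_eq_of_sameParam D (hsame.trans hst), hγ, he.invFun_apply]
        simp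
      have h2 : g k (c + ε * q 0) = t' := by
        subst hk
        rw [← h1]; exact ht'
      rw [h2]
      exact hsame.trans hst)
  refine ⟨_, Bx, fun a => ι (κ a), fun a => ⟨(hι _).1.trans (hκ a), ?_, fun x hx => ?_⟩⟩
  · rw [(hι _).2]
    refine hup _ ?_
    rw [hκ, hκs]
    exact (hs a).2.2.2
  · rw [(hι _).2]
    exact (hg _ _ (habs _ (hball x hx))).1.2.2.2 a rfl

end Diagrams

/-! ### The combinatorics of a rough order -/

section Combinatorics

/-- The classes of a total preorder on a finite type, numbered in increasing order. -/
lemma exists_rank {α : Type*} [Fintype α] {le : α → α → Prop} (hrefl : ∀ i, le i i)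
    (htrans : ∀ i j k, le i j → le j k → le i k) (htotal : ∀ i j, le i j ∨ le j i) :
    ∃ (m : ℕ) (p : α → Fin m), Function.Surjective p ∧ ∀ i j, p i ≤ p j ↔ le i j := by
  classical
  let N : α → ℕ := fun i => (Finset.univ.filter fun j => le j i).card
  have hN : ∀ i j, N i ≤ N j ↔ le i j := by
    intro i j
    refine ⟨fun h => ?_, fun h => Finset.card_le_card fun k hk => ?_⟩
    · by_contra hij
      have hji := (htotal i j).resolve_left hij
      refine absurd h (not_le.2 (Finset.card_lt_card ⟨fun k hk => ?_, fun hsub => ?_⟩))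
      · simp only [Finset.mem_filter, Finset.mem_univ, true_and] at hk ⊢
        exact htrans _ _ _ hk hji
      · exact hij (by simpa using hsub (show i ∈ Finset.univ.filter fun j => le j i by
          simpa using hrefl i))
    · simp only [Finset.mem_filter, Finset.mem_univ, true_and] at hk ⊢
      exact htrans _ _ _ hk h
  let S := Finset.univ.image N
  have hS : ∀ i, N i ∈ S := fun i => Finset.mem_image_of_mem N (Finset.mem_univ i)
  refine ⟨S.card, fun i => (S.orderIsoOfFin rfl).symm ⟨N i, hS i⟩, fun k => ?_, fun i j => ?_⟩
  · obtain ⟨i, -, hi⟩ := Finset.mem_image.1 (S.orderIsoOfFin rfl k).2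
    exact ⟨i, by rw [OrderIso.symm_apply_eq]; exact Subtype.ext hi⟩
  · rw [OrderIso.le_iff_le, Subtype.mk_le_mk, hN]

/-- The combinatorial form of the theorem: the values `V i j o` of a rough order on the crossings
with component index `(i, j)` and order index `o` are those of some `τ^{C,ε,ω}`. -/
lemma exists_roughData {n : ℕ} {Λ : Finset (Fin n)} (V : Fin n → Fin n → ZMod 2 → ZMod 2)
    (h3 : ∀ i j k, i ≠ j → j ≠ k → i ≠ k → V i j 0 = V j k 0 → V i k 0 = V j k 0)
    (h2 : ∀ i j o, i ≠ j → (o = 1 → i ∈ Λ) → V i j 0 = V j i 0 → V i i o = V j i 0) :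
    ∃ S : RoughData n Λ, ∀ i j o, (o = 1 → i = j ∧ i ∈ Λ) → V i j o =
      if S.part i = S.part j then
        S.ε (S.part i) + (if h : i ∈ Λ then S.w ⟨i, h⟩ * o else 0)
      else if S.part j < S.part i then 0 else 1 := by
  have h01 : ∀ x : ZMod 2, x = 0 ∨ x = 1 := by decide
  let le : Fin n → Fin n → Prop := fun i j => i = j ∨ V i j 0 = 1 ∨ V j i 0 = 0
  -- the class of an element and the order of the classes: `p i ≤ p j` means `le i j`
  obtain ⟨m, p, hp, hle⟩ := exists_rank (le := le) (fun i => .inl rfl)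
    (fun i j k hij hjk => by
      rcases eq_or_ne i j with rfl | h1
      · exact hjk
      rcases eq_or_ne j k with rfl | h2'
      · exact hij
      rcases eq_or_ne i k with rfl | h4
      · exact .inl rfl
      replace hij := hij.resolve_left h1
      replace hjk := hjk.resolve_left h2'
      refine .inr ?_
      have e1 := h3 i j k h1 h2' h4
      have e2 := h3 k i j h4.symm h1 h2'.symm
      have e3 := h3 j i k h1.symm h4 h2'
      have e4 := h3 k j i h2'.symm h1.symm h4.symm
      revert e1 e2 e3 e4 hij hjk
      generalize V i j 0 = a, V j k 0 = b, V i k 0 = c, V k i 0 = d, V k j 0 = e, V j i 0 = f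
      revert a b c d e f
      decide)
    (fun i j => by
      rcases h01 (V i j 0) with h | h
      · exact .inr (.inr (.inr h))
      · exact .inl (.inr (.inl h)))
  -- in a class with several elements all values are equal
  have hcls : ∀ i j, i ≠ j → p i = p j → V i j 0 = V j i 0 := fun i j hij h => by
    have e1 := ((hle i j).1 h.le).resolve_left hij
    have e2 := ((hle j i).1 h.ge).resolve_left hij.symm
    revert e1 e2
    generalize V i j 0 = a, V j i 0 = b
    revert a b
    decide
  have hdiag : ∀ i j, p i = p j → V i i 0 = V j j 0 := fun i j h => by
    rcases eq_or_ne i j with rfl | hij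
    · rfl
    have e := hcls i j hij h
    rw [h2 i j 0 hij (fun h => absurd h (by decide)) e,
      h2 j i 0 hij.symm (fun h => absurd h (by decide)) e.symm, e]
  obtain ⟨r, hr⟩ := hp.hasRightInverse
  -- `ω_i` is the difference of the two values on the self-crossings of `i`
  refine ⟨⟨m, p, hp, fun k => V (r k) (r k) 0, fun i => V i i 1 + V i i 0, fun i hi j hj => ?_⟩,
    fun i j o ho => ?_⟩
  · by_contra hne
    have e := hcls i j (Ne.symm hne) hj.symm
    rw [h2 i j 1 (Ne.symm hne) (fun _ => i.2) e,
      h2 i j 0 (Ne.symm hne) (fun h => absurd h (by decide)) e, CharTwo.add_self_eq_zero] at hi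
    exact absurd hi (by decide)
  · have hε : V (r (p i)) (r (p i)) 0 = V i i 0 := hdiag _ _ (hr (p i))
    simp only [hε]
    rcases eq_or_ne i j with rfl | hij
    · rw [if_pos rfl]
      rcases h01 o with rfl | rfl
      · simp
      · rw [dif_pos (ho rfl).2, mul_one, add_left_comm, CharTwo.add_self_eq_zero, add_zero]
    · have ho0 : o = 0 := (h01 o).resolve_right fun h => hij (ho h).1
      subst ho0
      rcases lt_trichotomy (p i) (p j) with h | h | h
      · rw [if_neg h.ne, if_neg h.not_gt]
        by_contra hv
        exact absurd ((hle j i).2 (.inr (.inr ((h01 _).resolve_right hv)))) (not_le.2 h)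
      · have e := hcls i j hij h
        rw [if_pos h, h2 i j 0 hij (fun h => absurd h (by decide)) e, e]
        simp
      · rw [if_neg h.ne', if_pos h]
        by_contra hv
        exact absurd ((hle i j).2 (.inr (.inl ((h01 _).resolve_left hv)))) (not_le.2 h)

end Combinatorics

/-! ### Triangles with prescribed components -/

section Diagrams

variable {F : Type*} [TopologicalSpace F] [ChartedSpace (EuclideanHalfSpace 2) F]
  {n : ℕ} {Λ : Finset (Fin n)} {T : TangleDiagram F n Λ}

lemma Crossing.orderIndex_of_ne {D : TangleDiagram F n Λ} {c : Crossing D}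
    (h : c.overComp ≠ c.underComp) : c.orderIndex = 0 := if_neg fun h' => h h'.1

/-- For given components `i`, `j`, `k`, some diagram of the tangle contains a triangle with upper
strand in `i`, middle strand in `j` and lower strand in `k`. If `i = k` is a long component, the
order index of the crossing of the outer strands can be prescribed. -/
lemma IsOrder.exists_triangle [IsManifold (𝓡∂ 2) ∞ F] [OrientedSurface F] [T2Space F]
    [ConnectedSpace F] {τ : Labelling T (ZMod 2)} (hτ : IsOrder τ) {i j k : Fin n} (hij : i ≠ j)
    (hjk : j ≠ k) {o : ZMod 2} (ho : o = 1 → i = k ∧ i ∈ Λ) :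
    ∃ (D : DiagramsOf T) (c₁ c₂ c₃ : Crossing D.1), c₁.componentIndex = (i, j) ∧
      c₂.componentIndex = (i, k) ∧ c₂.orderIndex = o ∧ c₃.componentIndex = (j, k) ∧
      ¬ (τ D c₁ = τ D c₃ ∧ τ D c₃ ≠ τ D c₂) := by
  classical
  -- the arcs on `i` and `k` are placed so that the crossing of the outer strands has order
  -- index `o`
  set U : Fin 3 → Set ℝ := ![if o = 1 then Ioo 0 (1 / 2) else Ioo (1 / 2) 1, Ioo 0 1,
    if o = 1 then Ioo (1 / 2) 1 else Ioo 0 (1 / 2)] with hU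
  have hopen : ∀ a, IsOpen (U a) := by
    intro a
    fin_cases a <;> simp only [hU] <;> dsimp <;> (try split_ifs) <;> exact isOpen_Ioo
  have hne : ∀ a, (U a).Nonempty := by
    intro a
    fin_cases a <;> simp only [hU] <;> dsimp <;> (try split_ifs) <;>
      exact nonempty_Ioo.2 (by norm_num)
  have hU01 : ∀ a, U a ⊆ Ioo 0 1 := by
    intro a
    fin_cases a <;> simp only [hU] <;> dsimp <;> (try split_ifs) <;>
      exact Ioo_subset_Ioo (by norm_num) (by norm_num)
  have hlow : Disjoint (Ioo (0 : ℝ) (1 / 2)) (Ioo (1 / 2) 1) :=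
    Set.disjoint_left.2 fun x hx hx' => lt_asymm hx.2 hx'.1
  have h20 : Disjoint (U 2) (U 0) := by
    simp only [hU]
    dsimp
    split_ifs
    · exact hlow.symm
    · exact hlow
  have hdis : ∀ a b : Fin 3, a ≠ b →
      (![k, j, i] : Fin 3 → Fin n) a = (![k, j, i] : Fin 3 → Fin n) b →
      Disjoint (U a) (U b) := by
    intro a b hab h
    fin_cases a <;> fin_cases b <;> first
      | exact absurd rfl hab
      | exact h20
      | exact h20.symm
      | exact absurd h hij
      | exact absurd h hij.symm
      | exact absurd h hjk
      | exact absurd h hjk.symm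
  obtain ⟨K, B, κ, hκ⟩ := exists_box T hopen hne hU01 hdis
  have hκinj : Function.Injective κ := by
    intro a b hab
    by_contra hne
    have h0 : (0 : ℝ) ∈ Icc (-1 : ℝ) 1 := by norm_num
    refine Set.disjoint_left.1 (hdis a b hne ?_) ((hκ a).2.2 0 h0) ?_
    · rw [← (hκ a).1, hab, (hκ b).1]
    · rw [hab]; exact (hκ b).2.2 0 h0
  have hK : 3 ≤ K := by simpa using Fintype.card_le_of_injective κ hκinj
  -- the three chosen strands are moved to the bottom of the box
  obtain ⟨π, hπ⟩ : ∃ π : Equiv.Perm (Fin K), π • Fin.castLEEmb hK = (⟨κ, hκinj⟩ : Fin 3 ↪ Fin K) :=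
    Equiv.Perm.exists_smul_eq_embedding _ _
  have hπκ : ∀ a, π (Fin.castLE hK a) = κ a := fun a => DFunLike.congr_fun hπ a
  obtain ⟨D', B', hD', hB'⟩ := B.exists_permute π
  obtain ⟨B₃, hB₃⟩ := B'.exists_lowest hK
  have href := hB₃.trans hB'
  have hcomp : ∀ a, B₃.comp a = (![k, j, i] : Fin 3 → Fin n) a := fun a => by
    rw [href.comp_eq, Function.comp_apply, hπκ, (hκ a).1]
  have hrange : ∀ a, ∀ x ∈ Icc (-1 : ℝ) 1, B₃.θ a x ∈ U a := fun a x hx => by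
    obtain ⟨x', hx', h⟩ := href.range a x hx
    rw [h, Function.comp_apply, hπκ]
    exact (hκ a).2.2 x' hx'
  obtain ⟨D, c₁, c₂, c₃, h1, h2, h3, hnot⟩ := B₃.exists_triangle hτ hD'
    (fun a => href.mono a (by rw [Function.comp_apply, hπκ]; exact (hκ a).2.1))
    (fun a x hx => by
      have := hU01 a (hrange a x hx)
      exact ⟨this.1.le, this.2.le, fun _ => this.2⟩)
  have hc0 : B₃.comp 0 = k := hcomp 0
  have hc1 : B₃.comp 1 = j := hcomp 1
  have hc2 : B₃.comp 2 = i := hcomp 2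
  refine ⟨D, c₁, c₂, c₃, ?_, ?_, ?_, ?_, hnot⟩
  · rw [Crossing.componentIndex, h1.overComp_eq, h1.underComp_eq, hc1, hc2]
  · rw [Crossing.componentIndex, h2.overComp_eq, h2.underComp_eq, hc0, hc2]
  · obtain ⟨x, hx, hover⟩ := h2.overTime
    obtain ⟨y, hy, hunder⟩ := h2.underTime
    have hx2 := hrange 2 x hx
    have hy0 := hrange 0 y hy
    rw [← hover] at hx2
    rw [← hunder] at hy0
    simp only [hU] at hx2 hy0
    dsimp at hx2 hy0
    rw [Crossing.orderIndex, h2.overComp_eq, h2.underComp_eq, hc0, hc2]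
    by_cases ho1 : o = 1
    · rw [if_pos ho1] at hx2 hy0
      rw [if_pos ⟨(ho ho1).1, (ho ho1).2, hy0.2.trans hx2.1⟩, ho1]
    · rw [if_neg ho1] at hx2 hy0
      rw [if_neg fun h => lt_asymm h.2.2 (hx2.2.trans hy0.1)]
      have h01 : ∀ x : ZMod 2, x ≠ 1 → 0 = x := by decide
      exact h01 o ho1
  · rw [Crossing.componentIndex, h3.overComp_eq, h3.underComp_eq, hc0, hc1]

end Diagrams

end Tangle

theorem mainTheorem7 {F : Type*} [TopologicalSpace F] [T2Space F] [CompactSpace F]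
    [ConnectedSpace F] [ChartedSpace (EuclideanHalfSpace 2) F] [IsManifold (𝓡∂ 2) ∞ F]
    [OrientedSurface F] (n : ℕ) (Λ : Finset (Fin n)) (T : TangleDiagram F n Λ)
    (τ : Labelling T (ZMod 2)) (hτ : IsRoughOrder τ) :
    ∃ S : RoughData n Λ, τ = S.label T := by
  classical
  -- the common value of `τ` on the crossings with given component and order indices
  let V : Fin n → Fin n → ZMod 2 → ZMod 2 := fun i j o =>
    if crossingSet τ i j o 1 = ∅ then 0 else 1
  have hV : ∀ (D : DiagramsOf T) (c : Crossing D.1),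
      τ D c = V c.overComp c.underComp c.orderIndex := by
    intro D c
    have hmem : (⟨D, c⟩ : Σ D : DiagramsOf T, Crossing D.1) ∈
        crossingSet τ c.overComp c.underComp c.orderIndex (τ D c) := ⟨rfl, rfl, rfl⟩
    have h01 : ∀ x : ZMod 2, x = 0 ∨ x = 1 := by decide
    rcases h01 (τ D c) with h | h <;> rw [h] at hmem ⊢
    · have h1 := (hτ.rough c.overComp c.underComp c.orderIndex).resolve_left
        (nonempty_of_mem hmem).ne_empty
      simp only [V, if_pos h1]
    · simp only [V, if_neg (nonempty_of_mem hmem).ne_empty]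
  have htri : ∀ i j k o, i ≠ j → j ≠ k → (o = 1 → i = k ∧ i ∈ Λ) → V i j 0 = V j k 0 →
      V i k o = V j k 0 := by
    intro i j k o hij hjk ho h
    obtain ⟨D, c₁, c₂, c₃, h1, h2, h2o, h3, hnot⟩ := hτ.toIsOrder.exists_triangle hij hjk ho
    obtain ⟨h1a, h1b⟩ := Prod.mk.inj h1
    obtain ⟨h2a, h2b⟩ := Prod.mk.inj h2
    obtain ⟨h3a, h3b⟩ := Prod.mk.inj h3
    have ho1 : c₁.orderIndex = 0 := Crossing.orderIndex_of_ne (by rwa [h1a, h1b])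
    have ho3 : c₃.orderIndex = 0 := Crossing.orderIndex_of_ne (by rwa [h3a, h3b])
    rw [hV, hV, hV, h1a, h1b, h2a, h2b, h3a, h3b, h2o, ho1, ho3] at hnot
    by_contra hne
    exact hnot ⟨h, fun h' => hne h'.symm⟩
  obtain ⟨S, hS⟩ := exists_roughData V
    (fun i j k hij hjk _ => htri i j k 0 hij hjk fun h => absurd h (by decide))
    (fun i j o hij ho => htri i j i o hij hij.symm fun h => ⟨rfl, ho h⟩)
  refine ⟨S, funext fun D => funext fun c => ?_⟩
  rw [hV, hS _ _ _ fun h => ?_]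
  · rfl
  · by_contra hne
    rw [Crossing.orderIndex, if_neg fun h' => hne ⟨h'.1, h'.2.1⟩] at h
    exact absurd h (by decide)
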